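/- **Setting.** Let $K$ be a connected compact metrizable space, $N\ge 2$, $S=\{1,\dots,N\}$, $\psi_i\colon K\to K$ ($i\in S$) continuous injective maps, $\Sigma=S^{\mathbb N}$, $\sigma_i(\omega_1\omega_2\cdots)=i\omega_1\omega_2\cdots$, and $\pi\colon\Sigma\to K$ a continuous surjection with $\psi_i\circ\pi=\pi\circ\sigma_i$ for all $i$. For a word $w=w_1\cdots w_m\in W_m=S^m$ ($m\ge 0$) put $\psi_w=\psi_{w_1}\circ\cdots\circ\psi_{w_m}$ (the identity if $m=0$), $\psi_w^*f=f\circ\psi_w$, and let $\Sigma_w\subset\Sigma$ be the set of sequences beginning with $w$. Let $\sigma^m$ be the $m$-fold left shift on $\Sigma$. Assume that the structure is post-critically finite: $\mathcal P=\bigcup_{m\ge1}\sigma^m\bigl(\pi^{-1}(\bigcup_{i\ne j}\psi_i(K)\cap\psi_j(K))\bigr)$ is finite. Let $V_0=\pi(\mathcal P)$ and $V_m=\bigcup_{w\in W_m}\psi_w(V_0)$. Assume moreover that each $p\in V_0$ is a fixed point of some $\psi_i$ and that $K\setminus\{p\}$ is connected. Let $(D,r)$ be a regular harmonic structure: $D$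 is a real symmetric $V_0\times V_0$ matrix that is nonpositive definite, with $Du=0$ if and only if $u$ is constant, and with nonnegative off-diagonal entries; $r=(r_i)_{i\in S}$ with $0<r_i<1$; and, with $r_w=r_{w_1}\cdots r_{w_m}$, $\mathcal E^{(0)}(u,v)=(-Du,v)$ and $$\mathcal E^{(m)}(u,v)=\sum_{w\in W_m}\frac1{r_w}\,\mathcal E^{(0)}\bigl(u\circ\psi_w|_{V_0},\,v\circ\psi_w|_{V_0}\bigr),$$ one has $\mathcal E^{(0)}(u,u)=\inf\{\mathcal E^{(1)}(v,v): v\colon V_1\to\mathbb R,\ v|_{V_0}=u\}$ for every $u\colon V_0\to\mathbb R$. Let $\mathcal F=\{u\in C(K):\lim_m\mathcal E^{(m)}(u|_{V_m},u|_{V_m})<\infty\}$ and, for $u,v\in\mathcal F$, $\mathcal E(u,v)=\lim_m\mathcal E^{(m)}(u|_{V_m},v|_{V_m})$, $\mathcal E(u)=\mathcal E(u,u)$. A function $h\in\mathcal F$ is harmonic if $\mathcal E(h)\le\mathcal E(g)$ for every $g\in\mathcal F$ with $g|_{V_0}=h|_{V_0}$; a function $f\in\mathcal F$ is piecewise harmonic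 if for some $m\ge0$ all $\psi_w^*f$, $w\in W_m$, are harmonic. For $f\in\mathcal F$ let $\lambda_{\langle f\rangle}$ be the unique finite Borel measure on $\Sigma$ with $\lambda_{\langle f\rangle}(\Sigma_w)=\frac{2}{r_w}\,\mathcal E(\psi_w^*f)$ for all words $w$, and for $f,g\in\mathcal F$ let $\lambda_{\langle f,g\rangle}=\frac14(\lambda_{\langle f+g\rangle}-\lambda_{\langle f-g\rangle})$. **Proposition.** Let $I$ be a countable set, let $(e_i)_{i\in I}$ be piecewise harmonic functions with $2\mathcal E(e_i)=1$ for all $i$, and let $(a_i)_{i\in I}$ be positive reals with $\sum_{i\in I}a_i=1$. Put $\lambda=\sum_{i\in I}a_i\lambda_{\langle e_i\rangle}$. Then every $\lambda_{\langle e_i,e_j\rangle}$ is absolutely continuous with respect to $\lambda$, and there are measurable functions $\zeta_i\colon\Sigma\to\mathbb R$ ($i\in I$) such that for all $i,j\in I$ the Radon–Nikodym derivative $Z^{i,j}=d\lambda_{\langle e_i,e_j\rangle}/d\lambda$ satisfies $$Z^{i,j}(\omega)=\zeta_i(\omega)\,\zeta_j(\omega)\qquad\text{for }\lambda\text{-a.e.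 }\omega\in\Sigma .$$ In particular, for $\lambda$-a.e. $\omega$ the matrix $(Z^{i,j}(\omega))_{i,j\in I}$ has rank one (its columns span a one-dimensional space). -/

import Mathlib

open MeasureTheory Filter Topology
open scoped ENNReal Matrix

noncomputable section

/-! ### Self-similar structures -/

/-- The map `σ_i : Σ → Σ`, `σ_i (ω₁ ω₂ ⋯) = i ω₁ ω₂ ⋯` on the shift space `Σ = S^ℕ`
(sequences are indexed from `0` here). -/
def consSeq {N : ℕ} (i : Fin N) (ω : ℕ → Fin N) : ℕ → Fin N
  | 0 => i
  | n + 1 => ω n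

/-- The iterated shift `σ^m (ω₁ ω₂ ⋯) = ω_{m+1} ω_{m+2} ⋯`. -/
def shiftSeq {N : ℕ} (m : ℕ) (ω : ℕ → Fin N) : ℕ → Fin N := fun n => ω (n + m)

/-- The cylinder set `Σ_w`: all sequences that begin with the finite word `w`. -/
def wordCylinder {N : ℕ} (w : List (Fin N)) : Set (ℕ → Fin N) :=
  {ω | ∀ k : Fin w.length, ω k = w.get k}

/-- A self-similar structure `(K, S, {ψ_i})` with `S` of size `N ≥ 2`, together with its coding map
`π : Σ → K`. -/
structure SelfSimilarStructure (K : Type*) [TopologicalSpace K] (N : ℕ) where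
  two_le : 2 ≤ N
  ψ : Fin N → C(K, K)
  ψ_injective : ∀ i, Function.Injective (ψ i)
  π : C(ℕ → Fin N, K)
  π_surjective : Function.Surjective π
  ψ_π : ∀ (i : Fin N) (ω : ℕ → Fin N), ψ i (π ω) = π (consSeq i ω)

namespace SelfSimilarStructure

variable {K : Type*} [TopologicalSpace K] {N : ℕ}

/-- `ψ_w = ψ_{w₁} ∘ ⋯ ∘ ψ_{w_m}` for a finite word `w = w₁ ⋯ w_m`. -/
def wordMap (L : SelfSimilarStructure K N) (w : List (Fin N)) : C(K, K) :=
  w.foldr (fun i g => (L.ψ i).comp g) (ContinuousMap.id K)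

/-- The union of all `K_i ∩ K_j` with `i ≠ j`, where `K_i = ψ_i(K)`. -/
def overlap (L : SelfSimilarStructure K N) : Set K :=
  ⋃ (i : Fin N) (j : Fin N) (_ : i ≠ j), Set.range (L.ψ i) ∩ Set.range (L.ψ j)

/-- The post-critical set `𝒫 = ⋃_{m ≥ 1} σ^m (π⁻¹ (⋃_{i ≠ j} K_i ∩ K_j))`. -/
def postCritical (L : SelfSimilarStructure K N) : Set (ℕ → Fin N) :=
  ⋃ (m : ℕ) (_ : 1 ≤ m), shiftSeq m '' (L.π ⁻¹' L.overlap)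

/-- The boundary `V₀ = π(𝒫)`. -/
def V0 (L : SelfSimilarStructure K N) : Set K := L.π '' L.postCritical

end SelfSimilarStructure

/-- A post-critically finite self-similar structure. -/
structure PCFStructure (K : Type*) [TopologicalSpace K] (N : ℕ) extends
    SelfSimilarStructure K N where
  finite_postCritical : toSelfSimilarStructure.postCritical.Finite

namespace PCFStructure

variable {K : Type*} [TopologicalSpace K] {N : ℕ}

instance fintypeV0 (L : PCFStructure K N) : Fintype L.V0 :=
  (L.finite_postCritical.image L.π).fintype

/-- `ℰ⁽⁰⁾(u, v) = (-D u, v)` on `l(V₀)`. -/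
def energy0 (L : PCFStructure K N) (D : Matrix L.V0 L.V0 ℝ) (u v : L.V0 → ℝ) : ℝ :=
  -(D *ᵥ u) ⬝ᵥ v

/-- `ℰ⁽ᵐ⁾(u, v) = ∑_{w ∈ W_m} r_w⁻¹ ℰ⁽⁰⁾(u ∘ ψ_w|_{V₀}, v ∘ ψ_w|_{V₀})`. The functions are given on
all of `K`, but only their values on `V_m = ⋃_{w ∈ W_m} ψ_w(V₀)` matter. -/
def discreteEnergy (L : PCFStructure K N) (D : Matrix L.V0 L.V0 ℝ) (r : Fin N → ℝ) (m : ℕ)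
    (u v : K → ℝ) : ℝ :=
  ∑ w : Fin m → Fin N, ((List.ofFn w).map r).prod⁻¹ *
    L.energy0 D (fun p => u (L.wordMap (List.ofFn w) p)) (fun p => v (L.wordMap (List.ofFn w) p))

end PCFStructure

/-- A harmonic structure `(D, r)`: `D` satisfies (D1)-(D3), all `r_i` are positive, and
`ℰ⁽⁰⁾(u, u) = inf {ℰ⁽¹⁾(v, v) | v|_{V₀} = u}` for every `u`. -/
structure HarmonicStructure {K : Type*} [TopologicalSpace K] {N : ℕ} (L : PCFStructure K N) where
  D : Matrix L.V0 L.V0 ℝ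
  r : Fin N → ℝ
  D_symm : D.IsSymm
  D_nonpos : ∀ u : L.V0 → ℝ, (D *ᵥ u) ⬝ᵥ u ≤ 0
  D_ker : ∀ u : L.V0 → ℝ, D *ᵥ u = 0 ↔ ∃ c : ℝ, ∀ p, u p = c
  D_offDiag : ∀ p q : L.V0, p ≠ q → 0 ≤ D p q
  r_pos : ∀ i, 0 < r i
  isGLB_energy : ∀ u : L.V0 → ℝ,
    IsGLB {x : ℝ | ∃ v : K → ℝ, (∀ p : L.V0, v p = u p) ∧ x = L.discreteEnergy D r 1 v v}
      (L.energy0 D u u)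

namespace HarmonicStructure

variable {K : Type*} [TopologicalSpace K] {N : ℕ} {L : PCFStructure K N}

/-- A harmonic structure is regular if `0 < r_i < 1` for all `i`. -/
def IsRegular (H : HarmonicStructure L) : Prop := ∀ i, H.r i < 1

/-- `ℰ⁽ᵐ⁾` of the harmonic structure. -/
def E (H : HarmonicStructure L) (m : ℕ) (u v : K → ℝ) : ℝ := L.discreteEnergy H.D H.r m u v

/-- `r_w = r_{w₁} ⋯ r_{w_m}`. -/
def rWord (H : HarmonicStructure L) (w : List (Fin N)) : ℝ := (w.map H.r).prod

lemma E_def (H : HarmonicStructure L) (m : ℕ) (u v : K → ℝ) :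
    H.E m u v = ∑ w : Fin m → Fin N, (H.rWord (List.ofFn w))⁻¹ *
      L.energy0 H.D (fun p => u (L.wordMap (List.ofFn w) p))
        (fun p => v (L.wordMap (List.ofFn w) p)) := rfl

lemma rWord_pos (H : HarmonicStructure L) (w : List (Fin N)) : 0 < H.rWord w := by
  induction w with
  | nil => simp [rWord]
  | cons i w ih =>
    have := H.r_pos i
    simp only [rWord, List.map_cons, List.prod_cons] at ih ⊢
    positivity

lemma rWord_cons (H : HarmonicStructure L) (i : Fin N) (w : List (Fin N)) :
    H.rWord (i :: w) = H.r i * H.rWord w := by simp [rWord]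

lemma rWord_append (H : HarmonicStructure L) (w : List (Fin N)) (i : Fin N) :
    H.rWord (w ++ [i]) = H.rWord w * H.r i := by simp [rWord]

lemma wordMap_append (L : SelfSimilarStructure K N) (w : List (Fin N)) (i : Fin N) :
    L.wordMap (w ++ [i]) = (L.wordMap w).comp (L.ψ i) := by
  induction w with
  | nil => ext; simp [SelfSimilarStructure.wordMap]
  | cons j w ih =>
    simp only [SelfSimilarStructure.wordMap, List.cons_append, List.foldr_cons] at ih ⊢
    rw [ih]; rfl

lemma energy0_nonneg (H : HarmonicStructure L) (u : L.V0 → ℝ) : 0 ≤ L.energy0 H.D u u := by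
  have := H.D_nonpos u
  simp only [PCFStructure.energy0, neg_dotProduct]; linarith

lemma E_nonneg (H : HarmonicStructure L) (m : ℕ) (u : K → ℝ) : 0 ≤ H.E m u u := by
  rw [E_def]
  exact Finset.sum_nonneg fun w _ =>
    mul_nonneg (inv_nonneg.2 (H.rWord_pos _).le) (H.energy0_nonneg _)

lemma E_zero (H : HarmonicStructure L) (u : K → ℝ) :
    H.E 0 u u = L.energy0 H.D (fun p => u p) (fun p => u p) := by
  rw [E_def]; simp [rWord, SelfSimilarStructure.wordMap]

lemma E_succ_cons (H : HarmonicStructure L) (m : ℕ) (u : K → ℝ) :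
    H.E (m + 1) u u = ∑ i, (H.r i)⁻¹ * H.E m (fun x => u (L.ψ i x)) (fun x => u (L.ψ i x)) := by
  simp only [E_def]
  rw [← (Fin.consEquiv (fun _ : Fin (m + 1) => Fin N)).sum_comp, Fintype.sum_prod_type]
  refine Finset.sum_congr rfl fun i _ => ?_
  rw [Finset.mul_sum]
  refine Finset.sum_congr rfl fun w _ => ?_
  have h : List.ofFn ((Fin.consEquiv (fun _ : Fin (m + 1) => Fin N)) (i, w))
      = i :: List.ofFn w := by simp [Fin.consEquiv]
  rw [h, rWord_cons, mul_inv, mul_assoc]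
  rfl

lemma E_le_succ (H : HarmonicStructure L) (m : ℕ) (u : K → ℝ) : H.E m u u ≤ H.E (m + 1) u u := by
  induction m generalizing u with
  | zero =>
    rw [E_zero]
    exact (H.isGLB_energy (fun p => u p)).1 ⟨u, fun _ => rfl, rfl⟩
  | succ m ih =>
    rw [E_succ_cons, E_succ_cons H (m + 1)]
    exact Finset.sum_le_sum fun i _ =>
      mul_le_mul_of_nonneg_left (ih _) (inv_nonneg.2 (H.r_pos i).le)

lemma E_add_add_sub (H : HarmonicStructure L) (m : ℕ) (u v : K → ℝ) :
    H.E m (u + v) (u + v) + H.E m (u - v) (u - v) = 2 * H.E m u u + 2 * H.E m v v := by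
  simp only [E_def, Finset.mul_sum, ← Finset.sum_add_distrib]
  refine Finset.sum_congr rfl fun w _ => ?_
  set a : L.V0 → ℝ := fun p => u (L.wordMap (List.ofFn w) p)
  set b : L.V0 → ℝ := fun p => v (L.wordMap (List.ofFn w) p)
  have h1 : (fun p : L.V0 => (u + v) (L.wordMap (List.ofFn w) p)) = a + b := rfl
  have h2 : (fun p : L.V0 => (u - v) (L.wordMap (List.ofFn w) p)) = a - b := rfl
  rw [h1, h2]
  simp only [PCFStructure.energy0, Matrix.mulVec_add, Matrix.mulVec_sub, neg_dotProduct,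
    add_dotProduct, sub_dotProduct, dotProduct_add, dotProduct_sub]
  ring

lemma E_smul (H : HarmonicStructure L) (m : ℕ) (c : ℝ) (u : K → ℝ) :
    H.E m (c • u) (c • u) = c ^ 2 * H.E m u u := by
  simp only [E_def, Finset.mul_sum]
  refine Finset.sum_congr rfl fun w _ => ?_
  set a : L.V0 → ℝ := fun p => u (L.wordMap (List.ofFn w) p)
  have h1 : (fun p : L.V0 => (c • u) (L.wordMap (List.ofFn w) p)) = c • a := rfl
  rw [h1]
  simp only [PCFStructure.energy0, Matrix.mulVec_smul, neg_dotProduct,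
    smul_dotProduct, dotProduct_smul, smul_eq_mul]
  ring

lemma exists_tendsto_E (H : HarmonicStructure L) (u : K → ℝ) (B : ℝ) (hB : ∀ m, H.E m u u ≤ B) :
    ∃ l : ℝ, Tendsto (fun m => H.E m u u) atTop (𝓝 l) :=
  ⟨_, tendsto_atTop_ciSup (monotone_nat_of_le_succ fun m => H.E_le_succ m u)
    ⟨B, by rintro _ ⟨m, rfl⟩; exact hB m⟩⟩

lemma exists_bound_E (H : HarmonicStructure L) (u : K → ℝ)
    (h : ∃ l : ℝ, Tendsto (fun m => H.E m u u) atTop (𝓝 l)) : ∃ B, ∀ m, H.E m u u ≤ B := by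
  obtain ⟨l, hl⟩ := h
  exact ⟨l, fun m => (monotone_nat_of_le_succ fun m => H.E_le_succ m u).ge_of_tendsto hl m⟩

/-! ### The Dirichlet form -/

/-- The domain `ℱ = {u ∈ C(K) | lim_m ℰ⁽ᵐ⁾(u|_{V_m}, u|_{V_m}) < ∞}`. -/
def domain (H : HarmonicStructure L) : Submodule ℝ C(K, ℝ) where
  carrier := {u | ∃ l : ℝ, Tendsto (fun m => H.E m u u) atTop (𝓝 l)}
  zero_mem' := by
    refine ⟨0, ?_⟩
    have h : ∀ m, H.E m ((0 : C(K, ℝ)) : K → ℝ) ((0 : C(K, ℝ)) : K → ℝ) = 0 := fun m => by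
      have := H.E_smul m 0 ((0 : C(K, ℝ)) : K → ℝ)
      simpa using this
    simp only [h]
    exact tendsto_const_nhds
  add_mem' := by
    intro u v hu hv
    obtain ⟨A, hA⟩ := H.exists_bound_E _ hu
    obtain ⟨B, hB⟩ := H.exists_bound_E _ hv
    refine H.exists_tendsto_E _ (2 * A + 2 * B) fun m => ?_
    have h := H.E_add_add_sub m u v
    have h' := H.E_nonneg m ((u : K → ℝ) - v)
    have := hA m
    have := hB m
    rw [ContinuousMap.coe_add]
    linarith
  smul_mem' := by
    intro c u hu
    obtain ⟨A, hA⟩ := H.exists_bound_E _ hu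
    refine H.exists_tendsto_E _ (c ^ 2 * A) fun m => ?_
    rw [ContinuousMap.coe_smul, E_smul]
    exact mul_le_mul_of_nonneg_left (hA m) (sq_nonneg c)

/-- `ℰ(u, v) = lim_m ℰ⁽ᵐ⁾(u|_{V_m}, v|_{V_m})`, meant for `u, v ∈ ℱ`, where the limit exists. -/
def energy (H : HarmonicStructure L) (u v : C(K, ℝ)) : ℝ :=
  limUnder atTop (fun m => H.E m u v)

/-- A harmonic function: `h ∈ ℱ` that minimizes the energy among all `g ∈ ℱ` with the same values
on `V₀`. -/
def IsHarmonic (H : HarmonicStructure L) (h : C(K, ℝ)) : Prop :=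
  h ∈ H.domain ∧ ∀ g ∈ H.domain, (∀ p ∈ L.V0, g p = h p) → H.energy h h ≤ H.energy g g

/-- A piecewise harmonic function: `f ∈ ℱ` such that, for some `m`, the pullback `ψ_w^* f` is
harmonic for all words `w` of length `m`. -/
def IsPiecewiseHarmonic (H : HarmonicStructure L) (f : C(K, ℝ)) : Prop :=
  f ∈ H.domain ∧ ∃ m : ℕ, ∀ w : List (Fin N), w.length = m → H.IsHarmonic (f.comp (L.wordMap w))

lemma tendsto_energy (H : HarmonicStructure L) {u : C(K, ℝ)} (hu : u ∈ H.domain) :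
    Tendsto (fun m => H.E m u u) atTop (𝓝 (H.energy u u)) :=
  tendsto_nhds_limUnder hu

lemma energy_nonneg (H : HarmonicStructure L) {u : C(K, ℝ)} (hu : u ∈ H.domain) :
    0 ≤ H.energy u u :=
  ge_of_tendsto' (H.tendsto_energy hu) fun m => H.E_nonneg m u

lemma comp_ψ_mem (H : HarmonicStructure L) {u : C(K, ℝ)} (hu : u ∈ H.domain) (i : Fin N) :
    u.comp (L.ψ i) ∈ H.domain := by
  obtain ⟨B, hB⟩ := H.exists_bound_E _ hu
  refine H.exists_tendsto_E _ (H.r i * B) fun m => ?_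
  have h := hB (m + 1)
  rw [E_succ_cons] at h
  have h2 := (Finset.single_le_sum (f := fun i => (H.r i)⁻¹ *
    H.E m (fun x => u (L.ψ i x)) (fun x => u (L.ψ i x)))
    (fun i _ => mul_nonneg (inv_nonneg.2 (H.r_pos i).le) (H.E_nonneg _ _))
    (Finset.mem_univ i)).trans h
  have h3 : H.E m (u.comp (L.ψ i)) (u.comp (L.ψ i)) =
      H.r i * ((H.r i)⁻¹ * H.E m (fun x => u (L.ψ i x)) (fun x => u (L.ψ i x))) := by
    rw [mul_inv_cancel_left₀ (H.r_pos i).ne']; rfl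
  rw [h3]
  exact mul_le_mul_of_nonneg_left h2 (H.r_pos i).le

lemma comp_wordMap_mem (H : HarmonicStructure L) {u : C(K, ℝ)} (hu : u ∈ H.domain)
    (w : List (Fin N)) : u.comp (L.wordMap w) ∈ H.domain := by
  induction w using List.reverseRecOn with
  | nil => exact hu
  | append_singleton w i ih => rw [wordMap_append]; exact H.comp_ψ_mem ih i

lemma energy_selfSimilar (H : HarmonicStructure L) {u : C(K, ℝ)} (hu : u ∈ H.domain) :
    H.energy u u = ∑ i, (H.r i)⁻¹ * H.energy (u.comp (L.ψ i)) (u.comp (L.ψ i)) := by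
  refine tendsto_nhds_unique ((tendsto_add_atTop_iff_nat 1).2 (H.tendsto_energy hu)) ?_
  simp only [E_succ_cons]
  exact tendsto_finsetSum _ fun i _ => (H.tendsto_energy (H.comp_ψ_mem hu i)).const_mul _

end HarmonicStructure

/-! ### Extension of consistent families on the shift space -/

namespace ShiftSpace

variable {N : ℕ}

/-- Sets that depend on the first `n` coordinates only. -/
def dependsOnFirst (n : ℕ) (s : Set (ℕ → Fin N)) : Prop :=
  ∀ ω ω' : ℕ → Fin N, (∀ k < n, ω k = ω' k) → ω ∈ s → ω' ∈ s

/-- The ring of sets that depend on finitely many coordinates. -/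
def finiteSets (N : ℕ) : Set (Set (ℕ → Fin N)) := {s | ∃ n, dependsOnFirst n s}

lemma dependsOnFirst.mono {n m : ℕ} (h : n ≤ m) {s : Set (ℕ → Fin N)} (hs : dependsOnFirst n s) :
    dependsOnFirst m s := fun ω ω' hω => hs ω ω' fun k hk => hω k (hk.trans_le h)

lemma dependsOnFirst.compl {n : ℕ} {s : Set (ℕ → Fin N)} (hs : dependsOnFirst n s) :
    dependsOnFirst n sᶜ := fun ω ω' hω h h' => h (hs ω' ω (fun k hk => (hω k hk).symm) h')

lemma dependsOnFirst.isOpen {n : ℕ} {s : Set (ℕ → Fin N)} (hs : dependsOnFirst n s) :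
    IsOpen s := by
  rw [isOpen_iff_mem_nhds]
  intro ω hω
  have : (⋂ k ∈ Finset.range n, (fun ω' : ℕ → Fin N => ω' k) ⁻¹' {ω k}) ∈ 𝓝 ω := by
    refine (Filter.biInter_finset_mem _).2 fun k _ => ?_
    exact (continuous_apply k).continuousAt.preimage_mem_nhds (by simp)
  refine mem_of_superset this fun ω' h => hs ω ω' (fun k hk => ?_) hω
  simp only [Set.mem_iInter] at h
  exact (h k (Finset.mem_range.2 hk)).symm

lemma dependsOnFirst.isClosed {n : ℕ} {s : Set (ℕ → Fin N)} (hs : dependsOnFirst n s) :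
    IsClosed s := ⟨hs.compl.isOpen⟩

lemma isSetRing_finiteSets : IsSetRing (finiteSets N) where
  empty_mem := ⟨0, fun _ _ _ h => h.elim⟩
  union_mem := by
    rintro s t ⟨n, hn⟩ ⟨m, hm⟩
    refine ⟨max n m, fun ω ω' h => Or.imp ?_ ?_⟩
    · exact hn.mono (le_max_left _ _) ω ω' h
    · exact hm.mono (le_max_right _ _) ω ω' h
  sdiff_mem := by
    rintro s t ⟨n, hn⟩ ⟨m, hm⟩
    refine ⟨max n m, fun ω ω' h => And.imp ?_ ?_⟩
    · exact hn.mono (le_max_left _ _) ω ω' h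
    · exact (hm.mono (le_max_right _ _)).compl ω ω' h

/-- The sequence that begins with `w` and is constantly `i₀` afterwards. -/
def extendWord (i₀ : Fin N) (w : List (Fin N)) : ℕ → Fin N := fun k => w.getD k i₀

open Classical in
/-- The total weight of the words of length `n` whose extension lies in `s`. -/
def approx (c : List (Fin N) → ℝ≥0∞) (i₀ : Fin N) (n : ℕ) (s : Set (ℕ → Fin N)) : ℝ≥0∞ :=
  ∑ w : Fin n → Fin N, if extendWord i₀ (List.ofFn w) ∈ s then c (List.ofFn w) else 0

lemma approx_succ {c : List (Fin N) → ℝ≥0∞} (hc : ∀ w, c w = ∑ i, c (w ++ [i])) (i₀ : Fin N)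
    {n : ℕ} {s : Set (ℕ → Fin N)} (hs : dependsOnFirst n s) :
    approx c i₀ (n + 1) s = approx c i₀ n s := by
  classical
  unfold approx
  rw [← (Fin.snocEquiv (fun _ : Fin (n + 1) => Fin N)).sum_comp, Fintype.sum_prod_type,
    Finset.sum_comm]
  refine Finset.sum_congr rfl fun w _ => ?_
  have h : ∀ i, List.ofFn ((Fin.snocEquiv (fun _ : Fin (n + 1) => Fin N)) (i, w))
      = List.ofFn w ++ [i] := fun i => by
    rw [List.ofFn_succ']
    simp [Fin.snocEquiv, Fin.snoc_castSucc, Fin.snoc_last, List.concat_eq_append]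
  simp only [h]
  have h2 : ∀ i, (extendWord i₀ (List.ofFn w ++ [i]) ∈ s ↔ extendWord i₀ (List.ofFn w) ∈ s) := by
    intro i
    have h3 : ∀ k < n, extendWord i₀ (List.ofFn w ++ [i]) k = extendWord i₀ (List.ofFn w) k := by
      intro k hk
      unfold extendWord
      rw [List.getD_append _ _ _ _ (by simpa using hk)]
    exact ⟨hs _ _ h3, hs _ _ fun k hk => (h3 k hk).symm⟩
  simp only [h2]
  split_ifs with hw
  · exact (hc _).symm
  · simp

lemma approx_eq {c : List (Fin N) → ℝ≥0∞} (hc : ∀ w, c w = ∑ i, c (w ++ [i])) (i₀ : Fin N)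
    {n : ℕ} {s : Set (ℕ → Fin N)} (hs : dependsOnFirst n s) (m : ℕ) (hm : n ≤ m) :
    approx c i₀ m s = approx c i₀ n s := by
  induction m, hm using Nat.le_induction with
  | base => rfl
  | succ m hm ih => rw [approx_succ hc i₀ (hs.mono hm), ih]

lemma approx_union (c : List (Fin N) → ℝ≥0∞) (i₀ : Fin N) (n : ℕ) {s t : Set (ℕ → Fin N)}
    (h : Disjoint s t) : approx c i₀ n (s ∪ t) = approx c i₀ n s + approx c i₀ n t := by
  classical
  unfold approx
  rw [← Finset.sum_add_distrib]
  refine Finset.sum_congr rfl fun w _ => ?_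
  by_cases h1 : extendWord i₀ (List.ofFn w) ∈ s
  · have := Set.disjoint_left.1 h h1
    simp [h1, this]
  · simp [h1]

/-- The set function on `finiteSets N` given by consistent weights. -/
def weight (c : List (Fin N) → ℝ≥0∞) (i₀ : Fin N) (s : Set (ℕ → Fin N)) : ℝ≥0∞ :=
  limsup (fun n => approx c i₀ n s) atTop

lemma weight_eq {c : List (Fin N) → ℝ≥0∞} (hc : ∀ w, c w = ∑ i, c (w ++ [i])) (i₀ : Fin N)
    {n : ℕ} {s : Set (ℕ → Fin N)} (hs : dependsOnFirst n s) :
    weight c i₀ s = approx c i₀ n s := by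
  refine Tendsto.limsup_eq (tendsto_const_nhds.congr' ?_)
  filter_upwards [eventually_ge_atTop n] with m hm
  exact (approx_eq hc i₀ hs m hm).symm

/-- The additive content given by consistent weights. -/
def content {c : List (Fin N) → ℝ≥0∞} (hc : ∀ w, c w = ∑ i, c (w ++ [i])) (i₀ : Fin N) :
    AddContent ℝ≥0∞ (finiteSets N) :=
  isSetRing_finiteSets.addContent_of_union (weight c i₀)
    (by rw [weight_eq hc i₀ (n := 0) (fun _ _ _ h => h.elim)]; simp [approx])
    (by
      rintro s t ⟨n, hn⟩ ⟨m, hm⟩ hst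
      have h1 := hn.mono (le_max_left n m)
      have h2 := hm.mono (le_max_right n m)
      have h3 : dependsOnFirst (max n m) (s ∪ t) :=
        fun ω ω' h => Or.imp (h1 ω ω' h) (h2 ω ω' h)
      rw [weight_eq hc i₀ h1, weight_eq hc i₀ h2, weight_eq hc i₀ h3, approx_union _ _ _ hst])

lemma dependsOnFirst_wordCylinder (w : List (Fin N)) :
    dependsOnFirst w.length (wordCylinder w) := fun ω ω' h hω k => by
  rw [← h k k.2]; exact hω k

lemma weight_wordCylinder {c : List (Fin N) → ℝ≥0∞} (hc : ∀ w, c w = ∑ i, c (w ++ [i]))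
    (i₀ : Fin N) (w : List (Fin N)) : weight c i₀ (wordCylinder w) = c w := by
  classical
  rw [weight_eq hc i₀ (dependsOnFirst_wordCylinder w), approx]
  rw [Finset.sum_eq_single (fun k => w.get k)]
  · have : extendWord i₀ w ∈ wordCylinder w := fun k => by simp [extendWord]
    simp [this]
  · intro v _ hv
    rw [if_neg]
    intro h
    refine hv (funext fun k => ?_)
    rw [← h k]
    simp [extendWord]
  · simp

/-- The Kolmogorov extension theorem on the shift space. -/
theorem exists_measure {c : List (Fin N) → ℝ≥0∞} (hc : ∀ w, c w = ∑ i, c (w ++ [i])) (i₀ : Fin N)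
    (hfin : c [] ≠ ∞) : ∃ m : Measure (ℕ → Fin N), ∀ w, m (wordCylinder w) = c w := by
  have hval : ∀ s, content hc i₀ s = weight c i₀ s := fun s => rfl
  have huniv : ∀ s ∈ finiteSets N, content hc i₀ s ≠ ∞ := by
    intro s hs
    have hU : (Set.univ : Set (ℕ → Fin N)) = wordCylinder [] := by
      ext ω; simp only [Set.mem_univ, wordCylinder, Set.mem_ofPred_eq, true_iff]
      exact fun k => k.elim0
    have h1 : (Set.univ : Set (ℕ → Fin N)) ∈ finiteSets N := ⟨0, fun _ _ _ _ => trivial⟩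
    have h2 : content hc i₀ s ≤ content hc i₀ Set.univ :=
      addContent_mono isSetRing_finiteSets.isSetSemiring hs h1 (Set.subset_univ s)
    refine ne_top_of_le_ne_top ?_ h2
    rw [hval, hU, weight_wordCylinder hc]
    exact hfin
  have hsub : (content hc i₀).IsSigmaSubadditive := by
    refine isSigmaSubadditive_of_addContent_iUnion_eq_tsum isSetRing_finiteSets ?_
    refine addContent_iUnion_eq_sum_of_tendsto_zero isSetRing_finiteSets _ huniv ?_
    intro s hs hanti hempty
    obtain ⟨n, hn⟩ : ∃ n, s n = ∅ := by
      by_contra! hne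
      have h := IsCompact.nonempty_iInter_of_sequence_nonempty_isCompact_isClosed s
        (fun n => hanti (Nat.le_succ n)) hne
        ((hs 0).choose_spec.isClosed.isCompact) (fun n => (hs n).choose_spec.isClosed)
      rw [hempty] at h
      exact Set.not_nonempty_empty h
    refine tendsto_const_nhds.congr' ?_
    filter_upwards [eventually_ge_atTop n] with m hm
    have : s m = ∅ := Set.subset_eq_empty (hanti hm) hn
    rw [this, addContent_empty]
  have hgen : (inferInstance : MeasurableSpace (ℕ → Fin N)) ≤
      MeasurableSpace.generateFrom (finiteSets N) := by
    refine iSup_le fun k => ?_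
    rintro _ ⟨t, _, rfl⟩
    refine MeasurableSpace.measurableSet_generateFrom ⟨k + 1, fun ω ω' h hω => ?_⟩
    simp only [Set.mem_preimage] at hω ⊢
    rwa [← h k (Nat.lt_succ_self k)]
  refine ⟨(content hc i₀).measure isSetRing_finiteSets.isSetSemiring hgen hsub, fun w => ?_⟩
  rw [AddContent.measure_eq _ _ (le_antisymm hgen ?_) hsub
    ⟨_, dependsOnFirst_wordCylinder w⟩, hval, weight_wordCylinder hc]
  refine MeasurableSpace.generateFrom_le ?_
  rintro s ⟨n, hn⟩
  exact hn.isOpen.measurableSet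

end ShiftSpace

/-! ### Energy measures on the shift space -/

namespace HarmonicStructure

variable {K : Type*} [TopologicalSpace K] {N : ℕ} {L : PCFStructure K N}

theorem exists_energyMeasure (H : HarmonicStructure L) (f : H.domain) :
    ∃ m : Measure (ℕ → Fin N), ∀ w : List (Fin N), m (wordCylinder w) =
      ENNReal.ofReal (2 * ((H.rWord w)⁻¹ *
        H.energy ((f : C(K, ℝ)).comp (L.wordMap w)) ((f : C(K, ℝ)).comp (L.wordMap w)))) := by
  refine ShiftSpace.exists_measure (c := fun w => ENNReal.ofReal (2 * ((H.rWord w)⁻¹ *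
        H.energy ((f : C(K, ℝ)).comp (L.wordMap w)) ((f : C(K, ℝ)).comp (L.wordMap w)))))
    (fun w => ?_) ⟨0, by have := L.two_le; omega⟩ ENNReal.ofReal_ne_top
  have hw := H.comp_wordMap_mem f.2 w
  rw [← ENNReal.ofReal_sum_of_nonneg]
  · congr 1
    rw [H.energy_selfSimilar hw, Finset.mul_sum, Finset.mul_sum]
    refine Finset.sum_congr rfl fun i _ => ?_
    rw [rWord_append, wordMap_append, mul_inv, mul_assoc]
    rfl
  · intro i _
    have h1 := H.energy_nonneg (H.comp_wordMap_mem f.2 (w ++ [i]))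
    have h2 := H.rWord_pos (w ++ [i])
    positivity

/-- The energy measure `λ_⟨f⟩` on the shift space: the Borel measure with
`λ_⟨f⟩(Σ_w) = 2 r_w⁻¹ ℰ(ψ_w^* f)` for all finite words `w`. -/
def energyMeasure (H : HarmonicStructure L) (f : H.domain) : Measure (ℕ → Fin N) :=
  Classical.choose (H.exists_energyMeasure f)

lemma energyMeasure_wordCylinder (H : HarmonicStructure L) (f : H.domain) (w : List (Fin N)) :
    H.energyMeasure f (wordCylinder w) =
      ENNReal.ofReal (2 * ((H.rWord w)⁻¹ *
        H.energy ((f : C(K, ℝ)).comp (L.wordMap w)) ((f : C(K, ℝ)).comp (L.wordMap w)))) :=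
  Classical.choose_spec (H.exists_energyMeasure f) w

instance isFiniteMeasure_energyMeasure (H : HarmonicStructure L) (f : H.domain) :
    IsFiniteMeasure (H.energyMeasure f) where
  measure_univ_lt_top := by
    have h : (Set.univ : Set (ℕ → Fin N)) = wordCylinder [] := by
      ext ω; simp only [Set.mem_univ, wordCylinder, Set.mem_ofPred_eq, true_iff]
      exact fun k => k.elim0
    rw [h, energyMeasure_wordCylinder]
    exact ENNReal.ofReal_lt_top

/-- The signed measure `λ_⟨f,g⟩ = (λ_⟨f+g⟩ - λ_⟨f-g⟩) / 4`. -/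
def mutualEnergyMeasure (H : HarmonicStructure L) (f g : H.domain) :
    SignedMeasure (ℕ → Fin N) :=
  (1 / 4 : ℝ) • ((H.energyMeasure (f + g)).toSignedMeasure -
    (H.energyMeasure (f - g)).toSignedMeasure)

end HarmonicStructure

end

/-!
Write `X = l(V₀)`, with the form `ℰ⁽⁰⁾`. Minimizing `ℰ⁽¹⁾` with prescribed values on `V₀` defines
linear maps `A_i` on `X` (`HarmonicStructure.transfer`). A function `u` on `V₀` extends to a harmonic
function on `K` of energy `ℰ⁽⁰⁾(u)` whose values on `ψ_w(V₀)` are given by `A_w = A_{w_m} ⋯ A_{w_1}`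
(`HarmonicStructure.harmonicExt`), so for a piecewise harmonic `f` the boundary values `U_f(w)` of
`ψ_w^* f` satisfy `U_f(wi) = A_i U_f(w)` and `λ_⟨f,g⟩(Σ_w) = 2 r_w⁻¹ ℰ⁽⁰⁾(U_f(w), U_g(w))` for long
words `w`.

For two piecewise harmonic functions `f`, `g` the density matrix of the energy measures is positive
semidefinite, and the square root of the determinant is concave on such matrices. So the integral of
the square root of the density determinant over `Σ_w` is at most
`2 ∑_{|v| = n} r_{wv}⁻¹ |A_v U_f(w) ∧ A_v U_g(w)|` for every `n`, where `|u ∧ v|` is the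
`ℰ⁽⁰⁾`-area of the parallelogram spanned by `u` and `v` (`HarmonicStructure.area`). These sums tend
to zero (`HarmonicStructure.exists_cellSum_iterate_lt`), hence the density matrix of `f` and `g` is
singular almost everywhere. Polarization kills all mixed minors `Z^{i,j} Z^{k,k} - Z^{i,k} Z^{j,k}`,
and `ζ` is a normalized column of `Z` through a positive diagonal entry.

The sums of areas decrease with `n`, and by compactness of the set of orthonormal pairs they decay
geometrically as soon as every orthonormal pair `u`, `v` loses some area at a finite level. If none
were lost, all Gram matrices of `A_w u`, `A_w v` would be scalar, by the inequality between geometric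
and arithmetic means. Now let `ψ_i p = p ∈ V₀`. The normal derivative `ℓ(u) = (D u)(p)` satisfies
`ℓ(A_i u) = r_i ℓ(u)`, since postcritical finiteness keeps `p` out of the other cells. As
`K ∖ {p}` is connected, the strong minimum principle makes each column of `A_i` off `p` either zero
or positive, and a Perron–Frobenius argument shows that `A_i^k z` decays faster than `r_i^k` when
`ℓ(z) = 0` (`HarmonicStructure.tendsto_E0_iterate`). Choose `p` with `ℓ(u) ≠ 0`. Then
`z = ℓ(u) v - ℓ(v) u` decays faster than `u` does, while scalar Gram matrices make the energies of
`A_i^k z` and `A_i^k u` proportional: a contradiction.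
-/

noncomputable section

/-! ### Coding of points and connectedness -/

namespace SelfSimilarStructure

variable {K : Type*} [TopologicalSpace K] {N : ℕ} (L : SelfSimilarStructure K N)

lemma consSeq_shiftSeq (ω : ℕ → Fin N) : consSeq (ω 0) (shiftSeq 1 ω) = ω := by
  funext n
  cases n <;> rfl

lemma ψ_π_shiftSeq (ω : ℕ → Fin N) : L.ψ (ω 0) (L.π (shiftSeq 1 ω)) = L.π ω := by
  rw [L.ψ_π, consSeq_shiftSeq]

lemma exists_ψ_eq (x : K) : ∃ i y, L.ψ i y = x := by
  obtain ⟨ω, rfl⟩ := L.π_surjective x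
  exact ⟨_, _, L.ψ_π_shiftSeq ω⟩

lemma mem_overlap {i j : Fin N} (hij : i ≠ j) {x : K} (hi : x ∈ Set.range (L.ψ i))
    (hj : x ∈ Set.range (L.ψ j)) : x ∈ L.overlap := by
  simp only [overlap, Set.mem_iUnion]
  exact ⟨i, j, hij, hi, hj⟩

lemma shiftSeq_mem_postCritical {ω : ℕ → Fin N} (h : ω ∈ L.postCritical) :
    shiftSeq 1 ω ∈ L.postCritical := by
  simp only [postCritical, Set.mem_iUnion] at h ⊢
  obtain ⟨m, hm, τ, hτ, rfl⟩ := h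
  refine ⟨m + 1, by omega, τ, hτ, ?_⟩
  funext n
  simp only [shiftSeq]
  congr 1
  omega

lemma shiftSeq_mem_postCritical_of_overlap {ω : ℕ → Fin N} (h : L.π ω ∈ L.overlap) :
    shiftSeq 1 ω ∈ L.postCritical := by
  simp only [postCritical, Set.mem_iUnion]
  exact ⟨1, le_rfl, ω, h, rfl⟩

lemma π_shiftSeq_mem_V0_of_overlap {ω : ℕ → Fin N} (h : L.π ω ∈ L.overlap) :
    L.π (shiftSeq 1 ω) ∈ L.V0 :=
  ⟨_, L.shiftSeq_mem_postCritical_of_overlap h, rfl⟩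

lemma mem_V0_of_ψ_mem_overlap {i : Fin N} {x : K} (h : L.ψ i x ∈ L.overlap) : x ∈ L.V0 := by
  obtain ⟨ω, rfl⟩ := L.π_surjective x
  rw [L.ψ_π] at h
  exact L.π_shiftSeq_mem_V0_of_overlap h

/-- All codings of a boundary point stay in the boundary under the shift: two codings either agree
in the first letter or witness an overlap. -/
lemma π_shiftSeq_mem_V0 {ω : ℕ → Fin N} (h : L.π ω ∈ L.V0) : L.π (shiftSeq 1 ω) ∈ L.V0 := by
  obtain ⟨τ, hτ, hωτ⟩ := h
  by_cases h0 : τ 0 = ω 0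
  · refine ⟨shiftSeq 1 τ, L.shiftSeq_mem_postCritical hτ, ?_⟩
    apply L.ψ_injective (ω 0)
    rw [ψ_π_shiftSeq, ← hωτ, ← h0, ψ_π_shiftSeq]
  · refine L.π_shiftSeq_mem_V0_of_overlap (L.mem_overlap h0 ?_ ?_)
    · exact ⟨L.π (shiftSeq 1 τ), by rw [ψ_π_shiftSeq, hωτ]⟩
    · exact ⟨L.π (shiftSeq 1 ω), by rw [ψ_π_shiftSeq]⟩

lemma exists_ψ_eq_of_mem_V0 {x : K} (hx : x ∈ L.V0) : ∃ i, ∃ y ∈ L.V0, L.ψ i y = x := by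
  obtain ⟨ω, rfl⟩ := L.π_surjective x
  exact ⟨_, _, L.π_shiftSeq_mem_V0 hx, L.ψ_π_shiftSeq ω⟩

/-- Connectedness of `K` as a combinatorial statement: a labelling of the cells `ψ_i(K)` that takes
equal values on intersecting cells is constant. -/
lemma eq_of_forall_range_inter [CompactSpace K] [T2Space K] [ConnectedSpace K] {α : Type*}
    (c : Fin N → α)
    (hc : ∀ i j, (Set.range (L.ψ i) ∩ Set.range (L.ψ j)).Nonempty → c i = c j) (i j : Fin N) :
    c i = c j := by
  have hcl : ∀ s : Set (Fin N), IsClosed (⋃ k ∈ s, Set.range (L.ψ k)) := fun s =>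
    s.toFinite.isClosed_biUnion fun k _ => (isCompact_range (L.ψ k).continuous).isClosed
  have hcompl : (⋃ k ∈ {k | c k = c i}, Set.range (L.ψ k))ᶜ =
      ⋃ k ∈ {k | c k ≠ c i}, Set.range (L.ψ k) := by
    ext x
    simp only [Set.mem_compl_iff, Set.mem_iUnion, not_exists, Set.mem_ofPred_eq, exists_prop]
    constructor
    · intro h
      obtain ⟨k, y, hy⟩ := L.exists_ψ_eq x
      exact ⟨k, fun hk => h k ⟨hk, y, hy⟩, y, hy⟩
    · rintro ⟨k, hk, hx⟩ l ⟨hl, hx'⟩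
      exact hk ((hc k l ⟨x, hx, hx'⟩).trans hl)
  have hclopen : IsClopen (⋃ k ∈ {k | c k = c i}, Set.range (L.ψ k)) := by
    refine ⟨hcl _, ?_⟩
    rw [← isClosed_compl_iff, hcompl]
    exact hcl _
  obtain ⟨x⟩ : Nonempty K := inferInstance
  have huniv := hclopen.eq_univ ⟨L.ψ i x, by
    simp only [Set.mem_iUnion]; exact ⟨i, rfl, x, rfl⟩⟩
  have hx : L.ψ j x ∈ ⋃ k ∈ {k | c k = c i}, Set.range (L.ψ k) := huniv ▸ Set.mem_univ _
  simp only [Set.mem_iUnion] at hx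
  obtain ⟨k, hk, hx⟩ := hx
  exact hk.symm.trans (hc k j ⟨_, hx, x, rfl⟩)

lemma nonempty_V0 [CompactSpace K] [T2Space K] [ConnectedSpace K] : Nonempty L.V0 := by
  by_contra hne
  have hN := L.two_le
  have h := L.eq_of_forall_range_inter (fun i => i) (fun i j ⟨x, hi, hj⟩ => by
    by_contra hij
    obtain ⟨ω, rfl⟩ := L.π_surjective x
    exact hne ⟨⟨_, L.π_shiftSeq_mem_V0_of_overlap (L.mem_overlap hij hi hj)⟩⟩)
    ⟨0, by omega⟩ ⟨1, by omega⟩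
  simp at h

end SelfSimilarStructure

/-! ### The discrete energy forms -/

namespace HarmonicStructure

variable {K : Type*} [TopologicalSpace K] {N : ℕ} {L : PCFStructure K N} (H : HarmonicStructure L)

/-- `ℰ⁽⁰⁾` of the harmonic structure. -/
def E0 (u v : L.V0 → ℝ) : ℝ := L.energy0 H.D u v

lemma E0_eq_sum (u v : L.V0 → ℝ) : H.E0 u v = -∑ p, (H.D *ᵥ u) p * v p := by
  simp [E0, PCFStructure.energy0, dotProduct]

lemma E0_add_left (u v w : L.V0 → ℝ) : H.E0 (u + v) w = H.E0 u w + H.E0 v w := by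
  simp only [E0, PCFStructure.energy0, Matrix.mulVec_add, neg_dotProduct, add_dotProduct]; ring

lemma E0_add_right (u v w : L.V0 → ℝ) : H.E0 u (v + w) = H.E0 u v + H.E0 u w := by
  simp only [E0, PCFStructure.energy0, dotProduct_add]

lemma E0_smul_left (c : ℝ) (u v : L.V0 → ℝ) : H.E0 (c • u) v = c * H.E0 u v := by
  simp only [E0, PCFStructure.energy0, Matrix.mulVec_smul, neg_dotProduct, smul_dotProduct,
    smul_eq_mul]; ring

lemma E0_smul_right (c : ℝ) (u v : L.V0 → ℝ) : H.E0 u (c • v) = c * H.E0 u v := by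
  simp only [E0, PCFStructure.energy0, dotProduct_smul, smul_eq_mul]

lemma E0_comm (u v : L.V0 → ℝ) : H.E0 u v = H.E0 v u := by
  simp only [E0, PCFStructure.energy0, neg_dotProduct]
  rw [dotProduct_comm, Matrix.dotProduct_mulVec, ← Matrix.mulVec_transpose, H.D_symm.eq]

lemma E0_nonneg (u : L.V0 → ℝ) : 0 ≤ H.E0 u u := H.energy0_nonneg u

lemma E0_sq_le (u v : L.V0 → ℝ) : H.E0 u v ^ 2 ≤ H.E0 u u * H.E0 v v := by
  have h : ∀ t : ℝ, 0 ≤ H.E0 v v * (t * t) + 2 * H.E0 u v * t + H.E0 u u := fun t => by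
    have := H.E0_nonneg (u + t • v)
    simp only [E0_add_left, E0_add_right, E0_smul_left, E0_smul_right, H.E0_comm v u] at this
    linarith
  have := discrim_le_zero h
  rw [discrim] at this
  nlinarith

lemma mulVec_const (c : ℝ) : H.D *ᵥ (fun _ => c) = 0 := (H.D_ker _).2 ⟨c, fun _ => rfl⟩

lemma E0_const_left (c : ℝ) (v : L.V0 → ℝ) : H.E0 (fun _ => c) v = 0 := by
  simp [E0_eq_sum, mulVec_const]

lemma E0_const_right (c : ℝ) (v : L.V0 → ℝ) : H.E0 v (fun _ => c) = 0 := by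
  rw [E0_comm, E0_const_left]

lemma mulVec_eq_zero_of_E0 {u : L.V0 → ℝ} (h : H.E0 u u = 0) : H.D *ᵥ u = 0 := by
  funext p
  classical
  have h1 := H.E0_sq_le u (Pi.single p 1)
  rw [h, zero_mul] at h1
  have h2 : H.E0 u (Pi.single p 1) = -(H.D *ᵥ u) p := by
    simp [E0, PCFStructure.energy0]
  rw [h2] at h1
  have : (-(H.D *ᵥ u) p) = 0 := by
    exact pow_eq_zero_iff two_ne_zero |>.1 (le_antisymm h1 (sq_nonneg _))
  simpa using this

lemma exists_const_of_E0 {u : L.V0 → ℝ} (h : H.E0 u u = 0) : ∃ c : ℝ, u = fun _ => c := by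
  obtain ⟨c, hc⟩ := (H.D_ker u).1 (H.mulVec_eq_zero_of_E0 h)
  exact ⟨c, funext hc⟩

/-- The Beurling–Deny form of `ℰ⁽⁰⁾`: the row sums of `D` vanish. -/
lemma E0_self_eq_sum (u : L.V0 → ℝ) :
    H.E0 u u = (1 / 2) * ∑ p, ∑ q, H.D p q * (u p - u q) ^ 2 := by
  have hrow : ∀ p, ∑ q, H.D p q = 0 := fun p => by
    have := congrFun (H.mulVec_const 1) p
    simpa [Matrix.mulVec, dotProduct] using this
  have h1 : ∑ p, ∑ q, H.D p q * u p ^ 2 = 0 := by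
    refine Finset.sum_eq_zero fun p _ => ?_
    rw [← Finset.sum_mul, hrow, zero_mul]
  have h2 : ∑ p, ∑ q, H.D p q * u q ^ 2 = 0 := by
    rw [Finset.sum_comm]
    refine Finset.sum_eq_zero fun q _ => ?_
    rw [← Finset.sum_mul]
    have : ∑ p, H.D p q = 0 := by
      rw [← hrow q]
      exact Finset.sum_congr rfl fun p _ => H.D_symm.apply q p
    rw [this, zero_mul]
  have h3 : H.E0 u u = -∑ p, ∑ q, H.D p q * (u p * u q) := by
    rw [E0_eq_sum]
    congr 1
    refine Finset.sum_congr rfl fun p _ => ?_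
    rw [Matrix.mulVec, dotProduct, Finset.sum_mul]
    exact Finset.sum_congr rfl fun q _ => by ring
  have h4 : ∑ p, ∑ q, H.D p q * (u p - u q) ^ 2 = ∑ p, ∑ q, H.D p q * u p ^ 2
      + ∑ p, ∑ q, H.D p q * u q ^ 2 - 2 * ∑ p, ∑ q, H.D p q * (u p * u q) := by
    simp only [Finset.mul_sum, ← Finset.sum_add_distrib, ← Finset.sum_sub_distrib]
    exact Finset.sum_congr rfl fun p _ => Finset.sum_congr rfl fun q _ => by ring
  rw [h4, h1, h2, h3]; ring

/-- The Markov property of `ℰ⁽⁰⁾`. -/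
lemma E0_le_of_contraction {u v : L.V0 → ℝ} (h : ∀ p q, |v p - v q| ≤ |u p - u q|) :
    H.E0 v v ≤ H.E0 u u := by
  rw [E0_self_eq_sum, E0_self_eq_sum]
  refine mul_le_mul_of_nonneg_left (Finset.sum_le_sum fun p _ => Finset.sum_le_sum fun q _ => ?_)
    (by norm_num)
  by_cases hpq : p = q
  · simp [hpq]
  · exact mul_le_mul_of_nonneg_left (sq_le_sq.2 (h p q)) (H.D_offDiag p q hpq)

lemma E_one (u v : K → ℝ) : H.E 1 u v =
    ∑ i, (H.r i)⁻¹ * H.E0 (fun p => u (L.ψ i p)) (fun p => v (L.ψ i p)) := by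
  rw [E_def, ← (Equiv.funUnique (Fin 1) (Fin N)).symm.sum_comp]
  refine Finset.sum_congr rfl fun i _ => ?_
  simp [rWord, SelfSimilarStructure.wordMap, E0]

lemma E_zero_eq (u v : K → ℝ) : H.E 0 u v = H.E0 (fun p => u p) (fun p => v p) := by
  rw [E_def]; simp [rWord, SelfSimilarStructure.wordMap, E0]

lemma E_succ (m : ℕ) (u v : K → ℝ) :
    H.E (m + 1) u v = ∑ i, (H.r i)⁻¹ * H.E m (fun x => u (L.ψ i x)) (fun x => v (L.ψ i x)) := by
  simp only [E_def]
  rw [← (Fin.consEquiv (fun _ : Fin (m + 1) => Fin N)).sum_comp, Fintype.sum_prod_type]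
  refine Finset.sum_congr rfl fun i _ => ?_
  rw [Finset.mul_sum]
  refine Finset.sum_congr rfl fun w _ => ?_
  have h : List.ofFn ((Fin.consEquiv (fun _ : Fin (m + 1) => Fin N)) (i, w))
      = i :: List.ofFn w := by simp [Fin.consEquiv]
  rw [h, rWord_cons, mul_inv, mul_assoc]
  rfl

lemma E_add_left (m : ℕ) (u v w : K → ℝ) : H.E m (u + v) w = H.E m u w + H.E m v w := by
  simp only [E_def, ← Finset.sum_add_distrib, ← mul_add]
  exact Finset.sum_congr rfl fun i _ => congrArg _ (H.E0_add_left _ _ _)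

lemma E_smul_left (m : ℕ) (c : ℝ) (u v : K → ℝ) : H.E m (c • u) v = c * H.E m u v := by
  simp only [E_def, Finset.mul_sum]
  refine Finset.sum_congr rfl fun i _ => ?_
  rw [mul_left_comm]
  exact congrArg _ (H.E0_smul_left _ _ _)

lemma E_comm (m : ℕ) (u v : K → ℝ) : H.E m u v = H.E m v u := by
  simp only [E_def]
  exact Finset.sum_congr rfl fun i _ => congrArg _ (H.E0_comm _ _)

lemma E_add_right (m : ℕ) (u v w : K → ℝ) : H.E m u (v + w) = H.E m u v + H.E m u w := by
  rw [E_comm, E_add_left, H.E_comm m v, H.E_comm m w]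

lemma E_smul_right (m : ℕ) (c : ℝ) (u v : K → ℝ) : H.E m u (c • v) = c * H.E m u v := by
  rw [E_comm, E_smul_left, E_comm]

/-! ### Harmonic transfer matrices -/

/-- A function on `K` has minimal `ℰ⁽¹⁾`-energy, in variational form: `ℰ⁽¹⁾(v, ·)` only sees
boundary values, where it is `ℰ⁽⁰⁾(v|_{V₀}, ·)`. -/
def IsMinimal (v : K → ℝ) : Prop :=
  ∀ z : K → ℝ, H.E 1 v z = H.E0 (fun p => v p) (fun p => z p)

variable {H}

lemma IsMinimal.add {v w : K → ℝ} (hv : H.IsMinimal v) (hw : H.IsMinimal w) :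
    H.IsMinimal (v + w) := fun z => by
  rw [E_add_left, hv, hw, ← E0_add_left]; rfl

lemma IsMinimal.smul {v : K → ℝ} (hv : H.IsMinimal v) (c : ℝ) : H.IsMinimal (c • v) := fun z => by
  rw [E_smul_left, hv, ← E0_smul_left]; rfl

variable (H)

lemma E0_le_E_one (v : K → ℝ) : H.E0 (fun p => v p) (fun p => v p) ≤ H.E 1 v v :=
  (H.isGLB_energy (fun p => v p)).1 ⟨v, fun _ => rfl, rfl⟩

lemma isMinimal_of_E_one_eq {v : K → ℝ} (hv : H.E 1 v v = H.E0 (fun p => v p) (fun p => v p)) :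
    H.IsMinimal v := by
  intro z
  have h : ∀ t : ℝ, 0 ≤ (H.E 1 z z - H.E0 (fun p => z p) (fun p => z p)) * (t * t) +
      2 * (H.E 1 v z - H.E0 (fun p => v p) (fun p => z p)) * t + 0 := fun t => by
    have h1 := H.E0_le_E_one (v + t • z)
    have h2 : (fun p : L.V0 => (v + t • z) p) = (fun p : L.V0 => v p) + t • fun p : L.V0 => z p :=
      rfl
    rw [h2] at h1
    simp only [E0_add_left, E0_add_right, E0_smul_left, E0_smul_right, E_add_left, E_add_right,
      E_smul_left, E_smul_right, H.E_comm 1 z v, H.E0_comm (fun p => z p) (fun p => v p), hv] at h1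
    linarith
  have := discrim_le_zero h
  rw [discrim] at this
  nlinarith [sq_nonneg (H.E 1 v z - H.E0 (fun p => v p) (fun p => z p))]

lemma continuous_E_one : Continuous fun v : K → ℝ => H.E 1 v v := by
  simp only [E_one, E0_eq_sum, Matrix.mulVec, dotProduct]
  fun_prop

variable [CompactSpace K] [T2Space K] [ConnectedSpace K]

/-- Minimal extensions exist and obey the maximum principle: by the Markov property it is enough to
minimize over the functions with values between `min u` and `max u`, which form a compact set. -/
lemma exists_isMinimal (u : L.V0 → ℝ) : ∃ v : K → ℝ, (∀ p : L.V0, v p = u p) ∧ H.IsMinimal v ∧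
    ∀ x, (⨅ p, u p) ≤ v x ∧ v x ≤ ⨆ p, u p := by
  classical
  have := L.nonempty_V0
  set a := ⨅ p, u p
  set b := ⨆ p, u p
  have hab : ∀ p, u p ∈ Set.Icc a b := fun p =>
    ⟨ciInf_le (Set.finite_range u).bddBelow p, le_ciSup (Set.finite_range u).bddAbove p⟩
  have hle : a ≤ b := (hab (Classical.arbitrary _)).1.trans (hab _).2
  let B : Set (K → ℝ) := Set.univ.pi (fun _ => Set.Icc a b) ∩ {v | ∀ p : L.V0, v p = u p}
  have hB : IsCompact B := by
    refine (isCompact_univ_pi fun _ => isCompact_Icc).inter_right ?_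
    simp only [Set.ofPred_forall]
    exact isClosed_iInter fun p => isClosed_eq (continuous_apply _) continuous_const
  have hmem : ∀ v : K → ℝ, (∀ p : L.V0, v p = u p) → (fun x => max a (min b (v x))) ∈ B := by
    intro v hv
    refine ⟨fun x _ => ⟨le_max_left _ _, max_le hle (min_le_left _ _)⟩, fun p => ?_⟩
    simp only [hv, min_eq_right (hab p).2, max_eq_right (hab p).1]
  have hne : B.Nonempty := ⟨_, hmem (fun x => if h : x ∈ L.V0 then u ⟨x, h⟩ else 0)
    (fun p => by simp)⟩
  obtain ⟨v, hvB, hmin⟩ := hB.exists_isMinOn hne H.continuous_E_one.continuousOn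
  refine ⟨v, hvB.2, H.isMinimal_of_E_one_eq ?_, fun x => hvB.1 x (Set.mem_univ x)⟩
  have hu : (fun p : L.V0 => v p) = u := funext hvB.2
  rw [hu]
  suffices h : IsLeast {x : ℝ | ∃ v : K → ℝ, (∀ p : L.V0, v p = u p) ∧ x = H.E 1 v v} (H.E 1 v v)
    from h.isGLB.unique (H.isGLB_energy u)
  refine ⟨⟨v, hvB.2, rfl⟩, ?_⟩
  rintro _ ⟨w, hw, rfl⟩
  refine (hmin (hmem w hw)).trans ?_
  change H.E 1 _ _ ≤ H.E 1 w w
  rw [E_one, E_one]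
  refine Finset.sum_le_sum fun i _ => mul_le_mul_of_nonneg_left (H.E0_le_of_contraction ?_)
    (inv_nonneg.2 (H.r_pos i).le)
  intro p q
  refine (abs_max_sub_max_le_max _ _ _ _).trans ?_
  rw [sub_self, abs_zero, max_eq_right (abs_nonneg _)]
  refine (abs_min_sub_min_le_max _ _ _ _).trans ?_
  rw [sub_self, abs_zero, max_eq_right (abs_nonneg _)]

/-- Minimal functions are determined on `V₁` by their boundary values, because `K` is connected. -/
lemma IsMinimal.eq_zero {v : K → ℝ} (hv : H.IsMinimal v) (h0 : ∀ p : L.V0, v p = 0) (i : Fin N)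
    (p : L.V0) : v (L.ψ i p) = 0 := by
  have hE : H.E 1 v v = 0 := by
    rw [hv v]
    have : (fun p : L.V0 => v p) = fun _ => 0 := funext h0
    rw [this, E0_const_left]
  rw [E_one, Finset.sum_eq_zero_iff_of_nonneg fun i _ =>
    mul_nonneg (inv_nonneg.2 (H.r_pos i).le) (H.E0_nonneg _)] at hE
  have hc : ∀ i, ∃ c : ℝ, (fun p : L.V0 => v (L.ψ i p)) = fun _ => c := fun i =>
    H.exists_const_of_E0 ((mul_eq_zero.1 (hE i (Finset.mem_univ i))).resolve_left
      (inv_ne_zero (H.r_pos i).ne'))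
  choose c hc using hc
  have hc' : ∀ i, ∀ p : L.V0, v (L.ψ i p) = c i := fun i p => congrFun (hc i) p
  have hcc : ∀ i j, c i = c j := L.eq_of_forall_range_inter c fun i j => by
    rintro ⟨x, ⟨y, hy⟩, ⟨z, hz⟩⟩
    by_cases hij : i = j
    · rw [hij]
    · have hx : x ∈ L.overlap := L.mem_overlap hij ⟨y, hy⟩ ⟨z, hz⟩
      have hyV : y ∈ L.V0 := L.mem_V0_of_ψ_mem_overlap (hy ▸ hx)
      have hzV : z ∈ L.V0 := L.mem_V0_of_ψ_mem_overlap (hz ▸ hx)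
      rw [← hc' i ⟨y, hyV⟩, ← hc' j ⟨z, hzV⟩, hy, hz]
  obtain ⟨q⟩ := L.nonempty_V0
  obtain ⟨j, y, hy, hjy⟩ := L.exists_ψ_eq_of_mem_V0 q.2
  have hj := hc' j ⟨y, hy⟩
  rw [hjy, h0 q] at hj
  rw [hc', hcc i j, ← hj]

lemma IsMinimal.eq_of_boundary {v w : K → ℝ} (hv : H.IsMinimal v) (hw : H.IsMinimal w)
    (h : ∀ p : L.V0, v p = w p) (i : Fin N) (p : L.V0) : v (L.ψ i p) = w (L.ψ i p) := by
  have := IsMinimal.eq_zero H (hv.add (hw.smul (-1))) (fun p => by simp [h]) i p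
  simp only [Pi.add_apply, Pi.smul_apply, smul_eq_mul] at this
  linarith

/-- A function on `K` of minimal `ℰ⁽¹⁾`-energy with boundary values `u`; only its values on `V₁`
are canonical. -/
def minExt (u : L.V0 → ℝ) : K → ℝ := Classical.choose (H.exists_isMinimal u)

lemma minExt_boundary (u : L.V0 → ℝ) (p : L.V0) : H.minExt u p = u p :=
  (Classical.choose_spec (H.exists_isMinimal u)).1 p

lemma minExt_isMinimal (u : L.V0 → ℝ) : H.IsMinimal (H.minExt u) :=
  (Classical.choose_spec (H.exists_isMinimal u)).2.1

lemma minExt_mem (u : L.V0 → ℝ) (x : K) : (⨅ p, u p) ≤ H.minExt u x ∧ H.minExt u x ≤ ⨆ p, u p :=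
  (Classical.choose_spec (H.exists_isMinimal u)).2.2 x

/-- The harmonic transfer matrix `A_i`: it takes boundary values on `V₀` of a harmonic function to
its values on `ψ_i(V₀)`. -/
def transfer (i : Fin N) : (L.V0 → ℝ) →ₗ[ℝ] (L.V0 → ℝ) where
  toFun u p := H.minExt u (L.ψ i p)
  map_add' u v := by
    funext p
    exact IsMinimal.eq_of_boundary H (H.minExt_isMinimal _)
      ((H.minExt_isMinimal u).add (H.minExt_isMinimal v))
      (fun q => by simp [minExt_boundary]) i p
  map_smul' c u := by
    funext p
    exact IsMinimal.eq_of_boundary H (H.minExt_isMinimal _)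
      ((H.minExt_isMinimal u).smul c) (fun q => by simp [minExt_boundary]) i p

lemma transfer_apply (i : Fin N) (u : L.V0 → ℝ) (p : L.V0) :
    H.transfer i u p = H.minExt u (L.ψ i p) := rfl

lemma IsMinimal.comp_ψ_eq {v : K → ℝ} (hv : H.IsMinimal v) (i : Fin N) :
    (fun p : L.V0 => v (L.ψ i p)) = H.transfer i (fun p => v p) := by
  funext p
  exact IsMinimal.eq_of_boundary H hv (H.minExt_isMinimal _)
    (fun q => by rw [minExt_boundary]) i p

lemma le_transfer {u : L.V0 → ℝ} {c : ℝ} (h : ∀ p, c ≤ u p) (i : Fin N) (p : L.V0) :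
    c ≤ H.transfer i u p := by
  have := L.nonempty_V0
  exact (le_ciInf h).trans (H.minExt_mem u _).1

lemma transfer_le {u : L.V0 → ℝ} {c : ℝ} (h : ∀ p, u p ≤ c) (i : Fin N) (p : L.V0) :
    H.transfer i u p ≤ c := by
  have := L.nonempty_V0
  exact (H.minExt_mem u _).2.trans (ciSup_le h)

lemma transfer_const (i : Fin N) (c : ℝ) : H.transfer i (fun _ => c) = fun _ => c :=
  funext fun p => le_antisymm (H.transfer_le (fun _ => le_rfl) i p)
    (H.le_transfer (fun _ => le_rfl) i p)

/-- Values at points of `V₀ ∩ ψ_i(V₀)` are kept. -/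
lemma transfer_of_ψ_eq (u : L.V0 → ℝ) {i : Fin N} {p q : L.V0} (h : L.ψ i q = p) :
    H.transfer i u q = u p := by
  rw [transfer_apply, h, minExt_boundary]

lemma transfer_eq_of_ψ_eq (u : L.V0 → ℝ) {i j : Fin N} {p q : L.V0} (h : L.ψ i p = L.ψ j q) :
    H.transfer i u p = H.transfer j u q := by
  rw [transfer_apply, transfer_apply, h]

lemma sum_E0_transfer (u : L.V0 → ℝ) (z : K → ℝ) :
    ∑ i, (H.r i)⁻¹ * H.E0 (H.transfer i u) (fun p => z (L.ψ i p)) = H.E0 u (fun p => z p) := by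
  have h := H.minExt_isMinimal u z
  rw [E_one] at h
  have hb : (fun p : L.V0 => H.minExt u p) = u := funext (H.minExt_boundary u)
  rw [hb] at h
  exact h

lemma sum_E0_transfer_transfer (u v : L.V0 → ℝ) :
    ∑ i, (H.r i)⁻¹ * H.E0 (H.transfer i u) (H.transfer i v) = H.E0 u v := by
  have h := H.sum_E0_transfer u (H.minExt v)
  have hb : (fun p : L.V0 => H.minExt v p) = v := funext (H.minExt_boundary v)
  rw [hb] at h
  exact h

lemma E0_transfer_le (i : Fin N) (u : L.V0 → ℝ) :
    H.E0 (H.transfer i u) (H.transfer i u) ≤ H.r i * H.E0 u u := by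
  have h := Finset.single_le_sum (f := fun i => (H.r i)⁻¹ * H.E0 (H.transfer i u) (H.transfer i u))
    (fun i _ => mul_nonneg (inv_nonneg.2 (H.r_pos i).le) (H.E0_nonneg _)) (Finset.mem_univ i)
  rw [sum_E0_transfer_transfer] at h
  rwa [inv_mul_le_iff₀ (H.r_pos i)] at h

end HarmonicStructure

namespace SelfSimilarStructure

variable {K : Type*} [TopologicalSpace K] {N : ℕ} (L : SelfSimilarStructure K N)

/-- The word formed by the first `n` letters of a sequence. -/
def initWord (ω : ℕ → Fin N) (n : ℕ) : List (Fin N) := List.ofFn fun k : Fin n => ω k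

lemma length_initWord (ω : ℕ → Fin N) (n : ℕ) : (initWord ω n).length = n := by simp [initWord]

lemma initWord_zero (ω : ℕ → Fin N) : initWord ω 0 = [] := by simp [initWord]

lemma initWord_succ (ω : ℕ → Fin N) (n : ℕ) :
    initWord ω (n + 1) = ω 0 :: initWord (shiftSeq 1 ω) n := by
  simp [initWord, List.ofFn_succ, shiftSeq]

lemma initWord_succ' (ω : ℕ → Fin N) (n : ℕ) :
    initWord ω (n + 1) = initWord ω n ++ [ω n] := by
  rw [initWord, List.ofFn_succ', List.concat_eq_append]
  rfl

lemma initWord_congr {ω ω' : ℕ → Fin N} {n : ℕ} (h : ∀ k < n, ω' k = ω k) :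
    initWord ω' n = initWord ω n := by
  simp only [initWord]
  exact congrArg _ (funext fun k => h k k.2)

lemma wordMap_cons (i : Fin N) (w : List (Fin N)) (x : K) :
    L.wordMap (i :: w) x = L.ψ i (L.wordMap w x) := rfl

lemma wordMap_append_singleton (w : List (Fin N)) (i : Fin N) (x : K) :
    L.wordMap (w ++ [i]) x = L.wordMap w (L.ψ i x) := by
  rw [HarmonicStructure.wordMap_append]; rfl

lemma wordMap_initWord_π (ω : ℕ → Fin N) (n : ℕ) :
    L.wordMap (initWord ω n) (L.π (shiftSeq n ω)) = L.π ω := by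
  induction n generalizing ω with
  | zero => rw [initWord_zero]; rfl
  | succ n ih =>
    have h : shiftSeq (n + 1) ω = shiftSeq n (shiftSeq 1 ω) := rfl
    rw [initWord_succ, wordMap_cons, h, ih, ψ_π_shiftSeq]

lemma exists_cylinder_subset {O : Set (ℕ → Fin N)} (hO : IsOpen O) {ω : ℕ → Fin N} (hω : ω ∈ O) :
    ∃ n, ∀ ω' : ℕ → Fin N, (∀ k < n, ω' k = ω k) → ω' ∈ O := by
  obtain ⟨I, U, hU, hsub⟩ := isOpen_pi_iff.1 hO ω hω
  refine ⟨I.sup id + 1, fun ω' h => hsub fun k hk => ?_⟩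
  rw [h k (Nat.lt_succ_of_le (Finset.le_sup (f := id) hk))]
  exact (hU k hk).2

lemma isOpen_of_forall_cylinder {O : Set (ℕ → Fin N)}
    (h : ∀ ω ∈ O, ∃ n, ∀ ω' : ℕ → Fin N, (∀ k < n, ω' k = ω k) → ω' ∈ O) : IsOpen O := by
  rw [isOpen_iff_mem_nhds]
  intro ω hω
  obtain ⟨n, hn⟩ := h ω hω
  have hs : ShiftSpace.dependsOnFirst n {ω' : ℕ → Fin N | ∀ k < n, ω' k = ω k} :=
    fun a b hab ha k hk => (hab k hk).symm.trans (ha k hk)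
  exact mem_of_superset (hs.isOpen.mem_nhds fun _ _ => rfl) fun ω' h => hn ω' h

lemma isQuotientMap_π [T2Space K] : IsQuotientMap L.π :=
  L.π.continuous.isClosedMap.isQuotientMap L.π.continuous L.π_surjective

end SelfSimilarStructure

namespace HarmonicStructure

open SelfSimilarStructure

variable {K : Type*} [TopologicalSpace K] {N : ℕ} {L : PCFStructure K N} (H : HarmonicStructure L)

/-! ### Oscillation and energy -/

lemma continuous_E0 : Continuous fun x : (L.V0 → ℝ) × (L.V0 → ℝ) => H.E0 x.1 x.2 := by
  simp only [E0_eq_sum, Matrix.mulVec, dotProduct]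
  fun_prop

lemma E0_sub_const (u : L.V0 → ℝ) (c : ℝ) : H.E0 (fun p => u p - c) (fun p => u p - c) =
    H.E0 u u := by
  have h : (fun p => u p - c) = u + fun _ => -c := by funext p; simp [sub_eq_add_neg]
  rw [h]
  simp [E0_add_left, E0_add_right, E0_const_left, E0_const_right]

/-- Modulo constants `ℰ⁽⁰⁾` is a norm on the finite-dimensional space `l(V₀)`, so it controls the
oscillation. -/
lemma exists_osc_bound : ∃ C : ℝ, 0 ≤ C ∧
    ∀ (u : L.V0 → ℝ) (p q : L.V0), (u p - u q) ^ 2 ≤ C * H.E0 u u := by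
  by_cases hne : Nonempty L.V0
  swap
  · exact ⟨0, le_rfl, fun u p => (hne ⟨p⟩).elim⟩
  obtain ⟨p₀⟩ := hne
  let B : Set (L.V0 → ℝ) := Metric.sphere 0 1 ∩ {u | u p₀ = 0}
  have hB : IsCompact B := (isCompact_sphere _ _).inter_right
    (isClosed_eq (continuous_apply _) continuous_const)
  have hcont : Continuous fun u : L.V0 → ℝ => H.E0 u u :=
    H.continuous_E0.comp (continuous_id.prodMk continuous_id)
  obtain ⟨c, hc, hBc⟩ : ∃ c : ℝ, 0 < c ∧ ∀ u ∈ B, c ≤ H.E0 u u := by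
    by_cases hne : B.Nonempty
    · obtain ⟨u, hu, hmin⟩ := hB.exists_isMinOn hne hcont.continuousOn
      refine ⟨H.E0 u u, lt_of_le_of_ne (H.E0_nonneg u) fun h0 => ?_, fun v hv => hmin hv⟩
      obtain ⟨c, rfl⟩ := H.exists_const_of_E0 h0.symm
      have h1 : c = 0 := hu.2
      have h2 := hu.1
      rw [h1] at h2
      have h3 : ‖(fun _ : L.V0 => (0 : ℝ))‖ = 1 := by simpa using h2
      rw [show (fun _ : L.V0 => (0 : ℝ)) = 0 from rfl, norm_zero] at h3
      exact zero_ne_one h3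
    · exact ⟨1, one_pos, fun u hu => (hne ⟨u, hu⟩).elim⟩
  refine ⟨4 / c, by positivity, fun u p q => ?_⟩
  set v : L.V0 → ℝ := fun p => u p - u p₀
  have hv : c * ‖v‖ ^ 2 ≤ H.E0 u u := by
    by_cases hv0 : v = 0
    · simp only [hv0, norm_zero]
      simpa using H.E0_nonneg u
    · have hn : 0 < ‖v‖ := norm_pos_iff.2 hv0
      have h := hBc (‖v‖⁻¹ • v) ⟨by simp [norm_smul, hn.ne'], by simp [v]⟩
      rw [E0_smul_left, E0_smul_right, H.E0_sub_const u] at h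
      have h' : c * ‖v‖ ^ 2 ≤ (‖v‖⁻¹ * (‖v‖⁻¹ * H.E0 u u)) * ‖v‖ ^ 2 :=
        mul_le_mul_of_nonneg_right h (by positivity)
      refine h'.trans (le_of_eq ?_)
      field_simp
  have h1 : |u p - u q| ≤ 2 * ‖v‖ := by
    have hp := norm_le_pi_norm v p
    have hq := norm_le_pi_norm v q
    rw [Real.norm_eq_abs] at hp hq
    have : u p - u q = v p - v q := by simp [v]
    rw [this]
    exact (abs_sub _ _).trans (by linarith)
  have h2 : (u p - u q) ^ 2 ≤ 4 * ‖v‖ ^ 2 := by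
    rw [← sq_abs]
    nlinarith [abs_nonneg (u p - u q)]
  rw [div_mul_eq_mul_div, le_div_iff₀ hc]
  nlinarith

lemma IsRegular.exists_ratio (hreg : H.IsRegular) : ∃ ρ : ℝ, 0 ≤ ρ ∧ ρ < 1 ∧ ∀ i, H.r i ≤ ρ := by
  have : Nonempty (Fin N) := ⟨⟨0, by have := L.two_le; omega⟩⟩
  obtain ⟨i, hi⟩ := Finite.exists_max H.r
  exact ⟨H.r i, (H.r_pos i).le, hreg i, hi⟩

lemma energy_eq_of_E_eq {f : C(K, ℝ)} {c : ℝ} (h : ∀ m, H.E m f f = c) : H.energy f f = c := by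
  have : Tendsto (fun m => H.E m f f) atTop (𝓝 c) := by
    simp only [h]; exact tendsto_const_nhds
  exact this.limUnder_eq

lemma E_le_energy {f : C(K, ℝ)} (hf : f ∈ H.domain) (m : ℕ) : H.E m f f ≤ H.energy f f :=
  (monotone_nat_of_le_succ fun m => H.E_le_succ m f).ge_of_tendsto (H.tendsto_energy hf) m

lemma isMinimal_of_energy_eq {f : C(K, ℝ)} (hf : f ∈ H.domain)
    (h : H.energy f f = H.E0 (fun p => f p) fun p => f p) : H.IsMinimal f :=
  H.isMinimal_of_E_one_eq (le_antisymm (h ▸ H.E_le_energy hf 1) (H.E0_le_E_one f))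

/-- Energy minimality is inherited by the restrictions to cells. -/
lemma energy_comp_ψ_eq {f : C(K, ℝ)} (hf : f ∈ H.domain)
    (h : H.energy f f = H.E0 (fun p => f p) fun p => f p) (i : Fin N) :
    H.energy (f.comp (L.ψ i)) (f.comp (L.ψ i)) =
      H.E0 (fun p => f (L.ψ i p)) fun p => f (L.ψ i p) := by
  have h1 := H.isMinimal_of_energy_eq hf h f
  rw [E_one, ← h, H.energy_selfSimilar hf] at h1
  have hle : ∀ i ∈ Finset.univ, (H.r i)⁻¹ * H.E0 (fun p => f (L.ψ i p)) (fun p => f (L.ψ i p)) ≤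
      (H.r i)⁻¹ * H.energy (f.comp (L.ψ i)) (f.comp (L.ψ i)) := fun i _ => by
    refine mul_le_mul_of_nonneg_left ?_ (inv_nonneg.2 (H.r_pos i).le)
    have := H.E_le_energy (H.comp_ψ_mem hf i) 0
    rw [E_zero_eq] at this
    exact this
  have h2 := (Finset.sum_eq_sum_iff_of_le hle).1 h1 i (Finset.mem_univ i)
  exact (mul_left_cancel₀ (inv_ne_zero (H.r_pos i).ne') h2).symm

variable [CompactSpace K] [T2Space K] [ConnectedSpace K]

/-- The harmonic transfer matrix `A_{w_m} ⋯ A_{w_1}` along a word `w = w₁ ⋯ w_m`. -/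
def transferWord : List (Fin N) → (L.V0 → ℝ) →ₗ[ℝ] (L.V0 → ℝ)
  | [] => LinearMap.id
  | i :: w => (transferWord w).comp (H.transfer i)

@[simp] lemma transferWord_nil (u : L.V0 → ℝ) : H.transferWord [] u = u := rfl

@[simp] lemma transferWord_cons (i : Fin N) (w : List (Fin N)) (u : L.V0 → ℝ) :
    H.transferWord (i :: w) u = H.transferWord w (H.transfer i u) := rfl

lemma transferWord_append_singleton (w : List (Fin N)) (i : Fin N) (u : L.V0 → ℝ) :
    H.transferWord (w ++ [i]) u = H.transfer i (H.transferWord w u) := by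
  induction w generalizing u with
  | nil => rfl
  | cons j w ih => simp [ih]

lemma le_transferWord {u : L.V0 → ℝ} {c : ℝ} (h : ∀ p, c ≤ u p) (w : List (Fin N)) (p : L.V0) :
    c ≤ H.transferWord w u p := by
  induction w generalizing u with
  | nil => exact h p
  | cons j w ih => exact ih (H.le_transfer h j)

lemma E0_transferWord_le (w : List (Fin N)) (u : L.V0 → ℝ) :
    H.E0 (H.transferWord w u) (H.transferWord w u) ≤ H.rWord w * H.E0 u u := by
  induction w generalizing u with
  | nil => simp [rWord]
  | cons j w ih =>
    refine (ih _).trans ?_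
    rw [rWord_cons, mul_comm (H.r j), mul_assoc]
    exact mul_le_mul_of_nonneg_left (H.E0_transfer_le j u) (H.rWord_pos w).le

/-! ### Harmonic extension -/

/-- Along any sequence of cells the transferred boundary values settle down, at a rate that does
not depend on the sequence. -/
lemma exists_modulus (hreg : H.IsRegular) (u : L.V0 → ℝ) :
    ∃ δ : ℕ → ℝ, Tendsto δ atTop (𝓝 0) ∧ ∀ (ω : ℕ → Fin N) (n m : ℕ), n ≤ m → ∀ p q,
      |H.transferWord (initWord ω m) u p - H.transferWord (initWord ω n) u q| ≤ δ n := by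
  obtain ⟨C, hC, hosc⟩ := H.exists_osc_bound
  obtain ⟨ρ, hρ0, hρ1, hρ⟩ := hreg.exists_ratio
  have hr : ∀ ω : ℕ → Fin N, ∀ n, H.rWord (initWord ω n) ≤ ρ ^ n := fun ω n => by
    induction n generalizing ω with
    | zero => simp [initWord_zero, rWord]
    | succ n ih =>
      rw [initWord_succ, rWord_cons, pow_succ']
      exact mul_le_mul (hρ _) (ih _) (H.rWord_pos _).le hρ0
  refine ⟨fun n => √(C * (ρ ^ n * H.E0 u u)), ?_, fun ω n m hnm => ?_⟩
  · have h : Tendsto (fun n => C * (ρ ^ n * H.E0 u u)) atTop (𝓝 (C * (0 * H.E0 u u))) :=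
      ((tendsto_pow_atTop_nhds_zero_of_lt_one hρ0 hρ1).mul_const _).const_mul _
    simpa using h.sqrt
  · have h0 : ∀ p q, |H.transferWord (initWord ω n) u p - H.transferWord (initWord ω n) u q| ≤
        √(C * (ρ ^ n * H.E0 u u)) := fun p q => by
      refine Real.abs_le_sqrt ((hosc _ p q).trans (mul_le_mul_of_nonneg_left ?_ hC))
      exact (H.E0_transferWord_le _ u).trans
        (mul_le_mul_of_nonneg_right (hr ω n) (H.E0_nonneg u))
    have key : ∀ q p,
        H.transferWord (initWord ω n) u q - √(C * (ρ ^ n * H.E0 u u)) ≤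
          H.transferWord (initWord ω m) u p ∧
        H.transferWord (initWord ω m) u p ≤
          H.transferWord (initWord ω n) u q + √(C * (ρ ^ n * H.E0 u u)) := by
      induction m, hnm using Nat.le_induction with
      | base =>
        intro q p
        have := abs_le.1 (h0 p q)
        constructor <;> linarith [this.1, this.2]
      | succ m _ ih =>
        intro q p
        rw [initWord_succ', transferWord_append_singleton]
        exact ⟨H.le_transfer (fun p' => (ih q p').1) _ p, H.transfer_le (fun p' => (ih q p').2) _ p⟩
    intro p q
    have := key q p
    exact abs_le.2 ⟨by linarith [this.1], by linarith [this.2]⟩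

/-- The harmonic extension of boundary values `u`, as a function of the coding sequence. -/
def codedExt (u : L.V0 → ℝ) (ω : ℕ → Fin N) : ℝ :=
  limUnder atTop fun n => H.transferWord (initWord ω n) u (Classical.choice L.nonempty_V0)

lemma tendsto_codedExt (hreg : H.IsRegular) (u : L.V0 → ℝ) (ω : ℕ → Fin N) (p : ℕ → L.V0) :
    Tendsto (fun n => H.transferWord (initWord ω n) u (p n)) atTop (𝓝 (H.codedExt u ω)) := by
  obtain ⟨δ, hδ, h⟩ := H.exists_modulus hreg u
  set p₀ : L.V0 := Classical.choice L.nonempty_V0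
  have hc : CauchySeq fun n => H.transferWord (initWord ω n) u p₀ := by
    refine cauchySeq_of_le_tendsto_0 (fun n => δ n + δ n) (fun n m k hn hm => ?_)
      (by simpa using hδ.add hδ)
    refine (dist_triangle_right _ _ (H.transferWord (initWord ω k) u p₀)).trans ?_
    exact add_le_add (h ω k n hn _ _) (h ω k m hm _ _)
  have h1 := hc.tendsto_limUnder
  have h2 : Tendsto (fun n => H.transferWord (initWord ω n) u (p n) -
      H.transferWord (initWord ω n) u p₀) atTop (𝓝 0) :=
    squeeze_zero_norm (fun n => h ω n n le_rfl _ _) hδ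
  simpa [codedExt] using h2.add h1

lemma codedExt_eq (hreg : H.IsRegular) (u : L.V0 → ℝ) (ω : ℕ → Fin N) :
    H.codedExt u ω = H.codedExt (H.transfer (ω 0) u) (shiftSeq 1 ω) := by
  obtain ⟨p⟩ := L.nonempty_V0
  refine tendsto_nhds_unique ((tendsto_add_atTop_iff_nat 1).2
    (H.tendsto_codedExt hreg u ω fun _ => p)) ?_
  simp only [initWord_succ, transferWord_cons]
  exact H.tendsto_codedExt hreg _ _ _

lemma continuous_codedExt (hreg : H.IsRegular) (u : L.V0 → ℝ) : Continuous (H.codedExt u) := by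
  obtain ⟨δ, hδ, h⟩ := H.exists_modulus hreg u
  obtain ⟨p⟩ := L.nonempty_V0
  have hu : TendstoUniformly (fun n ω => H.transferWord (initWord ω n) u p) (H.codedExt u)
      atTop := by
    rw [Metric.tendstoUniformly_iff]
    intro ε hε
    filter_upwards [hδ.eventually (gt_mem_nhds hε)] with n hn ω
    refine lt_of_le_of_lt ?_ hn
    refine le_of_tendsto ((H.tendsto_codedExt hreg u ω fun _ => p).dist tendsto_const_nhds) ?_
    filter_upwards [eventually_ge_atTop n] with m hm
    exact h ω n m hm p p
  refine hu.continuous (Eventually.frequently (Eventually.of_forall fun n => ?_))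
  refine continuous_def.2 fun s _ => isOpen_of_forall_cylinder fun ω hω => ⟨n, fun ω' h => ?_⟩
  rw [Set.mem_preimage] at hω ⊢
  rwa [initWord_congr h]

lemma codedExt_of_mem_V0 (hreg : H.IsRegular) (u : L.V0 → ℝ) (ω : ℕ → Fin N)
    (h : L.π ω ∈ L.V0) : H.codedExt u ω = u ⟨L.π ω, h⟩ := by
  have hn : ∀ n, L.π (shiftSeq n ω) ∈ L.V0 := fun n => by
    induction n with
    | zero => exact h
    | succ n ih =>
      have := L.π_shiftSeq_mem_V0 ih
      have h' : shiftSeq 1 (shiftSeq n ω) = shiftSeq (n + 1) ω := by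
        funext k; simp only [shiftSeq]; congr 1; omega
      rwa [h'] at this
  have hval : ∀ n, H.transferWord (initWord ω n) u ⟨_, hn n⟩ = u ⟨L.π ω, hn 0⟩ := fun n => by
    clear h
    induction n generalizing u ω with
    | zero => rw [initWord_zero]; rfl
    | succ n ih =>
      rw [initWord_succ, transferWord_cons]
      have := ih (H.transfer (ω 0) u) (shiftSeq 1 ω) (fun k => hn (k + 1))
      refine this.trans ?_
      exact H.transfer_of_ψ_eq u (p := ⟨L.π ω, hn 0⟩) (L.ψ_π_shiftSeq ω)
  refine tendsto_nhds_unique (H.tendsto_codedExt hreg u ω fun n => ⟨_, hn n⟩) ?_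
  simp only [hval]
  exact tendsto_const_nhds

/-- The coded extension takes one value on all codings of a point. At the first letter where two
codings differ the point lies in the overlap, where both cells see a boundary value. -/
lemma codedExt_congr (hreg : H.IsRegular) (u : L.V0 → ℝ) {ω τ : ℕ → Fin N}
    (h : L.π ω = L.π τ) : H.codedExt u ω = H.codedExt u τ := by
  have hdiff : ∀ (u : L.V0 → ℝ) (ω τ : ℕ → Fin N), L.π ω = L.π τ → ω 0 ≠ τ 0 →
      H.codedExt u ω = H.codedExt u τ := by
    intro u ω τ h h0
    have hω := L.ψ_π_shiftSeq ω
    have hτ := L.ψ_π_shiftSeq τ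
    have hov : L.π ω ∈ L.overlap := L.mem_overlap h0 ⟨_, hω⟩ ⟨_, hτ.trans h.symm⟩
    have h1 := L.π_shiftSeq_mem_V0_of_overlap hov
    have h2 := L.π_shiftSeq_mem_V0_of_overlap (h ▸ hov)
    rw [H.codedExt_eq hreg u ω, H.codedExt_eq hreg u τ, H.codedExt_of_mem_V0 hreg _ _ h1,
      H.codedExt_of_mem_V0 hreg _ _ h2]
    exact H.transfer_eq_of_ψ_eq u (p := ⟨_, h1⟩) (q := ⟨_, h2⟩) (hω.trans (h.trans hτ.symm))
  by_cases hne : ∃ n, ω n ≠ τ n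
  · obtain ⟨n, hn⟩ := hne
    induction n generalizing u ω τ with
    | zero => exact hdiff u ω τ h hn
    | succ n ih =>
      by_cases h0 : ω 0 = τ 0
      · rw [H.codedExt_eq hreg u ω, H.codedExt_eq hreg u τ, h0]
        refine ih _ (L.ψ_injective (ω 0) ?_) hn
        rw [L.ψ_π_shiftSeq, h0, L.ψ_π_shiftSeq, h]
      · exact hdiff u ω τ h h0
  · push Not at hne
    rw [funext hne]

/-- The harmonic extension of boundary values `u` to a continuous function on `K`. -/
def harmonicExt (hreg : H.IsRegular) (u : L.V0 → ℝ) : C(K, ℝ) :=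
  L.isQuotientMap_π.lift ⟨H.codedExt u, H.continuous_codedExt hreg u⟩
    fun _ _ h => H.codedExt_congr hreg u h

lemma harmonicExt_π (hreg : H.IsRegular) (u : L.V0 → ℝ) (ω : ℕ → Fin N) :
    H.harmonicExt hreg u (L.π ω) = H.codedExt u ω :=
  ContinuousMap.congr_fun (L.isQuotientMap_π.lift_comp
    ⟨H.codedExt u, H.continuous_codedExt hreg u⟩ fun _ _ h => H.codedExt_congr hreg u h) ω

lemma harmonicExt_boundary (hreg : H.IsRegular) (u : L.V0 → ℝ) (p : L.V0) :
    H.harmonicExt hreg u p = u p := by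
  obtain ⟨ω, hω⟩ := L.π_surjective p
  have h : L.π ω ∈ L.V0 := hω ▸ p.2
  rw [← hω, harmonicExt_π, H.codedExt_of_mem_V0 hreg u ω h]
  exact congrArg u (Subtype.ext hω)

lemma harmonicExt_ψ (hreg : H.IsRegular) (u : L.V0 → ℝ) (i : Fin N) (x : K) :
    H.harmonicExt hreg u (L.ψ i x) = H.harmonicExt hreg (H.transfer i u) x := by
  obtain ⟨ω, rfl⟩ := L.π_surjective x
  rw [L.ψ_π, harmonicExt_π, harmonicExt_π, codedExt_eq H hreg]
  rfl

lemma harmonicExt_wordMap (hreg : H.IsRegular) (u : L.V0 → ℝ) (w : List (Fin N)) (x : K) :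
    H.harmonicExt hreg u (L.wordMap w x) = H.harmonicExt hreg (H.transferWord w u) x := by
  induction w generalizing u with
  | nil => rfl
  | cons i w ih => rw [wordMap_cons, harmonicExt_ψ, ih]; rfl

lemma le_harmonicExt (hreg : H.IsRegular) {u : L.V0 → ℝ} {c : ℝ} (h : ∀ p, c ≤ u p) (x : K) :
    c ≤ H.harmonicExt hreg u x := by
  obtain ⟨ω, rfl⟩ := L.π_surjective x
  obtain ⟨p⟩ := L.nonempty_V0
  rw [harmonicExt_π]
  exact ge_of_tendsto' (H.tendsto_codedExt hreg u ω fun _ => p) fun n => H.le_transferWord h _ _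

lemma harmonicExt_zero (hreg : H.IsRegular) (x : K) : H.harmonicExt hreg 0 x = 0 := by
  obtain ⟨ω, rfl⟩ := L.π_surjective x
  obtain ⟨p⟩ := L.nonempty_V0
  rw [harmonicExt_π]
  refine tendsto_nhds_unique (H.tendsto_codedExt hreg 0 ω fun _ => p) ?_
  simp

lemma E_harmonicExt (hreg : H.IsRegular) (m : ℕ) (u : L.V0 → ℝ) (z : K → ℝ) :
    H.E m (H.harmonicExt hreg u) z = H.E0 u fun p => z p := by
  induction m generalizing u z with
  | zero =>
    rw [E_zero_eq]
    simp only [harmonicExt_boundary]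
  | succ m ih =>
    rw [E_succ]
    simp only [harmonicExt_ψ, ih]
    exact H.sum_E0_transfer u z

/-! ### Harmonic functions -/

/-- Harmonic functions have no more energy than their boundary values: the harmonic extension of
these is a competitor. -/
lemma IsHarmonic.energy_eq (hreg : H.IsRegular) {f : C(K, ℝ)} (hf : H.IsHarmonic f) :
    H.energy f f = H.E0 (fun p => f p) fun p => f p := by
  set u : L.V0 → ℝ := fun p => f p
  have hE : ∀ m, H.E m (H.harmonicExt hreg u) (H.harmonicExt hreg u) = H.E0 u u := fun m => by
    rw [E_harmonicExt]
    simp only [harmonicExt_boundary]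
  refine le_antisymm ?_ ?_
  · rw [← H.energy_eq_of_E_eq hE]
    refine hf.2 _ ⟨H.E0 u u, ?_⟩ fun p hp => H.harmonicExt_boundary hreg u ⟨p, hp⟩
    simp only [hE]
    exact tendsto_const_nhds
  · have := H.E_le_energy hf.1 0
    rwa [E_zero_eq] at this

/-- The boundary values of `ψ_w^* f`. -/
def cellValues (f : C(K, ℝ)) (w : List (Fin N)) : L.V0 → ℝ := fun p => f (L.wordMap w p)

/-- The values of `f` on cells of level at least `m` are related by the harmonic transfer
matrices. -/
def IsTransferred (m : ℕ) (f : C(K, ℝ)) : Prop :=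
  ∀ w : List (Fin N), m ≤ w.length → ∀ i,
    cellValues (L := L) f (w ++ [i]) = H.transfer i (cellValues f w)

lemma IsPiecewiseHarmonic.exists_isTransferred (hreg : H.IsRegular) {f : C(K, ℝ)}
    (hf : H.IsPiecewiseHarmonic f) : ∃ m, H.IsTransferred m f := by
  obtain ⟨hfd, m, hm⟩ := hf
  refine ⟨m, ?_⟩
  have key : ∀ (n : ℕ) (w : List (Fin N)), w.length = m + n →
      H.energy (f.comp (L.wordMap w)) (f.comp (L.wordMap w)) =
        H.E0 (cellValues f w) (cellValues f w) := by
    intro n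
    induction n with
    | zero => intro w hw; exact (hm w hw).energy_eq H hreg
    | succ n ih =>
      intro w hw
      rcases List.eq_nil_or_concat' w with rfl | ⟨v, i, rfl⟩
      · simp at hw
      · have hv : v.length = m + n := by simp at hw; omega
        have h := H.energy_comp_ψ_eq (H.comp_wordMap_mem hfd v) (ih v hv) i
        have h1 : f.comp (L.wordMap (v ++ [i])) = (f.comp (L.wordMap v)).comp (L.ψ i) := by
          rw [wordMap_append]; rfl
        have h2 : (fun p : L.V0 => (f.comp (L.wordMap v)) (L.ψ i p)) =
            cellValues f (v ++ [i]) := by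
          funext p
          rw [cellValues, wordMap_append_singleton]; rfl
        rw [h1, h, h2]
  intro w hw i
  obtain ⟨n, hn⟩ := Nat.exists_eq_add_of_le hw
  have hmin := H.isMinimal_of_energy_eq (H.comp_wordMap_mem hfd w) (key n w hn)
  have := IsMinimal.comp_ψ_eq H hmin i
  refine Eq.trans ?_ this
  funext p
  rw [cellValues, wordMap_append_singleton]; rfl

variable {H}

lemma IsTransferred.mono {m n : ℕ} (h : m ≤ n) {f : C(K, ℝ)} (hf : H.IsTransferred m f) :
    H.IsTransferred n f := fun w hw => hf w (h.trans hw)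

lemma IsTransferred.add {m : ℕ} {f g : C(K, ℝ)} (hf : H.IsTransferred m f)
    (hg : H.IsTransferred m g) : H.IsTransferred m (f + g) := fun w hw i => by
  have h : ∀ w, cellValues (L := L) (f + g) w = cellValues f w + cellValues g w := fun w => rfl
  rw [h, h, hf w hw, hg w hw, map_add]

lemma IsTransferred.E_eq {m : ℕ} {f g : C(K, ℝ)} (hf : H.IsTransferred m f)
    (hg : H.IsTransferred m g) (n : ℕ) (w : List (Fin N)) (hw : m ≤ w.length) :
    H.E n (f.comp (L.wordMap w)) (g.comp (L.wordMap w)) =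
      H.E0 (cellValues f w) (cellValues g w) := by
  induction n generalizing w with
  | zero => rw [E_zero_eq]; rfl
  | succ n ih =>
    rw [E_succ, ← H.sum_E0_transfer_transfer (cellValues f w)]
    refine Finset.sum_congr rfl fun i _ => ?_
    rw [← hf w hw, ← hg w hw, ← ih (w ++ [i]) (by simp; omega), wordMap_append]
    rfl

end HarmonicStructure

namespace SelfSimilarStructure

variable {K : Type*} [TopologicalSpace K] {N : ℕ} (L : SelfSimilarStructure K N)

lemma exists_wordMap_π (ω τ : ℕ → Fin N) (n : ℕ) : ∃ ω' : ℕ → Fin N, (∀ k < n, ω' k = ω k) ∧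
    L.wordMap (initWord ω n) (L.π τ) = L.π ω' := by
  let ω' : ℕ → Fin N := fun k => if k < n then ω k else τ (k - n)
  have h1 : ∀ k < n, ω' k = ω k := fun k hk => by simp [ω', hk]
  have h2 : shiftSeq n ω' = τ := by
    funext k
    simp [shiftSeq, ω']
  refine ⟨ω', h1, ?_⟩
  rw [← initWord_congr h1, ← h2, L.wordMap_initWord_π]

lemma π_iterate_consSeq {i : Fin N} {p : K} (hp : L.ψ i p = p) {τ : ℕ → Fin N} (hτ : L.π τ = p)
    (n : ℕ) : L.π ((consSeq i)^[n] τ) = p := by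
  induction n with
  | zero => exact hτ
  | succ n ih => rw [Function.iterate_succ_apply', ← L.ψ_π, ih, hp]

lemma iterate_consSeq_of_lt (i : Fin N) (τ : ℕ → Fin N) {n k : ℕ} (h : k < n) :
    (consSeq i)^[n] τ k = i := by
  induction n generalizing k with
  | zero => omega
  | succ n ih =>
    rw [Function.iterate_succ_apply']
    cases k with
    | zero => rfl
    | succ k => exact ih (by omega)

lemma iterate_consSeq_self (i : Fin N) (τ : ℕ → Fin N) (n : ℕ) :
    (consSeq i)^[n] τ n = τ 0 := by
  induction n with
  | zero => rfl
  | succ n ih =>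
    rw [Function.iterate_succ_apply']
    exact ih

lemma fixedPoint_unique [T2Space K] {i : Fin N} {p q : K} (hp : L.ψ i p = p)
    (hq : L.ψ i q = q) : p = q := by
  have h : ∀ {p : K}, L.ψ i p = p → p = L.π fun _ => i := by
    intro p hp
    obtain ⟨τ, hτ⟩ := L.π_surjective p
    have h1 : Tendsto (fun n => (consSeq i)^[n] τ) atTop (𝓝 fun _ => i) := by
      refine tendsto_pi_nhds.2 fun k => tendsto_const_nhds.congr' ?_
      filter_upwards [eventually_gt_atTop k] with n hn
      exact (iterate_consSeq_of_lt i τ hn).symm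
    have h2 := (L.π.continuous.tendsto _).comp h1
    simp only [Function.comp_def, L.π_iterate_consSeq hp hτ] at h2
    exact tendsto_nhds_unique tendsto_const_nhds h2
  rw [h hp, h hq]

end SelfSimilarStructure

namespace PCFStructure

open SelfSimilarStructure

variable {K : Type*} [TopologicalSpace K] {N : ℕ} (L : PCFStructure K N)

/-- A fixed point of `ψ_i` lies in no other cell `ψ_j(K)`: otherwise the sequences `i ⋯ i j ⋯`
coding it would give infinitely many postcritical sequences. -/
lemma eq_of_ψ_eq_fixedPoint {i j : Fin N} {p q : K} (hp : L.ψ i p = p) (hq : L.ψ j q = p) :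
    j = i := by
  by_contra hij
  obtain ⟨τ, rfl⟩ := L.π_surjective q
  have hov : p ∈ L.overlap := L.mem_overlap hij ⟨_, hq⟩ ⟨p, hp⟩
  have hτ : L.π (consSeq j τ) = p := by rw [← L.ψ_π, hq]
  let s : ℕ → ℕ → Fin N := fun n => (consSeq i)^[n] (consSeq j τ)
  have hmem : ∀ n, s n ∈ L.postCritical := fun n => by
    have h1 : L.π (s (n + 1)) ∈ L.overlap := by
      simp only [s]
      rw [L.π_iterate_consSeq hp hτ]
      exact hov
    have h2 : shiftSeq 1 (s (n + 1)) = s n := by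
      simp only [s, Function.iterate_succ_apply']
      rfl
    rw [← h2]
    exact L.shiftSeq_mem_postCritical_of_overlap h1
  have hlt : ∀ m n, m < n → s m ≠ s n := fun m n hmn h => by
    have h1 := congrFun h m
    simp only [s] at h1
    rw [iterate_consSeq_self, iterate_consSeq_of_lt i _ hmn] at h1
    exact hij h1
  refine Set.infinite_of_injective_forall_mem (f := s) (fun m n h => ?_) hmem L.finite_postCritical
  rcases lt_trichotomy m n with h' | h' | h'
  · exact (hlt m n h' h).elim
  · exact h'
  · exact (hlt n m h' h.symm).elim

lemma eq_of_ψ_mem_V0 [T2Space K] (hfix : ∀ p ∈ L.V0, ∃ i, L.ψ i p = p) {i : Fin N} {p x : K}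
    (hp : L.ψ i p = p) (hx : L.ψ i x ∈ L.V0) : x = p := by
  obtain ⟨j, hj⟩ := hfix _ hx
  have hij : i = j := L.eq_of_ψ_eq_fixedPoint hj rfl
  subst hij
  exact L.ψ_injective i ((L.fixedPoint_unique hj hp).trans hp.symm)

end PCFStructure

namespace HarmonicStructure

open SelfSimilarStructure

variable {K : Type*} [TopologicalSpace K] {N : ℕ} {L : PCFStructure K N} (H : HarmonicStructure L)

/-- Minimum principle for `D`: a nonnegative function that has a zero and is harmonic at its zeros
vanishes. -/
lemma eq_zero_of_mulVec_eq_zero {v : L.V0 → ℝ} (hv : ∀ p, 0 ≤ v p) {q₀ : L.V0} (hq₀ : v q₀ = 0)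
    (h : ∀ q, v q = 0 → (H.D *ᵥ v) q = 0) : v = 0 := by
  classical
  have hD : ∀ q s, v q = 0 → v s ≠ 0 → H.D q s = 0 := by
    intro q s hq hs
    have h1 := h q hq
    rw [Matrix.mulVec, dotProduct, Finset.sum_eq_zero_iff_of_nonneg] at h1
    · exact (mul_eq_zero.1 (h1 s (Finset.mem_univ s))).resolve_right hs
    · intro t _
      by_cases hqt : q = t
      · simp [← hqt, hq]
      · exact mul_nonneg (H.D_offDiag q t hqt) (hv t)
  let w : L.V0 → ℝ := fun q => if v q = 0 then 1 else 0
  have hw : H.E0 w w = 0 := by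
    rw [E0_self_eq_sum, Finset.sum_eq_zero, mul_zero]
    intro q _
    refine Finset.sum_eq_zero fun s _ => ?_
    by_cases hq : v q = 0 <;> by_cases hs : v s = 0
    · simp [w, hq, hs]
    · simp [hD q s hq hs]
    · rw [← H.D_symm.apply, hD s q hs hq, zero_mul]
    · simp [w, hq, hs]
  obtain ⟨c, hc⟩ := H.exists_const_of_E0 hw
  have h1 : c = 1 := by
    have := congrFun hc q₀
    simpa [w, hq₀] using this.symm
  funext s
  by_contra hs
  have := congrFun hc s
  simp only [w, h1, ite_eq_left_iff, zero_ne_one, imp_false, not_not] at this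
  exact hs this

lemma E0_single [DecidableEq L.V0] (u : L.V0 → ℝ) (p : L.V0) :
    H.E0 u (Pi.single p 1) = -(H.D *ᵥ u) p := by
  simp [E0, PCFStructure.energy0]

variable [CompactSpace K] [T2Space K] [ConnectedSpace K]

/-- The normal derivative `(D u)(p)` at a fixed point `p` of `ψ_i` is a left eigenvector of the
transfer matrix `A_i` with eigenvalue `r_i`, because `p` lies in the cell `ψ_i(K)` only. -/
lemma mulVec_transfer {i : Fin N} {p : L.V0} (hp : L.ψ i p = p) (u : L.V0 → ℝ) :
    (H.D *ᵥ H.transfer i u) p = H.r i * (H.D *ᵥ u) p := by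
  classical
  have h := H.sum_E0_transfer u (Pi.single (p : K) 1)
  have h0 : (fun q : L.V0 => (Pi.single (p : K) 1 : K → ℝ) q) = Pi.single p 1 := by
    funext q
    by_cases hq : q = p
    · simp [hq]
    · have : (q : K) ≠ p := fun h => hq (Subtype.ext h)
      simp [hq, this]
  rw [h0, Finset.sum_eq_single i, E0_single] at h
  · have h1 : (fun q : L.V0 => (Pi.single (p : K) 1 : K → ℝ) (L.ψ i q)) = Pi.single p 1 := by
      funext q
      by_cases hq : q = p
      · simp [hq, hp]
      · have : L.ψ i q ≠ p := fun h => hq (Subtype.ext (L.ψ_injective i (h.trans hp.symm)))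
        simp [hq, this]
    rw [h1, E0_single] at h
    have := (H.r_pos i).ne'
    field_simp at h
    linarith
  · intro j _ hj
    have h1 : (fun q : L.V0 => (Pi.single (p : K) 1 : K → ℝ) (L.ψ j q)) = fun _ => 0 := by
      funext q
      have : L.ψ j q ≠ p := fun h => hj (L.eq_of_ψ_eq_fixedPoint hp h)
      simp [this]
    rw [h1, E0_const_right, mul_zero]
  · simp

/-! ### Strong minimum principle -/

lemma transferWord_eq_zero (hreg : H.IsRegular) {u : L.V0 → ℝ} (hu : ∀ p, 0 ≤ u p)
    {w : List (Fin N)} (hw : ∀ q : L.V0, L.wordMap w q ∉ L.V0) {q : L.V0}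
    (hq : H.transferWord w u q = 0) : H.transferWord w u = 0 := by
  classical
  refine H.eq_zero_of_mulVec_eq_zero (H.le_transferWord hu w) hq fun q hq => ?_
  have hval : ∀ v (s : L.V0), H.harmonicExt hreg u (L.wordMap v s) = H.transferWord v u s :=
    fun v s => by rw [harmonicExt_wordMap, harmonicExt_boundary]
  set x := L.wordMap w q
  -- test the harmonic extension against the indicator of the vertex `x`, which is not in `V₀`
  have h := H.E_harmonicExt hreg w.length u (Pi.single x 1)
  have h0 : (fun p : L.V0 => (Pi.single x 1 : K → ℝ) p) = fun _ => 0 := by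
    funext p
    have : (p : K) ≠ x := fun h => hw q (show x ∈ L.V0 from h ▸ p.2)
    simp [this]
  rw [h0, E0_const_right, E_def] at h
  have hterm : ∀ (v : List (Fin N)) (s : L.V0),
      0 ≤ (H.D *ᵥ H.transferWord v u) s * (Pi.single x 1 : K → ℝ) (L.wordMap v s) := by
    intro v s
    by_cases hs : L.wordMap v s = x
    · have hs0 : H.transferWord v u s = 0 := by
        rw [← hval, hs]; simp only [x]; rw [hval, hq]
      rw [hs, Pi.single_eq_same, mul_one, Matrix.mulVec, dotProduct]
      refine Finset.sum_nonneg fun t _ => ?_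
      by_cases hst : s = t
      · simp [← hst, hs0]
      · exact mul_nonneg (H.D_offDiag s t hst) (H.le_transferWord hu v t)
    · simp [hs]
  have hsum : ∀ v : List (Fin N), L.energy0 H.D (fun p => H.harmonicExt hreg u (L.wordMap v p))
      (fun p => (Pi.single x 1 : K → ℝ) (L.wordMap v p)) =
      -∑ s, (H.D *ᵥ H.transferWord v u) s * (Pi.single x 1 : K → ℝ) (L.wordMap v s) := by
    intro v
    have : (fun p : L.V0 => H.harmonicExt hreg u (L.wordMap v p)) = H.transferWord v u :=
      funext (hval v)
    rw [this]
    exact H.E0_eq_sum _ _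
  have hw' := (Finset.sum_eq_zero_iff_of_nonpos fun v _ => ?_).1 h w.get (Finset.mem_univ _)
  · rw [List.ofFn_get, hsum] at hw'
    have h1 := (mul_eq_zero.1 hw').resolve_left (inv_ne_zero (H.rWord_pos w).ne')
    rw [neg_eq_zero, Finset.sum_eq_zero_iff_of_nonneg fun s _ => hterm w s] at h1
    have h2 := h1 q (Finset.mem_univ q)
    simpa [x] using h2
  · rw [hsum]
    exact mul_nonpos_of_nonneg_of_nonpos (inv_nonneg.2 (H.rWord_pos _).le)
      (neg_nonpos.2 (Finset.sum_nonneg fun s _ => hterm _ s))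

/-- Off the boundary the zero set of a nonnegative harmonic function is open. -/
lemma isOpen_zeros (hreg : H.IsRegular) {u : L.V0 → ℝ} (hu : ∀ p, 0 ≤ u p) :
    IsOpen {x | H.harmonicExt hreg u x = 0 ∧ x ∉ L.V0} := by
  have hV0 : IsOpen (L.V0)ᶜ := (Set.toFinite L.V0).isClosed.isOpen_compl
  rw [isOpen_iff_mem_nhds]
  rintro x ⟨hx, hxV⟩
  let G : Set (ℕ → Fin N) := {ω | ∃ n, H.transferWord (initWord ω n) u = 0}
  have hG : IsOpen G := isOpen_of_forall_cylinder fun ω ⟨n, hn⟩ =>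
    ⟨n, fun ω' h => ⟨n, by rwa [initWord_congr h]⟩⟩
  have hxG : x ∈ (L.π '' Gᶜ)ᶜ := by
    rintro ⟨ω, hω, rfl⟩
    obtain ⟨n, hn⟩ := exists_cylinder_subset (hV0.preimage L.π.continuous) (ω := ω) hxV
    refine hω ⟨n, ?_⟩
    by_contra hne
    have hpos : ∀ q, 0 < H.transferWord (initWord ω n) u q := fun q => by
      refine lt_of_le_of_ne (H.le_transferWord hu _ q) fun h0 => hne ?_
      refine H.transferWord_eq_zero hreg hu (fun s => ?_) h0.symm
      obtain ⟨τ, hτ⟩ := L.π_surjective s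
      obtain ⟨ω', h1, h2⟩ := L.exists_wordMap_π ω τ n
      rw [← hτ, h2]
      exact hn ω' h1
    have := L.nonempty_V0
    obtain ⟨q, hq⟩ := Finite.exists_min (H.transferWord (initWord ω n) u)
    have h1 := H.le_harmonicExt hreg hq (L.π (shiftSeq n ω))
    rw [← harmonicExt_wordMap, L.wordMap_initWord_π, hx] at h1
    exact absurd (hpos q) (not_lt.2 h1)
  have hopen : IsOpen (L.π '' Gᶜ)ᶜ := (L.π.continuous.isClosedMap _ hG.isClosed_compl).isOpen_compl
  filter_upwards [hopen.mem_nhds hxG, hV0.mem_nhds hxV] with y hy hyV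
  refine ⟨?_, hyV⟩
  obtain ⟨ω, rfl⟩ := L.π_surjective y
  have hω : ω ∈ G := by
    by_contra h
    exact hy ⟨ω, h, rfl⟩
  obtain ⟨n, hn⟩ := hω
  rw [← L.wordMap_initWord_π ω n, harmonicExt_wordMap, hn, harmonicExt_zero]

/-- If `ψ_i p = p` and `K ∖ {p}` is connected, then for `u ≥ 0` the function `A_i u` is either zero
or strictly positive off `p`. -/
lemma transfer_eq_zero_or_pos (hreg : H.IsRegular) (hfix : ∀ p ∈ L.V0, ∃ i, L.ψ i p = p)
    {i : Fin N} {p : L.V0} (hp : L.ψ i p = p) (hconn : IsPreconnected ({(p : K)}ᶜ : Set K))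
    {u : L.V0 → ℝ} (hu : ∀ q, 0 ≤ u q) :
    (∀ q, q ≠ p → H.transfer i u q = 0) ∨ ∀ q, q ≠ p → 0 < H.transfer i u q := by
  have hval : ∀ q : L.V0, H.harmonicExt hreg u (L.ψ i q) = H.transfer i u q := fun q => by
    rw [harmonicExt_ψ, harmonicExt_boundary]
  have hcont : Continuous fun x => H.harmonicExt hreg u (L.ψ i x) :=
    (H.harmonicExt hreg u).continuous.comp (L.ψ i).continuous
  have hZ := (H.isOpen_zeros hreg hu).preimage (L.ψ i).continuous
  have hP : IsOpen {x | 0 < H.harmonicExt hreg u (L.ψ i x)} := isOpen_lt continuous_const hcont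
  have hor := hconn.subset_or_subset hZ hP ?_ ?_
  · refine hor.imp (fun h q hq => ?_) fun h q hq => ?_
    · rw [← hval]
      exact (h (show (q : K) ∈ ({(p : K)}ᶜ : Set K) from fun h => hq (Subtype.ext h))).1
    · rw [← hval]
      exact h (show (q : K) ∈ ({(p : K)}ᶜ : Set K) from fun h => hq (Subtype.ext h))
  · rw [Set.disjoint_left]
    intro x h0 h1
    exact (show 0 < H.harmonicExt hreg u (L.ψ i x) from h1).ne' h0.1
  · intro x hx
    rcases (H.le_harmonicExt hreg hu (L.ψ i x)).eq_or_lt with h | h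
    · exact Or.inl ⟨h.symm, fun hV => hx (L.eq_of_ψ_mem_V0 hfix hp hV)⟩
    · exact Or.inr h

end HarmonicStructure

namespace HarmonicStructure

open SelfSimilarStructure

variable {K : Type*} [TopologicalSpace K] {N : ℕ} {L : PCFStructure K N} (H : HarmonicStructure L)

/-! ### Contraction on functions without normal derivative -/

lemma mulVec_eq_sum_erase [DecidableEq L.V0] {p : L.V0} {u : L.V0 → ℝ} (hu : u p = 0) :
    (H.D *ᵥ u) p = ∑ q ∈ Finset.univ.erase p, H.D p q * u q := by
  rw [Matrix.mulVec, dotProduct, ← Finset.add_sum_erase _ _ (Finset.mem_univ p), hu, mul_zero,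
    zero_add]

lemma mulVec_nonneg {p : L.V0} {u : L.V0 → ℝ} (hu0 : ∀ q, 0 ≤ u q) (hu : u p = 0) :
    0 ≤ (H.D *ᵥ u) p := by
  classical
  rw [H.mulVec_eq_sum_erase hu]
  exact Finset.sum_nonneg fun q hq =>
    mul_nonneg (H.D_offDiag p q (Finset.ne_of_mem_erase hq).symm) (hu0 q)

lemma exists_D_pos {p : L.V0} (hD : ∃ u, (H.D *ᵥ u) p ≠ 0) : ∃ q, q ≠ p ∧ 0 < H.D p q := by
  classical
  by_contra! h
  obtain ⟨u, hu⟩ := hD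
  apply hu
  have h0 : ∀ q, q ≠ p → H.D p q = 0 := fun q hq =>
    le_antisymm (h q hq) (H.D_offDiag p q hq.symm)
  have h1 := congrFun (H.mulVec_const (u p)) p
  have h2 : u = (fun q => u q - u p) + fun _ => u p := by funext q; simp
  rw [h2, Matrix.mulVec_add, Pi.add_apply, h1, H.mulVec_eq_sum_erase (by simp), Pi.zero_apply,
    add_zero]
  exact Finset.sum_eq_zero fun q hq => by rw [h0 q (Finset.ne_of_mem_erase hq), zero_mul]

variable [CompactSpace K] [T2Space K] [ConnectedSpace K]

lemma transfer_eq_sum [DecidableEq L.V0] (i : Fin N) (u : L.V0 → ℝ) (q : L.V0) :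
    H.transfer i u q = ∑ s, u s * H.transfer i (Pi.single s 1) q := by
  have h := LinearMap.pi_apply_eq_sum_univ (H.transfer i) u
  have h1 := congrFun h q
  rw [h1, Finset.sum_apply]
  refine Finset.sum_congr rfl fun s _ => ?_
  have : (fun j => if s = j then (1 : ℝ) else 0) = Pi.single s 1 := by
    funext j
    simp [Pi.single_apply, eq_comm]
  rw [this]
  rfl

/-- The columns of `A_i` off `p` are comparable to the row `D_{p ·}`, from above and from below:
column `s` is positive if `D_{ps} > 0` and zero if `D_{ps} = 0`. -/
lemma exists_column_bounds (hreg : H.IsRegular) (hfix : ∀ p ∈ L.V0, ∃ i, L.ψ i p = p)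
    {i : Fin N} {p : L.V0} (hp : L.ψ i p = p) (hconn : IsPreconnected ({(p : K)}ᶜ : Set K))
    (hD : ∃ u, (H.D *ᵥ u) p ≠ 0) :
    ∃ ε M : ℝ, 0 < ε ∧ 0 ≤ M ∧ ∀ u : L.V0 → ℝ, (∀ q, 0 ≤ u q) → u p = 0 → ∀ q, q ≠ p →
      ε * (H.D *ᵥ u) p ≤ H.transfer i u q ∧ H.transfer i u q ≤ M * (H.D *ᵥ u) p := by
  classical
  obtain ⟨q₁, hq₁, hDq₁⟩ := H.exists_D_pos hD
  have hcol : ∀ s, s ≠ p → 0 ≤ H.D p s ∧ ∀ q, q ≠ p →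
      (0 < H.D p s → 0 < H.transfer i (Pi.single s 1) q) ∧
      (H.D p s = 0 → H.transfer i (Pi.single s 1) q = 0) := by
    intro s hs
    have hs0 : ∀ t, (0 : ℝ) ≤ (Pi.single s 1 : L.V0 → ℝ) t := fun t => by
      by_cases h : t = s <;> simp [h]
    have hsp : (Pi.single s 1 : L.V0 → ℝ) p = 0 := by simp [hs.symm]
    have hAp : H.transfer i (Pi.single s 1) p = 0 := by rw [H.transfer_of_ψ_eq _ hp, hsp]
    have hℓ : (H.D *ᵥ H.transfer i (Pi.single s 1)) p = H.r i * H.D p s := by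
      rw [H.mulVec_transfer hp]; simp
    have hr := H.r_pos i
    refine ⟨H.D_offDiag p s hs.symm, fun q hq => ?_⟩
    rcases H.transfer_eq_zero_or_pos hreg hfix hp hconn hs0 with h | h
    · have h0 : H.transfer i (Pi.single s 1) = 0 := by
        funext t
        by_cases ht : t = p
        · rw [ht, hAp]; rfl
        · exact h t ht
      rw [h0, Matrix.mulVec_zero, Pi.zero_apply] at hℓ
      refine ⟨fun hpos => ?_, fun _ => h q hq⟩
      exact absurd hℓ (mul_pos hr hpos).ne
    · refine ⟨fun _ => h q hq, fun h0 => ?_⟩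
      rw [h0, mul_zero, H.mulVec_eq_sum_erase hAp, Finset.sum_eq_zero_iff_of_nonneg
        fun t ht => mul_nonneg (H.D_offDiag p t (Finset.ne_of_mem_erase ht).symm)
          (h t (Finset.ne_of_mem_erase ht)).le] at hℓ
      have h1 := hℓ q₁ (Finset.mem_erase.2 ⟨hq₁, Finset.mem_univ _⟩)
      exact absurd h1 (mul_pos hDq₁ (h q₁ hq₁)).ne'
  let ratio : L.V0 × L.V0 → ℝ := fun x =>
    if x.1 ≠ p ∧ x.2 ≠ p ∧ 0 < H.D p x.1 then H.transfer i (Pi.single x.1 1) x.2 / H.D p x.1 else 1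
  have hratio_pos : ∀ x, 0 < ratio x := fun x => by
    simp only [ratio]
    split_ifs with h
    · exact div_pos (((hcol x.1 h.1).2 x.2 h.2.1).1 h.2.2) h.2.2
    · exact one_pos
  have : Nonempty (L.V0 × L.V0) := ⟨(p, p)⟩
  obtain ⟨xm, hxm⟩ := Finite.exists_min ratio
  obtain ⟨xM, hxM⟩ := Finite.exists_max ratio
  have hbound : ∀ s q, s ≠ p → q ≠ p → ratio xm * H.D p s ≤ H.transfer i (Pi.single s 1) q ∧
      H.transfer i (Pi.single s 1) q ≤ ratio xM * H.D p s := by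
    intro s q hs hq
    rcases (hcol s hs).1.eq_or_lt with h0 | hpos
    · rw [((hcol s hs).2 q hq).2 h0.symm, ← h0]
      simp
    · have h1 : ratio (s, q) = H.transfer i (Pi.single s 1) q / H.D p s := by
        simp [ratio, hs, hq, hpos]
      rw [← le_div_iff₀ hpos, ← div_le_iff₀ hpos, ← h1]
      exact ⟨hxm _, hxM _⟩
  refine ⟨ratio xm, ratio xM, hratio_pos _, (hratio_pos _).le, fun u hu0 hu q hq => ?_⟩
  have hsum : H.transfer i u q =
      ∑ s ∈ Finset.univ.erase p, u s * H.transfer i (Pi.single s 1) q := by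
    rw [transfer_eq_sum, ← Finset.add_sum_erase _ _ (Finset.mem_univ p), hu, zero_mul, zero_add]
  rw [H.mulVec_eq_sum_erase hu, hsum, Finset.mul_sum, Finset.mul_sum]
  constructor <;>
  · refine Finset.sum_le_sum fun s hs => ?_
    have h := hbound s q (Finset.ne_of_mem_erase hs) hq
    nlinarith [hu0 s, mul_le_mul_of_nonneg_left h.1 (hu0 s), mul_le_mul_of_nonneg_left h.2 (hu0 s)]

/-- Functions vanishing at `p` with zero normal derivative there are contracted, in the norm
`ℓ(|u|) = ∑_{q ≠ p} D_{pq} |u(q)|`, by a factor smaller than the eigenvalue `r_i` (Doeblin's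
argument for positive matrices). -/
lemma exists_contraction (hreg : H.IsRegular) (hfix : ∀ p ∈ L.V0, ∃ i, L.ψ i p = p)
    {i : Fin N} {p : L.V0} (hp : L.ψ i p = p) (hconn : IsPreconnected ({(p : K)}ᶜ : Set K))
    (hD : ∃ u, (H.D *ᵥ u) p ≠ 0) :
    ∃ κ M : ℝ, 0 ≤ κ ∧ κ < H.r i ∧ 0 ≤ M ∧ ∀ u : L.V0 → ℝ, u p = 0 → (H.D *ᵥ u) p = 0 →
      (H.D *ᵥ fun q => |H.transfer i u q|) p ≤ κ * (H.D *ᵥ fun q => |u q|) p ∧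
      ∀ q, |H.transfer i u q| ≤ M * (H.D *ᵥ fun q => |u q|) p := by
  classical
  obtain ⟨ε, M, hε, hM, hb⟩ := H.exists_column_bounds hreg hfix hp hconn hD
  obtain ⟨q₁, hq₁, hDq₁⟩ := H.exists_D_pos hD
  set η := ∑ q ∈ Finset.univ.erase p, H.D p q
  have hη : 0 < η := Finset.sum_pos' (fun q hq => H.D_offDiag p q (Finset.ne_of_mem_erase hq).symm)
    ⟨q₁, Finset.mem_erase.2 ⟨hq₁, Finset.mem_univ _⟩, hDq₁⟩
  refine ⟨max 0 (H.r i - ε * η), M, le_max_left _ _,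
    max_lt (H.r_pos i) (by nlinarith), hM, fun u hu hℓ => ?_⟩
  set v : L.V0 → ℝ := fun q => |u q|
  have hv0 : ∀ q, 0 ≤ v q := fun q => abs_nonneg _
  have hvp : v p = 0 := by simp [v, hu]
  have hℓv := H.mulVec_nonneg hv0 hvp
  have hAp : H.transfer i u p = 0 := by rw [H.transfer_of_ψ_eq _ hp, hu]
  -- `v ± u` are nonnegative and have the normal derivative of `v`
  have hadd : ∀ q, q ≠ p → |H.transfer i u q| ≤ H.transfer i v q - ε * (H.D *ᵥ v) p := by
    intro q hq
    have h1 := (hb (v + u) (fun q => by have := neg_abs_le (u q); simp [v]; linarith)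
      (by simp [hvp, hu]) q hq).1
    have h2 := (hb (v - u) (fun q => by have := le_abs_self (u q); simp [v]; linarith)
      (by simp [hvp, hu]) q hq).1
    rw [Matrix.mulVec_add, map_add, Pi.add_apply, Pi.add_apply, hℓ] at h1
    rw [Matrix.mulVec_sub, map_sub, Pi.sub_apply, Pi.sub_apply, hℓ] at h2
    exact abs_le.2 ⟨by linarith, by linarith⟩
  constructor
  · have h1 : (H.D *ᵥ fun q => |H.transfer i u q|) p ≤
        ∑ q ∈ Finset.univ.erase p, H.D p q * (H.transfer i v q - ε * (H.D *ᵥ v) p) := by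
      rw [H.mulVec_eq_sum_erase (by simp [hAp])]
      exact Finset.sum_le_sum fun q hq => mul_le_mul_of_nonneg_left
        (hadd q (Finset.ne_of_mem_erase hq)) (H.D_offDiag p q (Finset.ne_of_mem_erase hq).symm)
    have h2 : ∑ q ∈ Finset.univ.erase p, H.D p q * (H.transfer i v q - ε * (H.D *ᵥ v) p) =
        (H.r i - ε * η) * (H.D *ᵥ v) p := by
      simp only [mul_sub, Finset.sum_sub_distrib]
      rw [← H.mulVec_eq_sum_erase (by rw [H.transfer_of_ψ_eq _ hp, hvp]), H.mulVec_transfer hp,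
        ← Finset.sum_mul]
      ring
    rw [h2] at h1
    exact h1.trans (mul_le_mul_of_nonneg_right (le_max_right _ _) hℓv)
  · intro q
    by_cases hq : q = p
    · rw [hq, hAp, abs_zero]
      positivity
    · have h1 := hadd q hq
      have h2 := (hb v hv0 hvp q hq).2
      nlinarith

/-- A function with zero normal derivative at `p` decays under `A_i` faster than `r_i^k`. -/
lemma tendsto_E0_iterate (hreg : H.IsRegular) (hfix : ∀ p ∈ L.V0, ∃ i, L.ψ i p = p)
    {i : Fin N} {p : L.V0} (hp : L.ψ i p = p) (hconn : IsPreconnected ({(p : K)}ᶜ : Set K))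
    (hD : ∃ u, (H.D *ᵥ u) p ≠ 0) (u : L.V0 → ℝ) (hℓ : (H.D *ᵥ u) p = 0) :
    Tendsto (fun k => ((H.r i ^ k)⁻¹) ^ 2 * H.E0 ((H.transfer i)^[k] u) ((H.transfer i)^[k] u))
      atTop (𝓝 0) := by
  obtain ⟨κ, M, hκ0, hκ, hM, hc⟩ := H.exists_contraction hreg hfix hp hconn hD
  have hr := H.r_pos i
  set v : L.V0 → ℝ := fun q => u q - u p
  have hvu : v = u + fun _ => -u p := by funext q; simp [v, sub_eq_add_neg]
  have hv : ∀ k, (H.transfer i)^[k] v = fun q => (H.transfer i)^[k] u q - u p := by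
    intro k
    induction k with
    | zero => rfl
    | succ k ih =>
      rw [Function.iterate_succ_apply', Function.iterate_succ_apply', ih]
      have : (fun q => (H.transfer i)^[k] u q - u p) =
        (H.transfer i)^[k] u + fun _ => -u p := by funext q; simp [sub_eq_add_neg]
      rw [this, map_add, H.transfer_const]
      funext q; simp [sub_eq_add_neg]
  have hvk : ∀ k, (H.transfer i)^[k] v p = 0 ∧ (H.D *ᵥ (H.transfer i)^[k] v) p = 0 := by
    intro k
    induction k with
    | zero =>
      refine ⟨by simp [v], ?_⟩
      rw [Function.iterate_zero, id, hvu, Matrix.mulVec_add, H.mulVec_const, Pi.add_apply, hℓ]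
      simp
    | succ k ih =>
      rw [Function.iterate_succ_apply', H.transfer_of_ψ_eq _ hp, H.mulVec_transfer hp, ih.1, ih.2]
      simp
  set c := (H.D *ᵥ fun q => |v q|) p
  have hgeo : ∀ k, (H.D *ᵥ fun q => |(H.transfer i)^[k] v q|) p ≤ κ ^ k * c := by
    intro k
    induction k with
    | zero => simp [c]
    | succ k ih =>
      rw [Function.iterate_succ_apply', pow_succ', mul_assoc]
      exact (hc _ (hvk k).1 (hvk k).2).1.trans (mul_le_mul_of_nonneg_left ih hκ0)
  have hpt : Tendsto (fun k => (H.r i ^ k)⁻¹ • (H.transfer i)^[k] v) atTop (𝓝 0) := by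
    rw [← tendsto_add_atTop_iff_nat 1, tendsto_pi_nhds]
    intro q
    refine squeeze_zero_norm (a := fun k => (κ / H.r i) ^ k * ((H.r i)⁻¹ * M * c)) (fun k => ?_) ?_
    · have h1 : |(H.transfer i)^[k + 1] v q| ≤ M * (κ ^ k * c) := by
        rw [Function.iterate_succ_apply']
        exact ((hc _ (hvk k).1 (hvk k).2).2 q).trans (mul_le_mul_of_nonneg_left (hgeo k) hM)
      rw [Pi.smul_apply, smul_eq_mul, norm_mul, Real.norm_eq_abs, Real.norm_eq_abs,
        abs_of_nonneg (by positivity)]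
      refine (mul_le_mul_of_nonneg_left h1 (by positivity)).trans (le_of_eq ?_)
      rw [div_pow, pow_succ]
      field_simp
    · have := tendsto_pow_atTop_nhds_zero_of_lt_one (div_nonneg hκ0 hr.le)
        ((div_lt_one hr).2 hκ)
      simpa using this.mul_const ((H.r i)⁻¹ * M * c)
  have hE := (H.continuous_E0.tendsto (0, 0)).comp (hpt.prodMk_nhds hpt)
  have h0 : H.E0 (0 : L.V0 → ℝ) 0 = 0 := H.E0_const_left 0 _
  simp only [h0] at hE
  refine hE.congr fun k => ?_
  simp only [Function.comp, E0_smul_left, E0_smul_right]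
  rw [hv, E0_sub_const]
  ring

end HarmonicStructure

namespace HarmonicStructure

open SelfSimilarStructure

variable {K : Type*} [TopologicalSpace K] {N : ℕ} {L : PCFStructure K N} (H : HarmonicStructure L)

/-! ### Areas of pairs of functions -/

/-- The `ℰ⁽⁰⁾`-area of the parallelogram spanned by `u` and `v`: the square root of the Gram
determinant. -/
def area (u v : L.V0 → ℝ) : ℝ := √(H.E0 u u * H.E0 v v - H.E0 u v ^ 2)

/-- Half the trace of the `ℰ⁽⁰⁾`-Gram matrix of `u` and `v`. -/
def halfTrace (u v : L.V0 → ℝ) : ℝ := (H.E0 u u + H.E0 v v) / 2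

lemma area_nonneg (u v : L.V0 → ℝ) : 0 ≤ H.area u v := Real.sqrt_nonneg _

lemma area_le_halfTrace (u v : L.V0 → ℝ) : H.area u v ≤ H.halfTrace u v := by
  have hu := H.E0_nonneg u
  have hv := H.E0_nonneg v
  refine Real.sqrt_le_iff.2 ⟨by unfold halfTrace; positivity, ?_⟩
  unfold halfTrace
  nlinarith [sq_nonneg (H.E0 u u - H.E0 v v), sq_nonneg (H.E0 u v)]

/-- Equality of the geometric and the arithmetic mean of the eigenvalues of the Gram matrix forces
it to be scalar. -/
lemma eq_of_area_eq_halfTrace {u v : L.V0 → ℝ} (h : H.halfTrace u v ≤ H.area u v) :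
    H.E0 u u = H.E0 v v ∧ H.E0 u v = 0 := by
  have hdet : 0 ≤ H.E0 u u * H.E0 v v - H.E0 u v ^ 2 := sub_nonneg.2 (H.E0_sq_le u v)
  have hu := H.E0_nonneg u
  have hv := H.E0_nonneg v
  have h1 : H.halfTrace u v ^ 2 ≤ H.E0 u u * H.E0 v v - H.E0 u v ^ 2 := by
    rw [← Real.sq_sqrt hdet]
    exact pow_le_pow_left₀ (by unfold halfTrace; positivity) h 2
  unfold halfTrace at h1
  have h2 : (H.E0 u u - H.E0 v v) ^ 2 + 4 * H.E0 u v ^ 2 ≤ 0 := by nlinarith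
  constructor
  · nlinarith [sq_nonneg (H.E0 u u - H.E0 v v), sq_nonneg (H.E0 u v)]
  · nlinarith [sq_nonneg (H.E0 u u - H.E0 v v), sq_nonneg (H.E0 u v)]

/-- The invariance properties shared by the area and by its sums over cells. -/
structure IsAreaLike (G : (L.V0 → ℝ) → (L.V0 → ℝ) → ℝ) : Prop where
  add_smul_right : ∀ u v (c : ℝ), G u (v + c • u) = G u v
  smul_smul : ∀ u v (s t : ℝ), G (s • u) (t • v) = |s * t| * G u v
  add_const : ∀ u v (c d : ℝ), G (u + fun _ => c) (v + fun _ => d) = G u v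

lemma isAreaLike_area : IsAreaLike H.area where
  add_smul_right u v c := by
    simp only [area, E0_add_left, E0_add_right, E0_smul_left, E0_smul_right, H.E0_comm v u]
    congr 1; ring
  smul_smul u v s t := by
    simp only [area, E0_smul_left, E0_smul_right]
    rw [← Real.sqrt_sq_eq_abs, ← Real.sqrt_mul (sq_nonneg _)]
    congr 1; ring
  add_const u v c d := by
    simp only [area, E0_add_left, E0_add_right, E0_const_left, E0_const_right, add_zero]

variable {H}

lemma IsAreaLike.const_left {G : (L.V0 → ℝ) → (L.V0 → ℝ) → ℝ} (hG : IsAreaLike G) (c : ℝ)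
    (v : L.V0 → ℝ) : G (fun _ => c) v = 0 := by
  have h1 := hG.add_const 0 v c 0
  have h2 := hG.smul_smul 0 v 0 1
  simp only [smul_zero, one_smul, zero_mul, abs_zero] at h2
  rw [h2] at h1
  convert h1 using 2
  · funext q; simp
  · funext q; simp

lemma IsAreaLike.const_right {G : (L.V0 → ℝ) → (L.V0 → ℝ) → ℝ} (hG : IsAreaLike G) (c : ℝ)
    (u : L.V0 → ℝ) : G u (fun _ => c) = 0 := by
  have h1 := hG.add_const u 0 0 c
  have h2 := hG.smul_smul u 0 1 0
  simp only [smul_zero, one_smul, mul_zero, abs_zero, zero_mul] at h2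
  rw [h2] at h1
  convert h1 using 2
  · funext q; simp
  · funext q; simp

variable (H)

/-- The `ℰ⁽⁰⁾`-orthonormal pairs of functions vanishing at `p₀`. -/
def orthoPairs (p₀ : L.V0) : Set ((L.V0 → ℝ) × (L.V0 → ℝ)) :=
  {x | H.E0 x.1 x.1 = 1 ∧ H.E0 x.2 x.2 = 1 ∧ H.E0 x.1 x.2 = 0 ∧ x.1 p₀ = 0 ∧ x.2 p₀ = 0}

/-- By Gram–Schmidt, area-like functionals may be compared on orthonormal pairs. -/
lemma IsAreaLike.le_mul_area {G : (L.V0 → ℝ) → (L.V0 → ℝ) → ℝ} (hG : IsAreaLike G) (p₀ : L.V0)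
    {θ : ℝ} (hθ : 0 ≤ θ) (h : ∀ x ∈ H.orthoPairs p₀, G x.1 x.2 ≤ θ) (u v : L.V0 → ℝ) :
    G u v ≤ θ * H.area u v := by
  have hA := H.isAreaLike_area
  have hnn := mul_nonneg hθ (H.area_nonneg u v)
  rcases (H.E0_nonneg u).eq_or_lt with hu | hu
  · obtain ⟨c, rfl⟩ := H.exists_const_of_E0 hu.symm
    rwa [hG.const_left]
  set w := v + (-(H.E0 u v / H.E0 u u)) • u with hw
  rw [← hG.add_smul_right u v (-(H.E0 u v / H.E0 u u)),
    ← hA.add_smul_right u v (-(H.E0 u v / H.E0 u u)), ← hw]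
  rw [← hA.add_smul_right u v (-(H.E0 u v / H.E0 u u)), ← hw] at hnn
  have horth : H.E0 u w = 0 := by
    rw [hw, E0_add_right, E0_smul_right]
    field_simp
    ring
  rcases (H.E0_nonneg w).eq_or_lt with hw0 | hw0
  · obtain ⟨c, hc⟩ := H.exists_const_of_E0 hw0.symm
    rw [hc] at hnn ⊢
    rwa [hG.const_right]
  have normalize : ∀ f : L.V0 → ℝ, 0 < H.E0 f f → ∃ (s c : ℝ) (g : L.V0 → ℝ), 0 < s ∧
      f = (s • g) + (fun _ => c) ∧ H.E0 g g = 1 ∧ g p₀ = 0 := by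
    intro f hf
    have hs := Real.sqrt_pos.2 hf
    refine ⟨√(H.E0 f f), f p₀, (√(H.E0 f f))⁻¹ • fun q => f q - f p₀, hs, ?_, ?_, ?_⟩
    · funext q
      simp [hs.ne']
    · rw [E0_smul_left, E0_smul_right, E0_sub_const]
      nth_rewrite 3 [← Real.mul_self_sqrt hf.le]
      field_simp
    · simp
  obtain ⟨s, c, g, hs, rfl, hg1, hg0⟩ := normalize u hu
  obtain ⟨t, d, k, ht, hk, hk1, hk0⟩ := normalize w hw0
  rw [hk] at horth ⊢
  have hgk : H.E0 g k = 0 := by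
    simp only [E0_add_left, E0_add_right, E0_smul_left, E0_smul_right, E0_const_left,
      E0_const_right, add_zero] at horth
    have := (mul_eq_zero.1 horth).resolve_left ht.ne'
    exact (mul_eq_zero.1 this).resolve_left hs.ne'
  rw [hG.add_const, hA.add_const, hG.smul_smul, hA.smul_smul]
  have harea : H.area g k = 1 := by simp [area, hg1, hk1, hgk]
  rw [harea, mul_one, mul_comm θ]
  exact mul_le_mul_of_nonneg_left (h (g, k) ⟨hg1, hk1, hgk, hg0, hk0⟩) (abs_nonneg _)

lemma isCompact_orthoPairs (p₀ : L.V0) : IsCompact (H.orthoPairs p₀) := by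
  obtain ⟨C, hC, hosc⟩ := H.exists_osc_bound
  refine Metric.isCompact_of_isClosed_isBounded ?_ ?_
  · have h : ∀ f g : (L.V0 → ℝ) × (L.V0 → ℝ) → (L.V0 → ℝ), Continuous f → Continuous g →
        Continuous fun x => H.E0 (f x) (g x) := fun f g hf hg =>
      H.continuous_E0.comp (hf.prodMk hg)
    refine IsClosed.inter (isClosed_eq (h _ _ continuous_fst continuous_fst) continuous_const) ?_
    refine IsClosed.inter (isClosed_eq (h _ _ continuous_snd continuous_snd) continuous_const) ?_
    refine IsClosed.inter (isClosed_eq (h _ _ continuous_fst continuous_snd) continuous_const) ?_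
    exact IsClosed.inter (isClosed_eq (by fun_prop) continuous_const)
      (isClosed_eq (by fun_prop) continuous_const)
  · refine Metric.isBounded_closedBall (x := 0) (r := √C) |>.subset ?_
    rintro ⟨u, v⟩ ⟨hu, hv, -, hu0, hv0⟩
    rw [mem_closedBall_zero_iff, norm_prod_le_iff, pi_norm_le_iff_of_nonneg (Real.sqrt_nonneg _),
      pi_norm_le_iff_of_nonneg (Real.sqrt_nonneg _)]
    constructor
    · intro q
      refine Real.abs_le_sqrt ?_
      have := hosc u q p₀
      simp only at hu hu0
      rwa [hu, hu0, sub_zero, mul_one] at this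
    · intro q
      refine Real.abs_le_sqrt ?_
      have := hosc v q p₀
      simp only at hv hv0
      rwa [hv, hv0, sub_zero, mul_one] at this

lemma continuous_area : Continuous fun x : (L.V0 → ℝ) × (L.V0 → ℝ) => H.area x.1 x.2 := by
  have h1 : Continuous fun x : (L.V0 → ℝ) × (L.V0 → ℝ) => H.E0 x.1 x.1 :=
    H.continuous_E0.comp (continuous_fst.prodMk continuous_fst)
  have h2 : Continuous fun x : (L.V0 → ℝ) × (L.V0 → ℝ) => H.E0 x.2 x.2 :=
    H.continuous_E0.comp (continuous_snd.prodMk continuous_snd)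
  exact ((h1.mul h2).sub (H.continuous_E0.pow 2)).sqrt

variable [CompactSpace K] [T2Space K] [ConnectedSpace K]

/-- The sum over the cells of level one of a functional of pairs of boundary values, with the
weights `r_i⁻¹`. -/
def cellSum (G : (L.V0 → ℝ) → (L.V0 → ℝ) → ℝ) (u v : L.V0 → ℝ) : ℝ :=
  ∑ i, (H.r i)⁻¹ * G (H.transfer i u) (H.transfer i v)

lemma cellSum_mono {G G' : (L.V0 → ℝ) → (L.V0 → ℝ) → ℝ} (h : ∀ u v, G u v ≤ G' u v)
    (u v : L.V0 → ℝ) : H.cellSum G u v ≤ H.cellSum G' u v :=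
  Finset.sum_le_sum fun i _ => mul_le_mul_of_nonneg_left (h _ _) (inv_nonneg.2 (H.r_pos i).le)

lemma cellSum_iterate_mono {G G' : (L.V0 → ℝ) → (L.V0 → ℝ) → ℝ} (h : ∀ u v, G u v ≤ G' u v)
    (k : ℕ) (u v : L.V0 → ℝ) : (H.cellSum)^[k] G u v ≤ (H.cellSum)^[k] G' u v := by
  induction k generalizing u v with
  | zero => exact h u v
  | succ k ih =>
    rw [Function.iterate_succ_apply', Function.iterate_succ_apply']
    exact H.cellSum_mono ih u v

lemma cellSum_iterate_const_mul (c : ℝ) (G : (L.V0 → ℝ) → (L.V0 → ℝ) → ℝ) (k : ℕ)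
    (u v : L.V0 → ℝ) :
    (H.cellSum)^[k] (fun u v => c * G u v) u v = c * (H.cellSum)^[k] G u v := by
  induction k generalizing u v with
  | zero => rfl
  | succ k ih =>
    rw [Function.iterate_succ_apply', Function.iterate_succ_apply']
    simp only [cellSum, ih, Finset.mul_sum]
    exact Finset.sum_congr rfl fun i _ => by ring

lemma cellSum_iterate_halfTrace (k : ℕ) : (H.cellSum)^[k] H.halfTrace = H.halfTrace := by
  refine Function.iterate_fixed ?_ k
  funext u v
  simp only [cellSum, halfTrace]
  rw [← H.sum_E0_transfer_transfer u u, ← H.sum_E0_transfer_transfer v v,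
    ← Finset.sum_add_distrib, Finset.sum_div]
  exact Finset.sum_congr rfl fun i _ => by ring

variable {H}

lemma IsAreaLike.cellSum_iterate {G : (L.V0 → ℝ) → (L.V0 → ℝ) → ℝ} (hG : IsAreaLike G) (k : ℕ) :
    IsAreaLike ((H.cellSum)^[k] G) := by
  induction k with
  | zero => exact hG
  | succ k ih =>
    rw [Function.iterate_succ_apply']
    refine ⟨fun u v c => ?_, fun u v s t => ?_, fun u v c d => ?_⟩
    · simp only [cellSum, map_add, map_smul, ih.add_smul_right]
    · simp only [cellSum, map_smul, ih.smul_smul, Finset.mul_sum]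
      exact Finset.sum_congr rfl fun i _ => by ring
    · simp only [cellSum, map_add, transfer_const, ih.add_const]

variable (H)

lemma continuous_cellSum_iterate {G : (L.V0 → ℝ) → (L.V0 → ℝ) → ℝ}
    (hG : Continuous fun x : (L.V0 → ℝ) × (L.V0 → ℝ) => G x.1 x.2) (k : ℕ) :
    Continuous fun x : (L.V0 → ℝ) × (L.V0 → ℝ) => (H.cellSum)^[k] G x.1 x.2 := by
  induction k with
  | zero => exact hG
  | succ k ih =>
    rw [Function.iterate_succ_apply']
    refine continuous_finsetSum _ fun i _ => continuous_const.mul ?_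
    have hA : Continuous (H.transfer i) := LinearMap.continuous_of_finiteDimensional _
    exact ih.comp ((hA.comp continuous_fst).prodMk (hA.comp continuous_snd))

/-- Areas are superadditive over cells. -/
lemma cellSum_area_le (u v : L.V0 → ℝ) : H.cellSum H.area u v ≤ H.area u v := by
  obtain ⟨p₀⟩ := L.nonempty_V0
  have h := (H.isAreaLike_area.cellSum_iterate (H := H) 1).le_mul_area H p₀ zero_le_one
    (fun x hx => ?_) u v
  · rwa [one_mul] at h
  · refine (H.cellSum_iterate_mono H.area_le_halfTrace 1 _ _).trans ?_
    rw [cellSum_iterate_halfTrace, halfTrace, hx.1, hx.2.1]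
    norm_num

lemma cellSum_iterate_area_antitone (u v : L.V0 → ℝ) :
    Antitone fun k => (H.cellSum)^[k] H.area u v := by
  refine antitone_nat_of_succ_le fun k => ?_
  rw [Function.iterate_succ_apply]
  exact H.cellSum_iterate_mono H.cellSum_area_le k u v

/-- The loss of area along the single cell `i ⋯ i` bounds the total loss from below. -/
lemma halfTrace_sub_area_iterate_le (i : Fin N) (k : ℕ) (u v : L.V0 → ℝ) :
    (H.r i ^ k)⁻¹ * (H.halfTrace ((H.transfer i)^[k] u) ((H.transfer i)^[k] v) -
        H.area ((H.transfer i)^[k] u) ((H.transfer i)^[k] v)) ≤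
      H.halfTrace u v - (H.cellSum)^[k] H.area u v := by
  induction k generalizing u v with
  | zero => simp
  | succ k ih =>
    have hnn : ∀ u v, 0 ≤ H.halfTrace u v - (H.cellSum)^[k] H.area u v := fun u v => by
      have := H.cellSum_iterate_mono H.area_le_halfTrace k u v
      rw [cellSum_iterate_halfTrace] at this
      linarith
    have hsum : H.halfTrace u v - (H.cellSum)^[k + 1] H.area u v =
        ∑ j, (H.r j)⁻¹ * (H.halfTrace (H.transfer j u) (H.transfer j v) -
          (H.cellSum)^[k] H.area (H.transfer j u) (H.transfer j v)) := by
      have h1 : H.halfTrace u v = H.cellSum H.halfTrace u v :=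
        (congrFun (congrFun (H.cellSum_iterate_halfTrace 1) u) v).symm
      rw [Function.iterate_succ_apply', h1]
      simp only [cellSum, mul_sub, Finset.sum_sub_distrib]
    rw [hsum, Function.iterate_succ_apply, Function.iterate_succ_apply, pow_succ', mul_inv,
      mul_assoc]
    refine (mul_le_mul_of_nonneg_left (ih _ _) (inv_nonneg.2 (H.r_pos i).le)).trans ?_
    exact Finset.single_le_sum (f := fun j => (H.r j)⁻¹ * (H.halfTrace (H.transfer j u)
      (H.transfer j v) - (H.cellSum)^[k] H.area (H.transfer j u) (H.transfer j v)))
      (fun j _ => mul_nonneg (inv_nonneg.2 (H.r_pos j).le) (hnn _ _)) (Finset.mem_univ i)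

lemma mulVec_iterate_transfer {i : Fin N} {p : L.V0} (hp : L.ψ i p = p) (k : ℕ) (u : L.V0 → ℝ) :
    (H.D *ᵥ (H.transfer i)^[k] u) p = H.r i ^ k * (H.D *ᵥ u) p := by
  induction k with
  | zero => simp
  | succ k ih => rw [Function.iterate_succ_apply', H.mulVec_transfer hp, ih, pow_succ', mul_assoc]

lemma iterate_transfer_combination (i : Fin N) (k : ℕ) (a b : ℝ) (u v : L.V0 → ℝ) :
    (H.transfer i)^[k] (a • u + b • v) =
      a • (H.transfer i)^[k] u + b • (H.transfer i)^[k] v := by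
  induction k with
  | zero => rfl
  | succ k ih => simp only [Function.iterate_succ_apply', ih, map_add, map_smul]

/-- Some area of an orthonormal pair is lost at a finite level. Otherwise the Gram matrices on all
cells are scalar; but in the cells `i ⋯ i` shrinking to a boundary point `p`, the combination of `u`
and `v` with zero normal derivative at `p` decays strictly faster than `u`. -/
lemma exists_cellSum_iterate_lt_one (hreg : H.IsRegular)
    (hstar : ∀ p ∈ L.V0, (∃ i, L.ψ i p = p) ∧ IsConnected ({p}ᶜ : Set K)) {p₀ : L.V0}
    {x : (L.V0 → ℝ) × (L.V0 → ℝ)} (hx : x ∈ H.orthoPairs p₀) :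
    ∃ k, (H.cellSum)^[k] H.area x.1 x.2 < 1 := by
  classical
  obtain ⟨u, v⟩ := x
  obtain ⟨hu, hv, -, -, -⟩ := hx
  simp only at hu hv ⊢
  by_contra! hge
  have hscalar : ∀ i k, H.E0 ((H.transfer i)^[k] u) ((H.transfer i)^[k] u) =
      H.E0 ((H.transfer i)^[k] v) ((H.transfer i)^[k] v) ∧
      H.E0 ((H.transfer i)^[k] u) ((H.transfer i)^[k] v) = 0 := by
    intro i k
    apply H.eq_of_area_eq_halfTrace
    have h1 := H.halfTrace_sub_area_iterate_le i k u v
    have h2 : H.halfTrace u v = 1 := by rw [halfTrace, hu, hv]; norm_num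
    rw [h2] at h1
    have h3 := h1.trans (sub_nonpos.2 (hge k))
    have h4 := inv_pos.2 (pow_pos (H.r_pos i) k)
    by_contra! hlt
    exact absurd h3 (not_le.2 (mul_pos h4 (sub_pos.2 hlt)))
  obtain ⟨p, hp⟩ : ∃ p, (H.D *ᵥ u) p ≠ 0 := by
    by_contra! h
    rw [E0_eq_sum] at hu
    simp [h] at hu
  obtain ⟨⟨i, hi⟩, hconn⟩ := hstar p p.2
  set a := (H.D *ᵥ u) p
  set b := (H.D *ᵥ v) p
  have hz : (H.D *ᵥ (a • v + (-b) • u)) p = 0 := by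
    simp only [Matrix.mulVec_add, Matrix.mulVec_smul, Pi.add_apply, Pi.smul_apply, smul_eq_mul]
    ring
  have hlim := H.tendsto_E0_iterate hreg (fun q hq => (hstar q hq).1) hi hconn.isPreconnected
    ⟨u, hp⟩ _ hz
  have hlow : ∀ k, (a ^ 2 + b ^ 2) * a ^ 2 ≤
      ((H.r i ^ k)⁻¹) ^ 2 * H.E0 ((H.transfer i)^[k] (a • v + (-b) • u))
        ((H.transfer i)^[k] (a • v + (-b) • u)) * H.E0 (Pi.single p 1) (Pi.single p 1) := by
    intro k
    have hr := pow_pos (H.r_pos i) k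
    have h1 := H.E0_sq_le ((H.transfer i)^[k] u) (Pi.single p 1)
    rw [E0_single, H.mulVec_iterate_transfer hi] at h1
    obtain ⟨h2, h3⟩ := hscalar i k
    have h4 : H.E0 ((H.transfer i)^[k] (a • v + (-b) • u))
        ((H.transfer i)^[k] (a • v + (-b) • u)) =
        (a ^ 2 + b ^ 2) * H.E0 ((H.transfer i)^[k] u) ((H.transfer i)^[k] u) := by
      rw [iterate_transfer_combination]
      simp only [E0_add_left, E0_add_right, E0_smul_left, E0_smul_right,
        H.E0_comm ((H.transfer i)^[k] v) ((H.transfer i)^[k] u), h3, ← h2]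
      ring
    rw [h4]
    have h5 : a ^ 2 = ((H.r i ^ k)⁻¹) ^ 2 * (-(H.r i ^ k * a)) ^ 2 := by
      field_simp
    calc (a ^ 2 + b ^ 2) * a ^ 2
        = (a ^ 2 + b ^ 2) * (((H.r i ^ k)⁻¹) ^ 2 * (-(H.r i ^ k * a)) ^ 2) := by rw [← h5]
      _ ≤ (a ^ 2 + b ^ 2) * (((H.r i ^ k)⁻¹) ^ 2 *
          (H.E0 ((H.transfer i)^[k] u) ((H.transfer i)^[k] u) *
            H.E0 (Pi.single p 1) (Pi.single p 1))) := by gcongr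
      _ = _ := by ring
  have hle := ge_of_tendsto' (hlim.mul_const (H.E0 (Pi.single p 1) (Pi.single p 1))) hlow
  rw [zero_mul] at hle
  have ha : 0 < a ^ 2 := by positivity
  nlinarith [sq_nonneg b]

/-- Areas are contracted uniformly at some fixed level, by compactness of the set of orthonormal
pairs. -/
lemma exists_uniform_area_contraction (hreg : H.IsRegular)
    (hstar : ∀ p ∈ L.V0, (∃ i, L.ψ i p = p) ∧ IsConnected ({p}ᶜ : Set K)) :
    ∃ (k : ℕ) (θ : ℝ), 0 ≤ θ ∧ θ < 1 ∧
      ∀ u v, (H.cellSum)^[k] H.area u v ≤ θ * H.area u v := by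
  obtain ⟨p₀⟩ := L.nonempty_V0
  have hcont := H.continuous_cellSum_iterate H.continuous_area
  obtain ⟨k, hk⟩ := (H.isCompact_orthoPairs p₀).elim_directed_cover
    (fun k => {x | (H.cellSum)^[k] H.area x.1 x.2 < 1})
    (fun k => isOpen_lt (hcont k) continuous_const)
    (fun x hx => Set.mem_iUnion.2 (H.exists_cellSum_iterate_lt_one hreg hstar hx))
    (Monotone.directed_le fun k l hkl x (hx : _ < _) =>
      (H.cellSum_iterate_area_antitone x.1 x.2 hkl).trans_lt hx)
  have hA := H.isAreaLike_area.cellSum_iterate (H := H) k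
  by_cases hne : (H.orthoPairs p₀).Nonempty
  · obtain ⟨x, hx, hmax⟩ := (H.isCompact_orthoPairs p₀).exists_isMaxOn hne (hcont k).continuousOn
    refine ⟨k, max 0 ((H.cellSum)^[k] H.area x.1 x.2), le_max_left _ _, max_lt one_pos (hk hx), ?_⟩
    exact hA.le_mul_area H p₀ (le_max_left _ _) fun y hy => (hmax hy).trans (le_max_right _ _)
  · exact ⟨k, 0, le_rfl, one_pos,
      hA.le_mul_area H p₀ le_rfl fun y hy => (hne ⟨y, hy⟩).elim⟩

lemma exists_cellSum_iterate_lt (hreg : H.IsRegular)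
    (hstar : ∀ p ∈ L.V0, (∃ i, L.ψ i p = p) ∧ IsConnected ({p}ᶜ : Set K)) (u v : L.V0 → ℝ)
    {ε : ℝ} (hε : 0 < ε) : ∃ n, (H.cellSum)^[n] H.area u v < ε := by
  obtain ⟨k, θ, hθ0, hθ1, hk⟩ := H.exists_uniform_area_contraction hreg hstar
  have hpow : ∀ j u v, (H.cellSum)^[k * j] H.area u v ≤ θ ^ j * H.area u v := by
    intro j
    induction j with
    | zero => intro u v; simp
    | succ j ih =>
      intro u v
      rw [Nat.mul_succ, Function.iterate_add_apply]
      refine (H.cellSum_iterate_mono hk _ u v).trans ?_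
      rw [cellSum_iterate_const_mul, pow_succ', mul_assoc]
      exact mul_le_mul_of_nonneg_left (ih u v) hθ0
  have hlim := (tendsto_pow_atTop_nhds_zero_of_lt_one hθ0 hθ1).mul_const (H.area u v)
  rw [zero_mul] at hlim
  obtain ⟨j, hj⟩ := (hlim.eventually (gt_mem_nhds hε)).exists
  exact ⟨k * j, (hpow j u v).trans_lt hj⟩

end HarmonicStructure

/-! ### An integral inequality for Gram determinants -/

/-- The mixed discriminant inequality for positive semidefinite `2 × 2` matrices. -/
lemma two_mul_sqrt_det_mul_sqrt_det_le {a b c A B C : ℝ} (ha : 0 ≤ a) (hb : 0 ≤ b)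
    (hc : c ^ 2 ≤ a * b) (hA : 0 ≤ A) (hB : 0 ≤ B) (hC : C ^ 2 ≤ A * B) :
    2 * √(A * B - C ^ 2) * √(a * b - c ^ 2) ≤ a * B + b * A - 2 * c * C := by
  set x := √(a * b - c ^ 2)
  set X := √(A * B - C ^ 2)
  have hx : x ^ 2 = a * b - c ^ 2 := Real.sq_sqrt (sub_nonneg.2 hc)
  have hX : X ^ 2 = A * B - C ^ 2 := Real.sq_sqrt (sub_nonneg.2 hC)
  have h1 : (2 * (c * C + X * x)) ^ 2 ≤ (a * B + b * A) ^ 2 := by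
    have h2 : a * b * (A * B) = (c ^ 2 + x ^ 2) * (C ^ 2 + X ^ 2) := by rw [hx, hX]; ring
    nlinarith [sq_nonneg (a * B - b * A), sq_nonneg (c * X - C * x)]
  have h3 := abs_le_of_sq_le_sq h1 (by positivity)
  linarith [le_abs_self (2 * (c * C + X * x))]

/-- The square root of the determinant of a positive semidefinite `2 × 2` matrix is concave, so its
integral is at most the square root of the determinant of the integrated matrix. -/
lemma integral_sqrt_det_le {Ω : Type*} [MeasurableSpace Ω] {μ : Measure Ω} {a b c : Ω → ℝ}
    (ha : Integrable a μ) (hb : Integrable b μ) (hc : Integrable c μ)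
    (ha0 : ∀ᵐ ω ∂μ, 0 ≤ a ω) (hb0 : ∀ᵐ ω ∂μ, 0 ≤ b ω) (hab : ∀ᵐ ω ∂μ, c ω ^ 2 ≤ a ω * b ω) :
    Integrable (fun ω => √(a ω * b ω - c ω ^ 2)) μ ∧
    ∫ ω, √(a ω * b ω - c ω ^ 2) ∂μ ≤ √((∫ ω, a ω ∂μ) * (∫ ω, b ω ∂μ) - (∫ ω, c ω ∂μ) ^ 2) := by
  have hint : Integrable (fun ω => √(a ω * b ω - c ω ^ 2)) μ := by
    refine (ha.add hb).mono' ?_ ?_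
    · exact Real.continuous_sqrt.comp_aestronglyMeasurable
        ((ha.1.mul hb.1).sub (hc.1.pow 2))
    · filter_upwards [ha0, hb0] with ω h1 h2
      rw [Real.norm_eq_abs, abs_of_nonneg (Real.sqrt_nonneg _), Pi.add_apply]
      refine Real.sqrt_le_iff.2 ⟨by positivity, ?_⟩
      nlinarith [sq_nonneg (c ω), mul_nonneg h1 h2, sq_nonneg (a ω), sq_nonneg (b ω)]
  refine ⟨hint, ?_⟩
  set A := ∫ ω, a ω ∂μ
  set B := ∫ ω, b ω ∂μ
  set C := ∫ ω, c ω ∂μ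
  have hA : 0 ≤ A := integral_nonneg_of_ae ha0
  have hB : 0 ≤ B := integral_nonneg_of_ae hb0
  -- the pointwise inequality against a fixed positive definite matrix, integrated
  have hmix : ∀ A' B' C' : ℝ, 0 ≤ A' → 0 ≤ B' → C' ^ 2 ≤ A' * B' →
      2 * √(A' * B' - C' ^ 2) * ∫ ω, √(a ω * b ω - c ω ^ 2) ∂μ ≤ A * B' + B * A' - 2 * C * C' := by
    intro A' B' C' hA' hB' hC'
    have i1 : Integrable (fun ω => a ω * B') μ := ha.mul_const _
    have i2 : Integrable (fun ω => b ω * A') μ := hb.mul_const _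
    have i3 : Integrable (fun ω => c ω * (2 * C')) μ := hc.mul_const _
    have i12 : Integrable (fun ω => a ω * B' + b ω * A') μ := i1.add i2
    have h1 : ∫ ω, 2 * √(A' * B' - C' ^ 2) * √(a ω * b ω - c ω ^ 2) ∂μ ≤
        ∫ ω, (a ω * B' + b ω * A' - c ω * (2 * C')) ∂μ := by
      refine integral_mono_ae (hint.const_mul _)
        (i12.sub i3) ?_
      filter_upwards [ha0, hb0, hab] with ω h1 h2 h3
      have := two_mul_sqrt_det_mul_sqrt_det_le h1 h2 h3 hA' hB' hC'
      linarith
    rw [integral_const_mul, integral_sub i12 i3, integral_add i1 i2, integral_mul_const,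
      integral_mul_const, integral_mul_const] at h1
    linarith
  have hCAB : C ^ 2 ≤ A * B := by
    have hq : ∀ t : ℝ, 0 ≤ B * (t * t) + 2 * C * t + A := fun t => by
      have := hmix (t ^ 2) 1 (-t) (sq_nonneg t) zero_le_one (by simp)
      simp at this
      nlinarith
    have := discrim_le_zero hq
    rw [discrim] at this
    nlinarith
  have hlim : Tendsto (fun ε : ℝ => √((A + ε) * (B + ε) - C ^ 2)) (𝓝[>] 0)
      (𝓝 √(A * B - C ^ 2)) := by
    have hcont : Continuous fun ε : ℝ => √((A + ε) * (B + ε) - C ^ 2) := by fun_prop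
    have := hcont.tendsto 0
    simp only [add_zero] at this
    exact this.mono_left nhdsWithin_le_nhds
  refine ge_of_tendsto hlim ?_
  filter_upwards [self_mem_nhdsWithin] with ε (hε : 0 < ε)
  have hdet : 0 < (A + ε) * (B + ε) - C ^ 2 := by
    nlinarith [mul_pos hε hε, mul_nonneg hA hε.le, mul_nonneg hB hε.le]
  have h1 := hmix (A + ε) (B + ε) C (by positivity) (by positivity) (by linarith)
  set s := √((A + ε) * (B + ε) - C ^ 2)
  have hs : 0 < s := Real.sqrt_pos.2 hdet
  have hs2 : s ^ 2 = (A + ε) * (B + ε) - C ^ 2 := Real.sq_sqrt hdet.le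
  have h2 : s * ∫ ω, √(a ω * b ω - c ω ^ 2) ∂μ ≤ s * s := by
    nlinarith [mul_pos hε hε, mul_nonneg hA hε.le, mul_nonneg hB hε.le]
  exact le_of_mul_le_mul_left h2 hs

/-! ### Cylinder sets -/

namespace ShiftSpace

open SelfSimilarStructure

variable {N : ℕ}

lemma mem_wordCylinder_iff (w : List (Fin N)) (ω : ℕ → Fin N) :
    ω ∈ wordCylinder w ↔ initWord ω w.length = w := by
  constructor
  · intro h
    conv_rhs => rw [← List.ofFn_get w]
    exact congrArg List.ofFn (funext fun k => h k)
  · intro h k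
    have h1 : w.get k = (initWord ω w.length).get ⟨k, by simp [length_initWord]⟩ := by
      simp only [List.get_eq_getElem]
      congr 1
      exact h.symm
    rw [h1]
    simp [initWord]

lemma wordCylinder_nil : wordCylinder ([] : List (Fin N)) = Set.univ := by
  ext ω
  simp [mem_wordCylinder_iff, initWord_zero]

lemma measurableSet_wordCylinder (w : List (Fin N)) : MeasurableSet (wordCylinder w) :=
  (dependsOnFirst_wordCylinder w).isOpen.measurableSet

lemma wordCylinder_eq_iUnion (w : List (Fin N)) :
    wordCylinder w = ⋃ i, wordCylinder (w ++ [i]) := by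
  ext ω
  simp only [Set.mem_iUnion, mem_wordCylinder_iff, List.length_append, List.length_singleton,
    initWord_succ']
  constructor
  · intro h
    exact ⟨ω w.length, by rw [h]⟩
  · rintro ⟨i, h⟩
    exact (List.append_inj' h rfl).1

lemma pairwise_disjoint_wordCylinder (w : List (Fin N)) :
    Pairwise (Function.onFun Disjoint fun i => wordCylinder (w ++ [i])) := by
  intro i j hij
  simp only [Function.onFun, Set.disjoint_left, mem_wordCylinder_iff, List.length_append,
    List.length_singleton]
  intro ω h1 h2
  have := List.append_inj' (h1.symm.trans h2) rfl
  exact hij (by simpa using this.2)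

lemma wordCylinder_subset_of_mem {w v : List (Fin N)} (hlen : w.length ≤ v.length)
    {ω : ℕ → Fin N} (hw : ω ∈ wordCylinder w) (hv : ω ∈ wordCylinder v) :
    wordCylinder v ⊆ wordCylinder w := by
  intro τ hτ
  refine dependsOnFirst_wordCylinder w ω τ (fun k hk => ?_) hw
  rw [hv ⟨k, hk.trans_le hlen⟩, hτ ⟨k, hk.trans_le hlen⟩]

lemma isPiSystem_wordCylinder : IsPiSystem (Set.range (wordCylinder (N := N))) := by
  rintro _ ⟨w, rfl⟩ _ ⟨v, rfl⟩ ⟨ω, hw, hv⟩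
  rcases le_total w.length v.length with h | h
  · exact ⟨v, (Set.inter_eq_right.2 (wordCylinder_subset_of_mem h hw hv)).symm⟩
  · exact ⟨w, (Set.inter_eq_left.2 (wordCylinder_subset_of_mem h hv hw)).symm⟩

lemma generateFrom_wordCylinder : (inferInstance : MeasurableSpace (ℕ → Fin N)) =
    MeasurableSpace.generateFrom (Set.range wordCylinder) := by
  refine le_antisymm (iSup_le fun k => ?_) (MeasurableSpace.generateFrom_le ?_)
  · rintro _ ⟨t, _, rfl⟩
    have h : (fun ω : ℕ → Fin N => ω k) ⁻¹' t =
        ⋃ w ∈ {w : List (Fin N) | ∃ ω : ℕ → Fin N, ω k ∈ t ∧ w = initWord ω (k + 1)},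
          wordCylinder w := by
      ext ω
      simp only [Set.mem_preimage, Set.mem_iUnion, Set.mem_ofPred_eq, exists_prop]
      constructor
      · intro hω
        refine ⟨_, ⟨ω, hω, rfl⟩, ?_⟩
        rw [mem_wordCylinder_iff, length_initWord]
      · rintro ⟨_, ⟨τ, hτ, rfl⟩, hω⟩
        rw [mem_wordCylinder_iff, length_initWord, initWord_succ', initWord_succ'] at hω
        have := (List.append_inj' hω rfl).2
        simp only [List.cons.injEq, and_true] at this
        rwa [this]
    rw [h]
    exact MeasurableSet.biUnion (Set.to_countable _) fun w _ =>
      MeasurableSpace.measurableSet_generateFrom ⟨w, rfl⟩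
  · rintro _ ⟨w, rfl⟩
    exact measurableSet_wordCylinder w

lemma signedMeasure_ext {μ ν : SignedMeasure (ℕ → Fin N)}
    (h : ∀ w, μ (wordCylinder w) = ν (wordCylinder w)) : μ = ν := by
  refine VectorMeasure.ext_of_generateFrom _ ?_ generateFrom_wordCylinder
    isPiSystem_wordCylinder ?_
  · rintro _ ⟨w, rfl⟩
    exact h w
  · rw [← wordCylinder_nil]
    exact h []

end ShiftSpace

/-! ### Mutual energy measures -/

namespace HarmonicStructure

open SelfSimilarStructure ShiftSpace

variable {K : Type*} [TopologicalSpace K] {N : ℕ} {L : PCFStructure K N} (H : HarmonicStructure L)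

lemma tendsto_energy_polarized {u v : C(K, ℝ)} (hu : u ∈ H.domain) (hv : v ∈ H.domain) :
    Tendsto (fun m => H.E m u v) atTop
      (𝓝 ((1 / 4) * (H.energy (u + v) (u + v) - H.energy (u - v) (u - v)))) := by
  have h1 := H.tendsto_energy (H.domain.add_mem hu hv)
  have h2 := H.tendsto_energy (H.domain.sub_mem hu hv)
  refine ((h1.sub h2).const_mul (1 / 4)).congr fun m => ?_
  have h3 : ((u - v : C(K, ℝ)) : K → ℝ) = u + (-1 : ℝ) • v := by
    funext x; simp [sub_eq_add_neg]
  rw [h3, ContinuousMap.coe_add]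
  simp only [E_add_left, E_add_right, E_smul_left, E_smul_right, H.E_comm m v u]
  ring

lemma energy_polarized {u v : C(K, ℝ)} (hu : u ∈ H.domain) (hv : v ∈ H.domain) :
    H.energy u v = (1 / 4) * (H.energy (u + v) (u + v) - H.energy (u - v) (u - v)) :=
  (H.tendsto_energy_polarized hu hv).limUnder_eq

lemma tendsto_E_energy {u v : C(K, ℝ)} (hu : u ∈ H.domain) (hv : v ∈ H.domain) :
    Tendsto (fun m => H.E m u v) atTop (𝓝 (H.energy u v)) := by
  rw [H.energy_polarized hu hv]
  exact H.tendsto_energy_polarized hu hv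

lemma toSignedMeasure_wordCylinder (f : H.domain) (w : List (Fin N)) :
    (H.energyMeasure f).toSignedMeasure (wordCylinder w) = 2 * ((H.rWord w)⁻¹ *
      H.energy ((f : C(K, ℝ)).comp (L.wordMap w)) ((f : C(K, ℝ)).comp (L.wordMap w))) := by
  rw [Measure.toSignedMeasure_apply_measurable (measurableSet_wordCylinder w), Measure.real,
    energyMeasure_wordCylinder, ENNReal.toReal_ofReal]
  have h1 := H.energy_nonneg (H.comp_wordMap_mem f.2 w)
  have h2 := H.rWord_pos w
  positivity

lemma mutualEnergyMeasure_wordCylinder (f g : H.domain) (w : List (Fin N)) :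
    H.mutualEnergyMeasure f g (wordCylinder w) = 2 * ((H.rWord w)⁻¹ *
      H.energy ((f : C(K, ℝ)).comp (L.wordMap w)) ((g : C(K, ℝ)).comp (L.wordMap w))) := by
  rw [mutualEnergyMeasure, _root_.smul_apply, _root_.sub_apply,
    toSignedMeasure_wordCylinder, toSignedMeasure_wordCylinder,
    H.energy_polarized (H.comp_wordMap_mem f.2 w) (H.comp_wordMap_mem g.2 w), smul_eq_mul]
  have h1 : ((f + g : H.domain) : C(K, ℝ)).comp (L.wordMap w) =
    (f : C(K, ℝ)).comp (L.wordMap w) + (g : C(K, ℝ)).comp (L.wordMap w) := rfl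
  have h2 : ((f - g : H.domain) : C(K, ℝ)).comp (L.wordMap w) =
    (f : C(K, ℝ)).comp (L.wordMap w) - (g : C(K, ℝ)).comp (L.wordMap w) := rfl
  rw [h1, h2]
  ring

lemma mutualEnergyMeasure_self (f : H.domain) :
    H.mutualEnergyMeasure f f = (H.energyMeasure f).toSignedMeasure :=
  signedMeasure_ext fun w => by
    rw [mutualEnergyMeasure_wordCylinder, toSignedMeasure_wordCylinder]

lemma mutualEnergyMeasure_comm (f g : H.domain) :
    H.mutualEnergyMeasure f g = H.mutualEnergyMeasure g f :=
  signedMeasure_ext fun w => by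
    simp only [mutualEnergyMeasure_wordCylinder, energy, H.E_comm _ ((f : C(K, ℝ)).comp _)]

lemma mutualEnergyMeasure_add_left (f g h : H.domain) :
    H.mutualEnergyMeasure (f + g) h = H.mutualEnergyMeasure f h + H.mutualEnergyMeasure g h := by
  refine signedMeasure_ext fun w => ?_
  rw [_root_.add_apply]
  simp only [mutualEnergyMeasure_wordCylinder]
  have hf := H.comp_wordMap_mem f.2 w
  have hg := H.comp_wordMap_mem g.2 w
  have hh := H.comp_wordMap_mem h.2 w
  have h1 : H.energy (((f + g : H.domain) : C(K, ℝ)).comp (L.wordMap w))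
      ((h : C(K, ℝ)).comp (L.wordMap w)) =
      H.energy ((f : C(K, ℝ)).comp (L.wordMap w)) ((h : C(K, ℝ)).comp (L.wordMap w)) +
      H.energy ((g : C(K, ℝ)).comp (L.wordMap w)) ((h : C(K, ℝ)).comp (L.wordMap w)) := by
    refine tendsto_nhds_unique (H.tendsto_E_energy (H.comp_wordMap_mem (f + g).2 w) hh) ?_
    refine ((H.tendsto_E_energy hf hh).add (H.tendsto_E_energy hg hh)).congr fun m => ?_
    rw [← E_add_left]
    rfl
  rw [h1]
  ring

lemma mutualEnergyMeasure_smul_left (c : ℝ) (f h : H.domain) :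
    H.mutualEnergyMeasure (c • f) h = c • H.mutualEnergyMeasure f h := by
  refine signedMeasure_ext fun w => ?_
  rw [_root_.smul_apply]
  simp only [mutualEnergyMeasure_wordCylinder]
  have hf := H.comp_wordMap_mem f.2 w
  have hh := H.comp_wordMap_mem h.2 w
  have h1 : H.energy (((c • f : H.domain) : C(K, ℝ)).comp (L.wordMap w))
      ((h : C(K, ℝ)).comp (L.wordMap w)) =
      c * H.energy ((f : C(K, ℝ)).comp (L.wordMap w)) ((h : C(K, ℝ)).comp (L.wordMap w)) := by
    refine tendsto_nhds_unique (H.tendsto_E_energy (H.comp_wordMap_mem (c • f).2 w) hh) ?_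
    refine ((H.tendsto_E_energy hf hh).const_mul c).congr fun m => ?_
    rw [← E_smul_left]
    rfl
  rw [h1, smul_eq_mul]
  ring

lemma mutualEnergyMeasure_add_right (f g h : H.domain) :
    H.mutualEnergyMeasure h (f + g) = H.mutualEnergyMeasure h f + H.mutualEnergyMeasure h g := by
  rw [mutualEnergyMeasure_comm, mutualEnergyMeasure_add_left, H.mutualEnergyMeasure_comm f,
    H.mutualEnergyMeasure_comm g]

lemma mutualEnergyMeasure_smul_right (c : ℝ) (f h : H.domain) :
    H.mutualEnergyMeasure h (c • f) = c • H.mutualEnergyMeasure h f := by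
  rw [mutualEnergyMeasure_comm, mutualEnergyMeasure_smul_left, H.mutualEnergyMeasure_comm f]

lemma toSignedMeasure_energyMeasure_add_smul (f g : H.domain) (t : ℝ) :
    (H.energyMeasure (f + t • g)).toSignedMeasure = H.mutualEnergyMeasure f f +
      (2 * t) • H.mutualEnergyMeasure f g + (t ^ 2) • H.mutualEnergyMeasure g g := by
  rw [← mutualEnergyMeasure_self, mutualEnergyMeasure_add_left, mutualEnergyMeasure_add_right,
    mutualEnergyMeasure_add_right, mutualEnergyMeasure_smul_left, mutualEnergyMeasure_smul_left,
    mutualEnergyMeasure_smul_right, mutualEnergyMeasure_smul_right, H.mutualEnergyMeasure_comm g f,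
    smul_smul, two_mul, add_smul, pow_two]
  abel

/-- The parallelogram law for energy measures. -/
lemma energyMeasure_parallelogram (f g : H.domain) {s : Set (ℕ → Fin N)} (hs : MeasurableSet s) :
    (H.energyMeasure (f + g)).real s + (H.energyMeasure (f - g)).real s =
      2 * (H.energyMeasure f).real s + 2 * (H.energyMeasure g).real s := by
  have h1 := H.toSignedMeasure_energyMeasure_add_smul f g 1
  have h2 := H.toSignedMeasure_energyMeasure_add_smul f g (-1)
  rw [one_smul] at h1
  rw [neg_one_smul ℝ g, ← sub_eq_add_neg] at h2
  have h3 := congrArg (fun μ : SignedMeasure (ℕ → Fin N) => μ s) h1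
  have h4 := congrArg (fun μ : SignedMeasure (ℕ → Fin N) => μ s) h2
  simp only [_root_.add_apply, _root_.smul_apply, mutualEnergyMeasure_self,
    Measure.toSignedMeasure_apply_measurable hs, smul_eq_mul] at h3 h4
  linarith

variable {H}

lemma energyMeasure_add_sub_eq_zero {f g : H.domain} {s : Set (ℕ → Fin N)} (hs : MeasurableSet s)
    (hf : H.energyMeasure f s = 0) (hg : H.energyMeasure g s = 0) :
    H.energyMeasure (f + g) s = 0 ∧ H.energyMeasure (f - g) s = 0 := by
  have h := H.energyMeasure_parallelogram f g hs
  simp only [measureReal_def, hf, hg, ENNReal.toReal_zero, mul_zero, add_zero] at h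
  have h1 := ENNReal.toReal_nonneg (a := H.energyMeasure (f + g) s)
  have h2 := ENNReal.toReal_nonneg (a := H.energyMeasure (f - g) s)
  constructor
  · exact ((ENNReal.toReal_eq_zero_iff _).1 (by linarith)).resolve_right (measure_ne_top _ _)
  · exact ((ENNReal.toReal_eq_zero_iff _).1 (by linarith)).resolve_right (measure_ne_top _ _)

variable {lam : Measure (ℕ → Fin N)}

lemma absolutelyContinuous_energyMeasure_add {f g : H.domain} (hf : H.energyMeasure f ≪ lam)
    (hg : H.energyMeasure g ≪ lam) : H.energyMeasure (f + g) ≪ lam :=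
  Measure.AbsolutelyContinuous.mk fun _ hs h0 =>
    (energyMeasure_add_sub_eq_zero hs (hf h0) (hg h0)).1

lemma absolutelyContinuous_mutualEnergyMeasure {f g : H.domain} (hf : H.energyMeasure f ≪ lam)
    (hg : H.energyMeasure g ≪ lam) :
    H.mutualEnergyMeasure f g ≪ᵥ lam.toENNRealVectorMeasure := by
  refine VectorMeasure.AbsolutelyContinuous.mk fun s hs h0 => ?_
  rw [Measure.toENNRealVectorMeasure_apply_measurable hs] at h0
  obtain ⟨h1, h2⟩ := energyMeasure_add_sub_eq_zero hs (hf h0) (hg h0)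
  rw [mutualEnergyMeasure, _root_.smul_apply, _root_.sub_apply,
    Measure.toSignedMeasure_apply_measurable hs, Measure.toSignedMeasure_apply_measurable hs,
    measureReal_def, measureReal_def, h1, h2]
  simp

/-! ### Densities of energy measures -/

variable (H lam)

/-- The density `Z^{f,g} = dλ_⟨f,g⟩ / dλ`. -/
def energyDensity (f g : H.domain) : (ℕ → Fin N) → ℝ := (H.mutualEnergyMeasure f g).rnDeriv lam

lemma measurable_energyDensity (f g : H.domain) : Measurable (H.energyDensity lam f g) :=
  SignedMeasure.measurable_rnDeriv _ _

lemma integrable_energyDensity (f g : H.domain) : Integrable (H.energyDensity lam f g) lam :=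
  SignedMeasure.integrable_rnDeriv _ _

variable {H lam}

lemma energyDensity_comm (f g : H.domain) : H.energyDensity lam f g = H.energyDensity lam g f := by
  rw [energyDensity, mutualEnergyMeasure_comm, energyDensity]

variable [IsFiniteMeasure lam]

lemma withDensityᵥ_energyDensity {f g : H.domain} (hf : H.energyMeasure f ≪ lam)
    (hg : H.energyMeasure g ≪ lam) :
    lam.withDensityᵥ (H.energyDensity lam f g) = H.mutualEnergyMeasure f g :=
  SignedMeasure.withDensityᵥ_rnDeriv_eq _ _ (absolutelyContinuous_mutualEnergyMeasure hf hg)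

lemma setIntegral_energyDensity {f g : H.domain} (hf : H.energyMeasure f ≪ lam)
    (hg : H.energyMeasure g ≪ lam) {s : Set (ℕ → Fin N)} (hs : MeasurableSet s) :
    ∫ ω in s, H.energyDensity lam f g ω ∂lam = H.mutualEnergyMeasure f g s := by
  rw [← withDensityᵥ_energyDensity hf hg, withDensityᵥ_apply (H.integrable_energyDensity lam f g) hs]

lemma energyDensity_add_left {f g h : H.domain} (hf : H.energyMeasure f ≪ lam)
    (hg : H.energyMeasure g ≪ lam) (hh : H.energyMeasure h ≪ lam) :
    H.energyDensity lam (f + g) h =ᵐ[lam] H.energyDensity lam f h + H.energyDensity lam g h := by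
  refine (H.integrable_energyDensity lam _ _).ae_eq_of_withDensityᵥ_eq
    ((H.integrable_energyDensity lam _ _).add (H.integrable_energyDensity lam _ _)) ?_
  rw [withDensityᵥ_energyDensity (absolutelyContinuous_energyMeasure_add hf hg) hh,
    withDensityᵥ_add (H.integrable_energyDensity lam _ _) (H.integrable_energyDensity lam _ _),
    withDensityᵥ_energyDensity hf hh, withDensityᵥ_energyDensity hg hh,
    mutualEnergyMeasure_add_left]

/-- The density matrices are positive semidefinite almost everywhere. -/
lemma ae_energyDensity_posSemidef {f g : H.domain} (hf : H.energyMeasure f ≪ lam)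
    (hg : H.energyMeasure g ≪ lam) :
    ∀ᵐ ω ∂lam, 0 ≤ H.energyDensity lam f f ω ∧ 0 ≤ H.energyDensity lam g g ω ∧
      H.energyDensity lam f g ω ^ 2 ≤ H.energyDensity lam f f ω * H.energyDensity lam g g ω := by
  have hnn : ∀ {f g : H.domain}, H.energyMeasure f ≪ lam → H.energyMeasure g ≪ lam → ∀ t : ℝ,
      ∀ᵐ ω ∂lam, 0 ≤ H.energyDensity lam f f ω + (2 * t) * H.energyDensity lam f g ω +
        t ^ 2 * H.energyDensity lam g g ω := by
    intro f g hf hg t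
    have i1 := H.integrable_energyDensity lam f f
    have i2 := (H.integrable_energyDensity lam f g).const_mul (2 * t)
    have i3 := (H.integrable_energyDensity lam g g).const_mul (t ^ 2)
    have i12 : Integrable (fun ω => H.energyDensity lam f f ω +
      (2 * t) * H.energyDensity lam f g ω) lam := i1.add i2
    refine ae_nonneg_of_forall_setIntegral_nonneg (i12.add i3) fun s hs _ => ?_
    have h := congrArg (fun μ : SignedMeasure (ℕ → Fin N) => μ s)
      (H.toSignedMeasure_energyMeasure_add_smul f g t)
    simp only [_root_.add_apply, _root_.smul_apply,
      Measure.toSignedMeasure_apply_measurable hs, smul_eq_mul] at h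
    have hsum : ∫ ω in s, (H.energyDensity lam f f ω + (2 * t) * H.energyDensity lam f g ω +
        t ^ 2 * H.energyDensity lam g g ω) ∂lam = (H.energyMeasure (f + t • g)).real s := by
      rw [integral_add i12.integrableOn i3.integrableOn,
        integral_add i1.integrableOn i2.integrableOn, integral_const_mul, integral_const_mul,
        setIntegral_energyDensity hf hf hs, setIntegral_energyDensity hf hg hs,
        setIntegral_energyDensity hg hg hs, h]
    exact hsum ▸ measureReal_nonneg
  have hrat : ∀ᵐ ω ∂lam, ∀ t : ℚ, 0 ≤ H.energyDensity lam f f ω +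
      (2 * (t : ℝ)) * H.energyDensity lam f g ω + (t : ℝ) ^ 2 * H.energyDensity lam g g ω :=
    ae_all_iff.2 fun t => hnn hf hg t
  filter_upwards [hrat, hnn hf hg 0, hnn hg hf 0] with ω h hf0 hg0
  have hreal : ∀ t : ℝ, 0 ≤ H.energyDensity lam f f ω +
      (2 * t) * H.energyDensity lam f g ω + t ^ 2 * H.energyDensity lam g g ω := fun t =>
    Rat.denseRange_cast.induction_on (p := fun t : ℝ => 0 ≤ H.energyDensity lam f f ω +
      (2 * t) * H.energyDensity lam f g ω + t ^ 2 * H.energyDensity lam g g ω) t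
      (isClosed_le continuous_const (by fun_prop)) h
  refine ⟨by simpa using hf0, by simpa using hg0, ?_⟩
  have hq : ∀ t : ℝ, 0 ≤ H.energyDensity lam g g ω * (t * t) +
      2 * H.energyDensity lam f g ω * t + H.energyDensity lam f f ω := fun t => by
    have := hreal t
    nlinarith
  have := discrim_le_zero hq
  rw [discrim] at this
  nlinarith

variable [CompactSpace K] [T2Space K] [ConnectedSpace K]

lemma IsTransferred.mutualEnergyMeasure_wordCylinder {m : ℕ} {f g : H.domain}
    (hf : H.IsTransferred m (f : C(K, ℝ))) (hg : H.IsTransferred m (g : C(K, ℝ)))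
    {w : List (Fin N)} (hw : m ≤ w.length) : H.mutualEnergyMeasure f g (wordCylinder w) =
      2 * ((H.rWord w)⁻¹ * H.E0 (cellValues (f : C(K, ℝ)) w) (cellValues (g : C(K, ℝ)) w)) := by
  rw [H.mutualEnergyMeasure_wordCylinder]
  congr 2
  refine tendsto_nhds_unique
    (H.tendsto_E_energy (H.comp_wordMap_mem f.2 w) (H.comp_wordMap_mem g.2 w)) ?_
  simp only [fun n => hf.E_eq hg n w hw]
  exact tendsto_const_nhds

/-- The density matrix of two piecewise harmonic functions is singular almost everywhere: the
integral of the square root of its determinant over a cylinder set is at most the sum of the areas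
over any finer level, and these sums tend to zero. -/
theorem ae_energyDensity_mul_eq_sq (hreg : H.IsRegular)
    (hstar : ∀ p ∈ L.V0, (∃ i, L.ψ i p = p) ∧ IsConnected ({p}ᶜ : Set K)) {m : ℕ} {f g : H.domain}
    (hf : H.IsTransferred m (f : C(K, ℝ))) (hg : H.IsTransferred m (g : C(K, ℝ)))
    (hfl : H.energyMeasure f ≪ lam) (hgl : H.energyMeasure g ≪ lam) :
    ∀ᵐ ω ∂lam, H.energyDensity lam f f ω * H.energyDensity lam g g ω =
      H.energyDensity lam f g ω ^ 2 := by
  set φ : (ℕ → Fin N) → ℝ := fun ω => √(H.energyDensity lam f f ω * H.energyDensity lam g g ω -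
    H.energyDensity lam f g ω ^ 2)
  have hpsd := ae_energyDensity_posSemidef hfl hgl
  have hgram : ∀ s : Set (ℕ → Fin N), IntegrableOn φ s lam ∧ ∫ ω in s, φ ω ∂lam ≤
      √((∫ ω in s, H.energyDensity lam f f ω ∂lam) * (∫ ω in s, H.energyDensity lam g g ω ∂lam) -
        (∫ ω in s, H.energyDensity lam f g ω ∂lam) ^ 2) := fun s =>
    integral_sqrt_det_le (H.integrable_energyDensity lam f f).integrableOn
      (H.integrable_energyDensity lam g g).integrableOn
      (H.integrable_energyDensity lam f g).integrableOn
      (ae_restrict_of_ae (hpsd.mono fun _ h => h.1))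
      (ae_restrict_of_ae (hpsd.mono fun _ h => h.2.1))
      (ae_restrict_of_ae (hpsd.mono fun _ h => h.2.2))
  have hbound : ∀ (n : ℕ) (w : List (Fin N)), m ≤ w.length →
      ∫ ω in wordCylinder w, φ ω ∂lam ≤ 2 * ((H.rWord w)⁻¹ * (H.cellSum)^[n] H.area
        (cellValues (f : C(K, ℝ)) w) (cellValues (g : C(K, ℝ)) w)) := by
    intro n
    induction n with
    | zero =>
      intro w hw
      refine (hgram _).2.trans (le_of_eq ?_)
      have hs := measurableSet_wordCylinder w
      rw [setIntegral_energyDensity hfl hfl hs, setIntegral_energyDensity hgl hgl hs,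
        setIntegral_energyDensity hfl hgl hs, hf.mutualEnergyMeasure_wordCylinder hf hw,
        hg.mutualEnergyMeasure_wordCylinder hg hw, hf.mutualEnergyMeasure_wordCylinder hg hw,
        Function.iterate_zero, id, area, ← mul_assoc 2 (H.rWord w)⁻¹ √_]
      have hr := inv_pos.2 (H.rWord_pos w)
      rw [← Real.sqrt_sq (show 0 ≤ 2 * (H.rWord w)⁻¹ by positivity), ← Real.sqrt_mul (sq_nonneg _)]
      congr 1
      ring
    | succ n ih =>
      intro w hw
      rw [wordCylinder_eq_iUnion, integral_iUnion_fintype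
        (fun i => measurableSet_wordCylinder _) (pairwise_disjoint_wordCylinder w)
        (fun i => (hgram _).1), Function.iterate_succ_apply', cellSum, Finset.mul_sum,
        Finset.mul_sum]
      refine Finset.sum_le_sum fun i _ => (ih (w ++ [i]) (by simp; omega)).trans (le_of_eq ?_)
      rw [hf w hw, hg w hw, rWord_append, mul_inv, mul_assoc]
  have hzero : ∀ w : List (Fin N), m ≤ w.length → ∀ᵐ ω ∂lam, ω ∈ wordCylinder w → φ ω = 0 := by
    intro w hw
    have hle : ∫ ω in wordCylinder w, φ ω ∂lam ≤ 0 := by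
      refine le_of_forall_pos_le_add fun ε hε => ?_
      have hr := H.rWord_pos w
      obtain ⟨n, hn⟩ := H.exists_cellSum_iterate_lt hreg hstar (cellValues (f : C(K, ℝ)) w)
        (cellValues (g : C(K, ℝ)) w) (ε := H.rWord w * ε / 2) (by positivity)
      refine (hbound n w hw).trans ?_
      rw [zero_add]
      calc 2 * ((H.rWord w)⁻¹ * (H.cellSum)^[n] H.area (cellValues (f : C(K, ℝ)) w)
            (cellValues (g : C(K, ℝ)) w))
          ≤ 2 * ((H.rWord w)⁻¹ * (H.rWord w * ε / 2)) := by gcongr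
        _ = ε := by field_simp
    have h0 : ∫ ω in wordCylinder w, φ ω ∂lam = 0 :=
      le_antisymm hle (integral_nonneg fun _ => Real.sqrt_nonneg _)
    rw [setIntegral_eq_zero_iff_of_nonneg_ae (Eventually.of_forall fun _ => Real.sqrt_nonneg _)
      (hgram _).1] at h0
    exact (ae_restrict_iff' (measurableSet_wordCylinder w)).1 h0
  have hall : ∀ᵐ ω ∂lam, ∀ w : List (Fin N), m ≤ w.length → ω ∈ wordCylinder w → φ ω = 0 :=
    ae_all_iff.2 fun w => by
      by_cases hw : m ≤ w.length
      · exact (hzero w hw).mono fun ω h _ => h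
      · exact Eventually.of_forall fun ω h => (hw h).elim
  filter_upwards [hall, hpsd] with ω h1 h2
  have h3 := h1 (initWord ω m) (length_initWord ω m).ge
    ((mem_wordCylinder_iff _ _).2 (by rw [length_initWord]))
  have h4 := Real.sqrt_eq_zero'.1 h3
  linarith [h2.2.2]

/-- The mixed `2 × 2` minors of the density matrix vanish, by polarization. -/
theorem ae_energyDensity_mul_eq_mul (hreg : H.IsRegular)
    (hstar : ∀ p ∈ L.V0, (∃ i, L.ψ i p = p) ∧ IsConnected ({p}ᶜ : Set K)) {f g h : H.domain}
    (hf : H.IsPiecewiseHarmonic f) (hg : H.IsPiecewiseHarmonic g) (hh : H.IsPiecewiseHarmonic h)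
    (hfl : H.energyMeasure f ≪ lam) (hgl : H.energyMeasure g ≪ lam)
    (hhl : H.energyMeasure h ≪ lam) :
    ∀ᵐ ω ∂lam, H.energyDensity lam f g ω * H.energyDensity lam h h ω =
      H.energyDensity lam f h ω * H.energyDensity lam g h ω := by
  obtain ⟨a, ha⟩ := hf.exists_isTransferred H hreg
  obtain ⟨b, hb⟩ := hg.exists_isTransferred H hreg
  obtain ⟨c, hc⟩ := hh.exists_isTransferred H hreg
  replace ha := ha.mono (show a ≤ a + b + c by omega)
  replace hb := hb.mono (show b ≤ a + b + c by omega)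
  replace hc := hc.mono (show c ≤ a + b + c by omega)
  have hfgl := absolutelyContinuous_energyMeasure_add hfl hgl
  filter_upwards [ae_energyDensity_mul_eq_sq hreg hstar ha hc hfl hhl,
    ae_energyDensity_mul_eq_sq hreg hstar hb hc hgl hhl,
    ae_energyDensity_mul_eq_sq (f := f + g) hreg hstar (ha.add hb) hc hfgl hhl,
    energyDensity_add_left hfl hgl hhl, energyDensity_add_left hfl hgl hfgl,
    energyDensity_add_left hfl hgl hfl, energyDensity_add_left hfl hgl hgl]
    with ω h1 h2 h3 h4 h5 h6 h7
  rw [energyDensity_comm f, energyDensity_comm g, Pi.add_apply, h6, h7] at h5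
  simp only [Pi.add_apply] at h4 h5 h6 h7
  rw [h5, h4] at h3
  rw [energyDensity_comm g f] at h3
  linarith

end HarmonicStructure

/-! ### Factorization of matrices of rank one -/

lemma eRank_eq_one_of_eq_mul {I : Type*} {A : Matrix I I ℝ} {ζ : I → ℝ}
    (h : ∀ i j, A i j = ζ i * ζ j) (hζ : ζ ≠ 0) : A.eRank = 1 := by
  have hspan : Submodule.span ℝ (Set.range A.col) = Submodule.span ℝ {ζ} := by
    apply le_antisymm
    · rw [Submodule.span_le]
      rintro _ ⟨j, rfl⟩
      refine Submodule.mem_span_singleton.2 ⟨ζ j, ?_⟩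
      funext i
      simp [Matrix.col_apply, h, mul_comm]
    · obtain ⟨j, hj⟩ := Function.ne_iff.1 hζ
      rw [Submodule.span_singleton_le_iff_mem]
      have hj' : ζ j ≠ 0 := hj
      have : ζ = (ζ j)⁻¹ • A.col j := by
        funext i
        simp only [Pi.smul_apply, Matrix.col_apply, h, smul_eq_mul]
        field_simp
      rw [this]
      exact Submodule.smul_mem _ _ (Submodule.subset_span ⟨j, rfl⟩)
  rw [Matrix.eRank, Matrix.cRank, hspan, ← Module.finrank_eq_rank, finrank_span_singleton hζ]
  simp

/-- If the mixed minors of a countable matrix of measurable functions vanish and some diagonal entry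
is positive, then it factors through one vector: a normalized column, selected measurably. -/
lemma exists_measurable_factor {Ω I : Type*} [MeasurableSpace Ω] [Countable I] [Nonempty I]
    {μ : Measure Ω} {Z : I → I → Ω → ℝ} (hZ : ∀ i j, Measurable (Z i j))
    (hminor : ∀ i j k, ∀ᵐ ω ∂μ, Z i j ω * Z k k ω = Z i k ω * Z j k ω)
    (hpos : ∀ᵐ ω ∂μ, ∃ i, 0 < Z i i ω) :
    ∃ ζ : I → Ω → ℝ, (∀ i, Measurable (ζ i)) ∧ ∀ i j, ∀ᵐ ω ∂μ, Z i j ω = ζ i ω * ζ j ω := by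
  classical
  obtain ⟨s, hs⟩ := exists_surjective_nat I
  -- the second alternative only serves to make the search total
  let P : Ω → ℕ → Prop := fun ω n => 0 < Z (s n) (s n) ω ∨ ∀ m, Z (s m) (s m) ω ≤ 0
  have hP : ∀ ω, ∃ n, P ω n := fun ω => by
    by_cases h : ∃ n, 0 < Z (s n) (s n) ω
    · exact h.imp fun n hn => Or.inl hn
    · push Not at h
      exact ⟨0, Or.inr h⟩
  have hPm : ∀ n, MeasurableSet {ω | P ω n} := fun n => by
    have h : MeasurableSet {ω | ∀ m, Z (s m) (s m) ω ≤ 0} := by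
      simp only [Set.ofPred_forall]
      exact MeasurableSet.iInter fun m => measurableSet_le (hZ _ _) measurable_const
    exact (measurableSet_lt measurable_const (hZ _ _)).union h
  have hν : Measurable fun ω => Nat.find (hP ω) := measurable_find hP hPm
  have hsel : ∀ F : ℕ → Ω → ℝ, (∀ n, Measurable (F n)) →
      Measurable fun ω => F (Nat.find (hP ω)) ω := fun F hF =>
    (measurable_from_prod_countable_left (f := fun x : Ω × ℕ => F x.2 x.1) hF).comp
      (measurable_id.prodMk hν)
  refine ⟨fun i ω => Z i (s (Nat.find (hP ω))) ω /
    √(Z (s (Nat.find (hP ω))) (s (Nat.find (hP ω))) ω), fun i => ?_, fun i j => ?_⟩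
  · exact hsel (fun n ω => Z i (s n) ω / √(Z (s n) (s n) ω)) fun n => (hZ _ _).div (hZ _ _).sqrt
  · filter_upwards [hpos, ae_all_iff.2 (hminor i j)] with ω h1 h2
    have hk : 0 < Z (s (Nat.find (hP ω))) (s (Nat.find (hP ω))) ω := by
      refine (Nat.find_spec (hP ω)).resolve_right fun h => ?_
      obtain ⟨i, hi⟩ := h1
      obtain ⟨m, rfl⟩ := hs i
      exact absurd hi (not_lt.2 (h m))
    rw [div_mul_div_comm, Real.mul_self_sqrt hk.le, ← h2, mul_div_assoc, div_self hk.ne', mul_one]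

theorem proposition3 {K : Type*} [TopologicalSpace K] [CompactSpace K]
    [TopologicalSpace.MetrizableSpace K] [ConnectedSpace K] {N : ℕ} (L : PCFStructure K N)
    (hstar : ∀ p ∈ L.V0, (∃ i, L.ψ i p = p) ∧ IsConnected ({p}ᶜ : Set K))
    (H : HarmonicStructure L) (hreg : H.IsRegular)
    {I : Type*} [Countable I] (e : I → H.domain)
    (he : ∀ i, H.IsPiecewiseHarmonic (e i))
    (he_energy : ∀ i, 2 * H.energy (e i) (e i) = 1)
    (a : I → ℝ) (ha_pos : ∀ i, 0 < a i) (ha_sum : HasSum a 1)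
    (lam : Measure (ℕ → Fin N))
    (hlam : lam = Measure.sum fun i => ENNReal.ofReal (a i) • H.energyMeasure (e i)) :
    (∀ i j, H.mutualEnergyMeasure (e i) (e j) ≪ᵥ lam.toENNRealVectorMeasure) ∧
    ∃ ζ : I → (ℕ → Fin N) → ℝ, (∀ i, Measurable (ζ i)) ∧
      (∀ i j, ∀ᵐ ω ∂lam,
        (H.mutualEnergyMeasure (e i) (e j)).rnDeriv lam ω = ζ i ω * ζ j ω) ∧
      ∀ᵐ ω ∂lam, (Matrix.of fun i j =>
        (H.mutualEnergyMeasure (e i) (e j)).rnDeriv lam ω).eRank = 1 := by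
  have hI : Nonempty I := by
    by_contra h
    rw [not_nonempty_iff] at h
    exact zero_ne_one ((hasSum_empty (f := a)).unique ha_sum)
  have happly : ∀ s, MeasurableSet s →
      lam s = ∑' i, ENNReal.ofReal (a i) * H.energyMeasure (e i) s := fun s hs => by
    rw [hlam, Measure.sum_apply _ hs]
    simp
  have huniv : ∀ i, H.energyMeasure (e i) Set.univ = 1 := fun i => by
    rw [← ShiftSpace.wordCylinder_nil, H.energyMeasure_wordCylinder]
    have h1 : ((e i : C(K, ℝ))).comp (L.wordMap []) = e i := rfl
    rw [h1]
    simp [HarmonicStructure.rWord, he_energy i]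
  have hfin : IsFiniteMeasure lam := by
    refine ⟨?_⟩
    rw [happly _ MeasurableSet.univ]
    simp only [huniv, mul_one]
    rw [← ENNReal.ofReal_tsum_of_nonneg (fun i => (ha_pos i).le) ha_sum.summable]
    exact ENNReal.ofReal_lt_top
  have hac : ∀ i, H.energyMeasure (e i) ≪ lam := fun i =>
    Measure.AbsolutelyContinuous.mk fun s hs h0 => by
      rw [happly s hs, ENNReal.tsum_eq_zero] at h0
      exact (mul_eq_zero.1 (h0 i)).resolve_left (ENNReal.ofReal_pos.2 (ha_pos i)).ne'
  let Z : I → I → (ℕ → Fin N) → ℝ := fun i j => H.energyDensity lam (e i) (e j)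
  have hZ : ∀ i j, Measurable (Z i j) := fun i j => H.measurable_energyDensity lam _ _
  have hpos : ∀ᵐ ω ∂lam, ∃ i, 0 < Z i i ω := by
    have hB : MeasurableSet {ω | ∀ i, Z i i ω ≤ 0} := by
      simp only [Set.ofPred_forall]
      exact MeasurableSet.iInter fun i => measurableSet_le (hZ i i) measurable_const
    have h0 : lam {ω | ∀ i, Z i i ω ≤ 0} = 0 := by
      rw [happly _ hB, ENNReal.tsum_eq_zero]
      intro i
      have h1 : ∫ ω in {ω | ∀ i, Z i i ω ≤ 0}, Z i i ω ∂lam ≤ 0 :=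
        setIntegral_nonpos hB fun ω hω => hω i
      have h2 := HarmonicStructure.setIntegral_energyDensity (hac i) (hac i) hB
      rw [H.mutualEnergyMeasure_self, Measure.toSignedMeasure_apply_measurable hB] at h2
      have h3 : (H.energyMeasure (e i)).real {ω | ∀ i, Z i i ω ≤ 0} = 0 :=
        le_antisymm (h2 ▸ h1) measureReal_nonneg
      rw [(measureReal_eq_zero_iff (measure_ne_top _ _)).1 h3, mul_zero]
    rw [ae_iff]
    simpa only [not_exists, not_lt] using h0
  obtain ⟨ζ, hζm, hζ⟩ := exists_measurable_factor hZ (fun i j k =>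
    HarmonicStructure.ae_energyDensity_mul_eq_mul hreg hstar (he i) (he j) (he k) (hac i) (hac j)
      (hac k)) hpos
  refine ⟨fun i j => HarmonicStructure.absolutelyContinuous_mutualEnergyMeasure (hac i) (hac j),
    ζ, hζm, hζ, ?_⟩
  have hall : ∀ᵐ ω ∂lam, ∀ i j, Z i j ω = ζ i ω * ζ j ω :=
    ae_all_iff.2 fun i => ae_all_iff.2 fun j => hζ i j
  filter_upwards [hall, hpos] with ω h1 ⟨i, hi⟩
  refine eRank_eq_one_of_eq_mul (ζ := fun i => ζ i ω) h1 fun h0 => ?_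
  rw [h1 i i, show ζ i ω = 0 from congrFun h0 i] at hi
  simp at hi

end
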